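/- There are a constant $C>0$, a polynomial $q$ and a randomized mechanism for combinatorial auctions with explicitly given budget additive valuations that is universally truthful, runs in polynomial time and achieves an expected $O(\sqrt{\log m})$ approximation to the social welfare. In detail: A valuation on a set of $m$ items is a function $v$ from bundles (sets of items) to $\mathbb R$ with $v(\emptyset)=0$ and $v(S)\le v(T)$ for $S\subseteq T$. It is budget additive if there is a $b\in\mathbb R$ (a budget of $v$) with $v(S)=\min\bigl(b,\sum_{j\in S}v(\{j\})\bigr)$ for every bundle $S$. A deterministic mechanism for $n$ bidders maps every profile $v=(v_1,\dots,v_n)$ of budget additive valuations to an allocation $f(v)=(A_1,\dots,A_n)$ (pairwise disjoint bundles; items may stay unallocated) and payments $p_1(v),\dots,p_n(v)\in\mathbb R$. It is truthful if $v_i(f(v_i,v_{-i})_i)-p_i(v_i,v_{-i})\ge v_i(f(v_i',v_{-i})_i)-p_i(v_i',v_{-i})$ for all $i$, $v_i$, $v_i'$, $v_{-i}$. A randomized mechanism is a probability distribution over deterministic mechanisms, here given by independent fair coins; it is universally truthful if every deterministic mechanism in its support is truthful. Then there is one program such that for every number $n$ of bidders and $m$ of items there is a universally truthful randomized mechanism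 for $n$ bidders with budget additive valuations on $m$ items, which uses at most $q(n,m)$ coins, with the following properties. 1. (Running time.) Given $n$, $m$, the coins, the numbers $v_i(\{j\})$ and any budgets $b_i$ of the $v_i$, the program outputs the allocation and the payments of the mechanism within $q(n,m)$ steps. Steps are counted on a random access machine with integer and real registers whose arithmetic operations are addition, subtraction, comparison and halving of reals, at unit cost (so that, for rational data, it can be simulated in polynomial time by a Turing machine). 2. (Approximation.) If $m\ge 2$, then for every profile $v$ of budget additive valuations and every allocation $(O_1,\dots,O_n)$, in particular an optimal one, $$\sum_{i}v_i(O_i)\;\le\; C\sqrt{\log m}\cdot \mathbb E\Bigl[\sum_i v_i(A_i)\Bigr],$$ where $(A_1,\dots,A_n)$ is the allocation of the mechanism and the expectation is over its coins. The constant $C$ depends on nothing. -/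

import Mathlib

namespace BudgetAuction

/-! ### Combinatorial auctions -/

/-- A valuation on the items `Fin m`: a real set function that is normalized and nondecreasing. -/
structure Valuation (m : ℕ) where
  /-- the value of every bundle -/
  toFun : Finset (Fin m) → ℝ
  empty' : toFun ∅ = 0
  mono' : ∀ ⦃S T : Finset (Fin m)⦄, S ⊆ T → toFun S ≤ toFun T

instance (m : ℕ) : CoeFun (Valuation m) (fun _ => Finset (Fin m) → ℝ) := ⟨Valuation.toFun⟩

/-- `b` is a budget of `v`: every bundle `S` has value `min (b, ∑_{j ∈ S} v({j}))`. -/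
def IsBudget {m : ℕ} (v : Valuation m) (b : ℝ) : Prop :=
  ∀ S : Finset (Fin m), v S = min b (∑ j ∈ S, v {j})

/-- The set of budget additive valuations on `m` items. -/
def budgetAdditive (m : ℕ) : Set (Valuation m) :=
  {v | ∃ b : ℝ, IsBudget v b}

/-- An allocation of `m` items to `n` bidders: pairwise disjoint bundles.  Items may remain
unallocated. -/
structure Allocation (n m : ℕ) where
  /-- the bundle of every bidder -/
  bundle : Fin n → Finset (Fin m)
  disjoint' : ∀ i i' : Fin n, i ≠ i' → Disjoint (bundle i) (bundle i')

/-- The social welfare of an allocation. -/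
def welfare {n m : ℕ} {V : Set (Valuation m)} (v : Fin n → V) (A : Allocation n m) : ℝ :=
  ∑ i, (v i : Valuation m) (A.bundle i)

/-- A deterministic (direct revelation) `n`-bidder mechanism for valuations in `V`: an allocation
rule and a payment rule, both functions of the reported valuations. -/
structure Mechanism {m : ℕ} (V : Set (Valuation m)) (n : ℕ) where
  /-- the allocation rule -/
  alloc : (Fin n → V) → Allocation n m
  /-- the payment rule -/
  pay : (Fin n → V) → Fin n → ℝ

/-- Whatever the others report, no bidder can gain by reporting `v'` in place of the true
valuation `v i`. -/
def Mechanism.Truthful {m : ℕ} {V : Set (Valuation m)} {n : ℕ} (M : Mechanism V n) : Prop :=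
  ∀ (i : Fin n) (v : Fin n → V) (v' : V),
    (v i : Valuation m) ((M.alloc (Function.update v i v')).bundle i)
        - M.pay (Function.update v i v') i
      ≤ (v i : Valuation m) ((M.alloc v).bundle i) - M.pay v i

/-- A randomized mechanism that uses `ℓ` fair coins: a deterministic mechanism for each outcome of
the coins, the outcomes being equally likely. -/
def RandomizedMechanism {m : ℕ} (V : Set (Valuation m)) (n ℓ : ℕ) : Type :=
  (Fin ℓ → Bool) → Mechanism V n

/-- Every deterministic mechanism in the support of the distribution is truthful. -/
def RandomizedMechanism.UniversallyTruthful {m : ℕ} {V : Set (Valuation m)} {n ℓ : ℕ}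
    (M : RandomizedMechanism V n ℓ) : Prop :=
  ∀ r : Fin ℓ → Bool, (M r).Truthful

/-- The social welfare in expectation over the coins. -/
noncomputable def RandomizedMechanism.expectedWelfare {m : ℕ} {V : Set (Valuation m)} {n ℓ : ℕ}
    (M : RandomizedMechanism V n ℓ) (v : Fin n → V) : ℝ :=
  (∑ r : Fin ℓ → Bool, welfare v ((M r).alloc v)) / 2 ^ ℓ

/-! ### A random access machine with a step count

Programs manipulate two families of arrays, one holding natural numbers and one holding real
numbers, all indexed by pairs of natural numbers.  Every assignment and every test costs one step.
The arithmetic is addition and subtraction (and halving of reals); there is no multiplication, no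
rounding, no conversion between the two sorts and no real constant other than `0` and `1`.  Hence
in `T` steps on rational data of `L` bits all numbers keep `O(L + T)` bits, so a polynomial bound
on the number of steps here is also a polynomial bound on Turing machine time. -/

/-- A memory: entry `(i, j)` of the natural array `a` is `nat a i j`, and entry `(i, j)` of the
real array `a` is `val a i j`. -/
structure Mem where
  /-- the natural number arrays -/
  nat : ℕ → ℕ → ℕ → ℕ
  /-- the real number arrays -/
  val : ℕ → ℕ → ℕ → ℝ

/-- Store `x` in entry `(i, j)` of the natural array `a`. -/
def Mem.setNat (s : Mem) (a i j x : ℕ) : Mem :=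
  { s with nat := fun a' i' j' => if a' = a ∧ i' = i ∧ j' = j then x else s.nat a' i' j' }

/-- Store `x` in entry `(i, j)` of the real array `a`. -/
noncomputable def Mem.setVal (s : Mem) (a i j : ℕ) (x : ℝ) : Mem :=
  { s with val := fun a' i' j' => if a' = a ∧ i' = i ∧ j' = j then x else s.val a' i' j' }

/-- Natural number expressions (`sub` is truncated subtraction). -/
inductive NExp where
  | const (c : ℕ)
  | get (a : ℕ) (i j : NExp)
  | add (e f : NExp)
  | sub (e f : NExp)

/-- The value of a natural number expression. -/
def NExp.eval (s : Mem) : NExp → ℕ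
  | .const c => c
  | .get a i j => s.nat a (i.eval s) (j.eval s)
  | .add e f => e.eval s + f.eval s
  | .sub e f => e.eval s - f.eval s

/-- Real number expressions. -/
inductive VExp where
  | zero
  | one
  | get (a : ℕ) (i j : NExp)
  | add (e f : VExp)
  | sub (e f : VExp)
  | half (e : VExp)

/-- The value of a real number expression. -/
noncomputable def VExp.eval (s : Mem) : VExp → ℝ
  | .zero => 0
  | .one => 1
  | .get a i j => s.val a (i.eval s) (j.eval s)
  | .add e f => e.eval s + f.eval s
  | .sub e f => e.eval s - f.eval s
  | .half e => e.eval s / 2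

/-- Tests. -/
inductive Test where
  | natLe (e f : NExp)
  | valLe (e f : VExp)
  | neg (b : Test)
  | conj (b c : Test)

/-- The truth of a test. -/
def Test.Holds (s : Mem) : Test → Prop
  | .natLe e f => e.eval s ≤ f.eval s
  | .valLe e f => e.eval s ≤ f.eval s
  | .neg b => ¬ b.Holds s
  | .conj b c => b.Holds s ∧ c.Holds s

/-- Programs. `setNat a i j e` and `setVal a i j e` are the assignments `a[i, j] := e`, and
`loop b c` is "while `b` do `c`". -/
inductive Program where
  | skip
  | setNat (a : ℕ) (i j e : NExp)
  | setVal (a : ℕ) (i j : NExp) (e : VExp)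
  | seq (c d : Program)
  | ite (b : Test) (c d : Program)
  | loop (b : Test) (c : Program)

/-- `Exec c s s' t`: started in memory `s`, program `c` halts in memory `s'` after exactly `t`
steps. -/
inductive Exec : Program → Mem → Mem → ℕ → Prop where
  | skip (s : Mem) : Exec .skip s s 1
  | setNat (a : ℕ) (i j e : NExp) (s : Mem) :
      Exec (.setNat a i j e) s (s.setNat a (i.eval s) (j.eval s) (e.eval s)) 1
  | setVal (a : ℕ) (i j : NExp) (e : VExp) (s : Mem) :
      Exec (.setVal a i j e) s (s.setVal a (i.eval s) (j.eval s) (e.eval s)) 1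
  | seq {c d : Program} {s s' s'' : Mem} {t u : ℕ} :
      Exec c s s' t → Exec d s' s'' u → Exec (.seq c d) s s'' (t + u)
  | iteTrue {b : Test} {c d : Program} {s s' : Mem} {t : ℕ} :
      b.Holds s → Exec c s s' t → Exec (.ite b c d) s s' (t + 1)
  | iteFalse {b : Test} {c d : Program} {s s' : Mem} {t : ℕ} :
      ¬ b.Holds s → Exec d s s' t → Exec (.ite b c d) s s' (t + 1)
  | loopFalse {b : Test} {c : Program} {s : Mem} :
      ¬ b.Holds s → Exec (.loop b c) s s 1
  | loopTrue {b : Test} {c : Program} {s s' s'' : Mem} {t u : ℕ} :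
      b.Holds s → Exec c s s' t → Exec (.loop b c) s' s'' u →
        Exec (.loop b c) s s'' (t + u + 1)

/-! ### Auctions as inputs and outputs of programs -/

/-- The memory that holds `n` and `m` (natural array `0`, entries `(0, 0)` and `(0, 1)`), the coins
`r` (natural array `1`, row `0`), the item values `w i j` (real array `0`) and the budgets `b i`
(real array `1`, column `0`).  Everything else is `0`. -/
noncomputable def inputMem {n m ℓ : ℕ} (w : Fin n → Fin m → ℝ) (b : Fin n → ℝ)
    (r : Fin ℓ → Bool) : Mem where
  nat a i j :=
    if a = 0 ∧ i = 0 ∧ j = 0 then n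
    else if a = 0 ∧ i = 0 ∧ j = 1 then m
    else if a = 1 ∧ i = 0 then
      if h : j < ℓ then (if r ⟨j, h⟩ = true then 1 else 0) else 0
    else 0
  val a i j :=
    if a = 0 then
      if h : i < n ∧ j < m then w ⟨i, h.1⟩ ⟨j, h.2⟩ else 0
    else if a = 1 ∧ j = 0 then
      if h : i < n then b ⟨i, h⟩ else 0
    else 0

/-- The memory `s` shows the outcome `(A, p)`: item `j` belongs to bidder `i` if and only if entry
`(j, 0)` of the natural array `2` is `i + 1`, and entry `(i, 0)` of the real array `2` is the
payment of bidder `i`. -/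
def Mem.Outputs {n m : ℕ} (s : Mem) (A : Allocation n m) (p : Fin n → ℝ) : Prop :=
  (∀ (i : Fin n) (j : Fin m), j ∈ A.bundle i ↔ s.nat 2 j 0 = (i : ℕ) + 1) ∧
    ∀ i : Fin n, s.val 2 i 0 = p i

/-- On every profile of budget additive valuations, given explicitly by the values of the single
items and any valid budgets, and for all outcomes of the coins, the program `P` halts within `T`
steps with the allocation and the payments of `M`. -/
def RandomizedMechanism.ComputedInTime {n m ℓ : ℕ}
    (M : RandomizedMechanism (budgetAdditive m) n ℓ) (P : Program) (T : ℕ) : Prop :=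
  ∀ (v : Fin n → budgetAdditive m) (b : Fin n → ℝ) (r : Fin ℓ → Bool),
    (∀ i, IsBudget (v i : Valuation m) (b i)) →
      ∃ (s : Mem) (t : ℕ),
        Exec P (inputMem (fun i j => (v i : Valuation m) {j}) b r) s t ∧ t ≤ T ∧
          s.Outputs ((M r).alloc v) ((M r).pay v)

end BudgetAuction

/-! The mechanism combines three auctions. With probability 1/2 all items are sold together by a
second price auction, which secures the largest budget. Otherwise the bidders are split by coins
into estimators, who buy nothing, and two groups of buyers. The unit price is $p=B/2^L$, where $B$
is the highest budget of an estimator and $2^L\ge 4m$. The $L$ price levels are covered by $K$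
blocks of $K$ levels, with $K^2\ge L$ and $K=O(\sqrt{\log m})$. Either the first group buys
sequentially at the uniform price $2^{xK}p$, or sales to the first group are simulated at all $K$
block prices, the highest block price at which an item sells becomes its learned price, and the
second group buys at the learned prices times $2^x$. The level $x<K$ is uniform.

Truthfulness: in a sale the buyer faces prices and available items that do not depend on the buyer's
report and receives a best bundle (`sale_truthful`); the learned prices depend only on the
estimators and the first group (`outcome_truthful`).

Approximation: scaled item values give prices $q$ that support the target allocation
(`supported_natBundle`). Let $e$ have the largest budget and condition on $e$ being an estimator.
The bundle of $e$ and the items with $q<2p$ lose at most $\frac32B_e$. For another item of a second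
group bidder $i$, take the last block $k$ with $2\cdot2^{kK}p\le q$ (`price_le`). If the item is
unsold at block $k$, then $q$ is at most twice the gain that $i$ forgoes; moving $i$ to the first
group by one coin shows that all these gains together are in expectation at most the welfare of that
sale (`sum_lost_le`). If the item also sells at a higher block, the revenue there covers $q/2$.
Otherwise block $k$ is learned and some level $x<K$ puts the price between $q/4$ and $q/2$; then
either the price or the utility that the unsold items would give to $i$ pays for a quarter of $q$
(`sum_le_total`). Summing over the $K$ choices of $x$ and of the block costs the factor $K$
(`Supported.approximation`).

Running time: all prices are integer multiples of $p$ of size at most $2^{K^2}$, which is polynomial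
in $m$. Hence the demand of a budget additive bidder is found exactly by the knapsack dynamic
program over total costs (`utility_le_demand`, `saleProg_runs`). -/

namespace BudgetAuction

/-! ### Total correctness of programs with a bound on the number of steps -/

/-- Whether the program contains an assignment to the natural array `a`. -/
def Program.writesNat (a : ℕ) : Program → Bool
  | .skip => false
  | .setNat a' _ _ _ => a' == a
  | .setVal _ _ _ _ => false
  | .seq c d => c.writesNat a || d.writesNat a
  | .ite _ c d => c.writesNat a || d.writesNat a
  | .loop _ c => c.writesNat a

/-- Whether the program contains an assignment to the real array `a`. -/
def Program.writesVal (a : ℕ) : Program → Bool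
  | .skip => false
  | .setNat _ _ _ _ => false
  | .setVal a' _ _ _ => a' == a
  | .seq c d => c.writesVal a || d.writesVal a
  | .ite _ c d => c.writesVal a || d.writesVal a
  | .loop _ c => c.writesVal a

/-- The memories agree on all arrays that the program does not write. -/
structure Agree (c : Program) (s s' : Mem) : Prop where
  nat : ∀ a, c.writesNat a = false → s'.nat a = s.nat a
  val : ∀ a, c.writesVal a = false → s'.val a = s.val a

theorem Agree.refl (c : Program) (s : Mem) : Agree c s s := ⟨fun _ _ => rfl, fun _ _ => rfl⟩

theorem Agree.trans {c : Program} {s s' s'' : Mem} (h : Agree c s s') (h' : Agree c s' s'') :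
    Agree c s s'' :=
  ⟨fun a ha => (h'.nat a ha).trans (h.nat a ha), fun a ha => (h'.val a ha).trans (h.val a ha)⟩

theorem Agree.mono {c d : Program} {s s' : Mem} (h : Agree c s s')
    (hn : ∀ a, d.writesNat a = false → c.writesNat a = false)
    (hv : ∀ a, d.writesVal a = false → c.writesVal a = false) : Agree d s s' :=
  ⟨fun a ha => h.nat a (hn a ha), fun a ha => h.val a (hv a ha)⟩

/-- A syntactic frame rule. The side conditions on concrete programs hold by `rfl`, so loop
invariants need to mention only the entries that change. -/
theorem Exec.agree {c : Program} {s s' : Mem} {t : ℕ} (h : Exec c s s' t) : Agree c s s' := by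
  induction h with
  | skip s => exact Agree.refl _ _
  | setNat a i j e s =>
    refine ⟨fun a' ha => ?_, fun _ _ => rfl⟩
    have hne : a' ≠ a := by
      rintro rfl
      simp [Program.writesNat] at ha
    funext i' j'
    simp [Mem.setNat, hne]
  | setVal a i j e s =>
    refine ⟨fun _ _ => rfl, fun a' ha => ?_⟩
    have hne : a' ≠ a := by
      rintro rfl
      simp [Program.writesVal] at ha
    funext i' j'
    simp [Mem.setVal, hne]
  | seq _ _ h₁ h₂ =>
    refine (h₁.mono ?_ ?_).trans (h₂.mono ?_ ?_) <;> intro a ha <;>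
      simp_all [Program.writesNat, Program.writesVal]
  | iteTrue _ _ h₁ =>
    refine h₁.mono ?_ ?_ <;> intro a ha <;> simp_all [Program.writesNat, Program.writesVal]
  | iteFalse _ _ h₁ =>
    refine h₁.mono ?_ ?_ <;> intro a ha <;> simp_all [Program.writesNat, Program.writesVal]
  | loopFalse _ => exact Agree.refl _ _
  | loopTrue _ _ _ h₁ h₂ => exact Agree.trans (h₁.mono (fun _ h => h) (fun _ h => h)) h₂

/-- Started in `s`, the program halts within `T` steps in a memory that satisfies `Q`. -/
def Runs (c : Program) (s : Mem) (T : ℕ) (Q : Mem → Prop) : Prop :=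
  ∃ s' t, Exec c s s' t ∧ t ≤ T ∧ Q s'

namespace Runs

variable {c d : Program} {s : Mem} {T T' : ℕ} {Q Q' : Mem → Prop} {b : Test}

theorem le (h : Runs c s T Q) (hT : T ≤ T') : Runs c s T' Q := by
  obtain ⟨s', t, he, ht, hq⟩ := h
  exact ⟨s', t, he, ht.trans hT, hq⟩

theorem mono (h : Runs c s T Q) (hQ : ∀ s', Agree c s s' → Q s' → Q' s') : Runs c s T Q' := by
  obtain ⟨s', t, he, ht, hq⟩ := h
  exact ⟨s', t, he, ht, hQ s' he.agree hq⟩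

theorem skip (h : Q s) : Runs .skip s 1 Q := ⟨s, 1, .skip s, le_rfl, h⟩

theorem setNat {a : ℕ} {i j e : NExp}
    (h : Q (s.setNat a (i.eval s) (j.eval s) (e.eval s))) : Runs (.setNat a i j e) s 1 Q :=
  ⟨_, 1, .setNat a i j e s, le_rfl, h⟩

theorem setVal {a : ℕ} {i j : NExp} {e : VExp}
    (h : Q (s.setVal a (i.eval s) (j.eval s) (e.eval s))) : Runs (.setVal a i j e) s 1 Q :=
  ⟨_, 1, .setVal a i j e s, le_rfl, h⟩

theorem seq (h : Runs c s T (fun s' => Runs d s' T' Q)) : Runs (.seq c d) s (T + T') Q := by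
  obtain ⟨s', t, he, ht, s'', u, he', hu, hq⟩ := h
  exact ⟨s'', t + u, .seq he he', add_le_add ht hu, hq⟩

theorem ite (hc : b.Holds s → Runs c s T Q) (hd : ¬ b.Holds s → Runs d s T' Q) :
    Runs (.ite b c d) s (T + T' + 1) Q := by
  by_cases hb : b.Holds s
  · obtain ⟨s', t, he, ht, hq⟩ := hc hb
    exact ⟨s', t + 1, .iteTrue hb he, by omega, hq⟩
  · obtain ⟨s', t, he, ht, hq⟩ := hd hb
    exact ⟨s', t + 1, .iteFalse hb he, by omega, hq⟩

/-- The invariant is indexed by the exact number of completed rounds, so no separate termination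
measure is needed. Each round pays for the body and one test; the final 1 is the failing test. The
frame `Agree c s s'` is supplied for free. -/
theorem loop {I : ℕ → Mem → Prop} {N : ℕ} (h0 : I 0 s)
    (hstep : ∀ k < N, ∀ s', Agree c s s' → I k s' → b.Holds s' ∧ Runs c s' T (I (k + 1)))
    (hend : ∀ s', Agree c s s' → I N s' → ¬ b.Holds s') :
    Runs (.loop b c) s (N * (T + 1) + 1) (I N) := by
  suffices H : ∀ l k, k + l = N → ∀ s', Agree c s s' → I k s' →
      Runs (.loop b c) s' (l * (T + 1) + 1) (I N) from H N 0 (by omega) s (Agree.refl _ _) h0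
  intro l
  induction l with
  | zero =>
    intro k hk s' ha hI
    obtain rfl : k = N := by omega
    exact ⟨s', 1, .loopFalse (hend s' ha hI), by omega, hI⟩
  | succ l ih =>
    intro k hk s' ha hI
    obtain ⟨hb, s₁, t, he, ht, hI'⟩ := hstep k (by omega) s' ha hI
    obtain ⟨s₂, u, he', hu, hq⟩ := ih (k + 1) (by omega) s₁ (ha.trans he.agree) hI'
    refine ⟨s₂, t + u + 1, .loopTrue hb he he', ?_, hq⟩
    have : (l + 1) * (T + 1) = l * (T + 1) + (T + 1) := by ring
    omega

end Runs

/-! ### Scalar variables and counting loops -/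

/-- The scalar natural variable stored in entry `(0, 0)` of array `a`. -/
def nv (a : ℕ) : NExp := .get a (.const 0) (.const 0)

/-- The scalar real variable stored in entry `(0, 0)` of array `a`. -/
def rv (a : ℕ) : VExp := .get a (.const 0) (.const 0)

/-- Assignment to a scalar natural variable. -/
def setN (a : ℕ) (e : NExp) : Program := .setNat a (.const 0) (.const 0) e

/-- Assignment to a scalar real variable. -/
def setR (a : ℕ) (e : VExp) : Program := .setVal a (.const 0) (.const 0) e

/-- For `i` from `0` to `N - 1` do `c`; the counter is the scalar natural variable `i`. -/
def forTo (i : ℕ) (N : NExp) (c : Program) : Program :=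
  .seq (setN i (.const 0))
    (.loop (.natLe (.add (nv i) (.const 1)) N)
      (.seq c (setN i (.add (nv i) (.const 1)))))

theorem Runs.setN {s : Mem} {Q : Mem → Prop} {a : ℕ} {e : NExp} (h : Q (s.setNat a 0 0 (e.eval s))) :
    Runs (setN a e) s 1 Q := Runs.setNat h

theorem Runs.setR {s : Mem} {Q : Mem → Prop} {a : ℕ} {e : VExp} (h : Q (s.setVal a 0 0 (e.eval s))) :
    Runs (setR a e) s 1 Q := Runs.setVal h

/-- The invariant is asserted after the counter has been advanced, hence the `setNat` in the step. A
round costs the body, the increment and the test; the outer 2 pays for the initialization and the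
failing test. -/
theorem Runs.forTo {s : Mem} {i N T : ℕ} {e : NExp} {c : Program} {I : ℕ → Mem → Prop}
    (hi : c.writesNat i = false)
    (hN : ∀ s', Agree (forTo i e c) s s' → e.eval s' = N)
    (h0 : I 0 (s.setNat i 0 0 0))
    (hstep : ∀ k < N, ∀ s', Agree (BudgetAuction.forTo i e c) s s' → s'.nat i 0 0 = k → I k s' →
      Runs c s' T (fun s'' => I (k + 1) (s''.setNat i 0 0 (k + 1)))) :
    Runs (BudgetAuction.forTo i e c) s (N * (T + 2) + 2) (I N) := by
  have hset : ∀ (s : Mem) (x : ℕ), Agree (BudgetAuction.forTo i e c) s (s.setNat i 0 0 x) :=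
    fun s x => (Exec.setNat i (.const 0) (.const 0) (.const x) s).agree.mono
      (by intro a; simp only [BudgetAuction.forTo, BudgetAuction.setN, Program.writesNat]; simp)
      (by intro a; simp [Program.writesVal])
  have key := Runs.loop (s := s.setNat i 0 0 0) (T := T + 1)
    (b := .natLe (.add (nv i) (.const 1)) e)
    (c := .seq c (BudgetAuction.setN i (.add (nv i) (.const 1))))
    (I := fun k s' => I k s' ∧ s'.nat i 0 0 = k) (N := N)
    ⟨h0, by simp [Mem.setNat]⟩ ?_ ?_
  · refine (Runs.seq (T := 1) (Runs.setN (key.mono fun s' _ h => h.1))).le ?_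
    rw [add_comm, add_assoc]
  · rintro k hk s' ha ⟨hI, hik⟩
    have ha' : Agree (BudgetAuction.forTo i e c) s s' := (hset s 0).trans (ha.mono
      (by intro a; simp only [BudgetAuction.forTo, BudgetAuction.setN, Program.writesNat]; simp)
      (by intro a; simp [BudgetAuction.forTo, BudgetAuction.setN, Program.writesVal]))
    refine ⟨?_, ?_⟩
    · simp only [Test.Holds, NExp.eval, nv, hN s' ha', hik]
      omega
    · refine Runs.seq ((hstep k hk s' ha' hik hI).mono fun s'' ha'' hI'' => Runs.setN ?_)
      have : s''.nat i 0 0 = k := by rw [ha''.nat i hi, hik]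
      simp only [NExp.eval, nv, this]
      exact ⟨hI'', by simp [Mem.setNat]⟩
  · rintro s' ha ⟨hI, hik⟩
    have ha' : Agree (BudgetAuction.forTo i e c) s s' := (hset s 0).trans (ha.mono
      (by intro a; simp only [BudgetAuction.forTo, BudgetAuction.setN, Program.writesNat]; simp)
      (by intro a; simp [BudgetAuction.forTo, BudgetAuction.setN, Program.writesVal]))
    simp only [Test.Holds, NExp.eval, nv, hN s' ha', hik]
    omega

@[simp] theorem Mem.nat_setNat (s : Mem) (a i j x a' i' j' : ℕ) :
    (s.setNat a i j x).nat a' i' j' = if a' = a ∧ i' = i ∧ j' = j then x else s.nat a' i' j' := rfl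

@[simp] theorem Mem.val_setNat (s : Mem) (a i j x : ℕ) : (s.setNat a i j x).val = s.val := rfl

@[simp] theorem Mem.nat_setVal (s : Mem) (a i j : ℕ) (x : ℝ) : (s.setVal a i j x).nat = s.nat := rfl

@[simp] theorem Mem.val_setVal (s : Mem) (a i j : ℕ) (x : ℝ) (a' i' j' : ℕ) :
    (s.setVal a i j x).val a' i' j' =
      if a' = a ∧ i' = i ∧ j' = j then x else s.val a' i' j' := rfl

theorem Mem.nat_setNat_of_ne (s : Mem) {a a' : ℕ} (i j x : ℕ) (h : a' ≠ a) :
    (s.setNat a i j x).nat a' = s.nat a' := by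
  funext i' j'
  simp [h]

theorem Mem.val_setVal_of_ne (s : Mem) {a a' : ℕ} (i j : ℕ) (x : ℝ) (h : a' ≠ a) :
    (s.setVal a i j x).val a' = s.val a' := by
  funext i' j'
  simp [h]

/-! ### Demand of a budget additive bidder at integral prices -/

section Knapsack

variable (w : ℕ → ℝ) (c own : ℕ → ℕ)

/-- The largest sum of item values among the unowned items below `j` at total cost at most `P`. -/
noncomputable def best : ℕ → ℕ → ℝ
  | 0, _ => 0
  | j + 1, P =>
    if own j = 0 ∧ c j ≤ P ∧ best j P ≤ best j (P - c j) + w j then best j (P - c j) + w j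
    else best j P

/-- Whether item `j` is taken when the items up to `j` are left and the budget for costs is `P`. -/
def Takes (j P : ℕ) : Prop :=
  own j = 0 ∧ c j ≤ P ∧ best w c own j P ≤ best w c own j (P - c j) + w j

open Classical in
/-- A bundle that attains `best`. -/
noncomputable def pick : ℕ → ℕ → Finset ℕ
  | 0, _ => ∅
  | j + 1, P => if Takes w c own j P then insert j (pick j (P - c j)) else pick j P

variable {w c own}

theorem best_succ_of_takes {j P : ℕ} (h : Takes w c own j P) :
    best w c own (j + 1) P = best w c own j (P - c j) + w j := if_pos h

theorem best_succ_of_not_takes {j P : ℕ} (h : ¬ Takes w c own j P) :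
    best w c own (j + 1) P = best w c own j P := if_neg h

theorem pick_succ_of_takes {j P : ℕ} (h : Takes w c own j P) :
    pick w c own (j + 1) P = insert j (pick w c own j (P - c j)) := if_pos h

theorem pick_succ_of_not_takes {j P : ℕ} (h : ¬ Takes w c own j P) :
    pick w c own (j + 1) P = pick w c own j P := if_neg h

theorem lt_of_mem_pick {j P l : ℕ} (h : l ∈ pick w c own j P) : l < j := by
  induction j generalizing P with
  | zero => simp [pick] at h
  | succ j ih =>
    by_cases ht : Takes w c own j P
    · rw [pick_succ_of_takes ht, Finset.mem_insert] at h
      rcases h with rfl | h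
      · omega
      · exact (ih h).trans (by omega)
    · rw [pick_succ_of_not_takes ht] at h
      exact (ih h).trans (by omega)

theorem notMem_pick_self (j P : ℕ) : j ∉ pick w c own j P := fun h => (lt_of_mem_pick h).false

theorem own_eq_zero_of_mem_pick {j P l : ℕ} (h : l ∈ pick w c own j P) : own l = 0 := by
  induction j generalizing P with
  | zero => simp [pick] at h
  | succ j ih =>
    by_cases ht : Takes w c own j P
    · rw [pick_succ_of_takes ht, Finset.mem_insert] at h
      rcases h with rfl | h
      · exact ht.1
      · exact ih h
    · rw [pick_succ_of_not_takes ht] at h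
      exact ih h

theorem sum_cost_pick_le (j P : ℕ) : ∑ l ∈ pick w c own j P, c l ≤ P := by
  induction j generalizing P with
  | zero => simp [pick]
  | succ j ih =>
    by_cases ht : Takes w c own j P
    · rw [pick_succ_of_takes ht, Finset.sum_insert (notMem_pick_self _ _)]
      have := ih (P - c j)
      have := ht.2.1
      omega
    · rw [pick_succ_of_not_takes ht]
      exact ih P

theorem sum_value_pick (j P : ℕ) : ∑ l ∈ pick w c own j P, w l = best w c own j P := by
  induction j generalizing P with
  | zero => simp [pick, best]
  | succ j ih =>
    by_cases ht : Takes w c own j P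
    · rw [pick_succ_of_takes ht, best_succ_of_takes ht, Finset.sum_insert (notMem_pick_self _ _),
        ih, add_comm]
    · rw [pick_succ_of_not_takes ht, best_succ_of_not_takes ht, ih]

/-- Optimality of the knapsack recursion: the last item `j` is either outside `D`, or its removal
leaves a bundle that is feasible for the cost `P - c j`. The recursion keeps the better of the two
options. -/
theorem sum_value_le_best {j P : ℕ} {D : Finset ℕ} (hD : ∀ l ∈ D, l < j)
    (hown : ∀ l ∈ D, own l = 0) (hc : ∑ l ∈ D, c l ≤ P) : ∑ l ∈ D, w l ≤ best w c own j P := by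
  induction j generalizing P D with
  | zero =>
    have : D = ∅ := Finset.eq_empty_of_forall_notMem fun l hl => by simpa using hD l hl
    simp [this, best]
  | succ j ih =>
    by_cases hj : j ∈ D
    · have hs := Finset.add_sum_erase D c hj
      have h1 : ∑ l ∈ D.erase j, w l ≤ best w c own j (P - c j) := by
        refine ih (fun l hl => ?_) (fun l hl => hown l (Finset.mem_of_mem_erase hl)) (by omega)
        have := hD l (Finset.mem_of_mem_erase hl)
        have := Finset.ne_of_mem_erase hl
        omega
      rw [← Finset.add_sum_erase D w hj]
      by_cases ht : Takes w c own j P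
      · rw [best_succ_of_takes ht]
        linarith
      · rw [best_succ_of_not_takes ht]
        have : ¬ best w c own j P ≤ best w c own j (P - c j) + w j := fun h =>
          ht ⟨hown j hj, by omega, h⟩
        linarith
    · have h1 : ∑ l ∈ D, w l ≤ best w c own j P := by
        refine ih (fun l hl => ?_) hown hc
        have := hD l hl
        have : l ≠ j := fun h => hj (h ▸ hl)
        omega
      by_cases ht : Takes w c own j P
      · rw [best_succ_of_takes ht]
        exact h1.trans ht.2.2
      · rwa [best_succ_of_not_takes ht]

end Knapsack

/-- The last maximizer of `u` on `{0, …, k}`. -/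
noncomputable def lastArgmax (u : ℕ → ℝ) : ℕ → ℕ
  | 0 => 0
  | k + 1 => if u (lastArgmax u k) ≤ u (k + 1) then k + 1 else lastArgmax u k

theorem le_lastArgmax (u : ℕ → ℝ) {k l : ℕ} (h : l ≤ k) : u l ≤ u (lastArgmax u k) := by
  induction k with
  | zero =>
    obtain rfl : l = 0 := by omega
    rfl
  | succ k ih =>
    rw [lastArgmax]
    split_ifs with hu
    · rcases Nat.lt_or_ge k l with hl | hl
      · obtain rfl : l = k + 1 := by omega
        rfl
      · exact (ih hl).trans hu
    · rcases Nat.lt_or_ge k l with hl | hl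
      · obtain rfl : l = k + 1 := by omega
        exact (not_le.1 hu).le
      · exact ih hl

/-! ### The mechanism on markets indexed by natural numbers -/

/-- `n` bidders, `m` items, the item values and the budgets. -/
structure Market where
  /-- the number of bidders -/
  n : ℕ
  /-- the number of items -/
  m : ℕ
  /-- the value of every single item for every bidder -/
  w : ℕ → ℕ → ℝ
  /-- the budgets -/
  B : ℕ → ℝ

namespace Market

variable (X : Market)

/-- The value of a bundle. -/
noncomputable def value (i : ℕ) (S : Finset ℕ) : ℝ := min (X.B i) (∑ j ∈ S, X.w i j)

/-- The utility of bidder `i` from an optimal bundle of total cost at most `P` at unit price `p`. -/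
noncomputable def utilityUpTo (p : ℝ) (c own : ℕ → ℕ) (i P : ℕ) : ℝ :=
  min (X.B i) (best (X.w i) c own X.m P) - P * p

/-- The cost of the bundle that bidder `i` demands among the unowned items, where item `j` has
price `c j * p`. -/
noncomputable def demandCost (p : ℝ) (c own : ℕ → ℕ) (i : ℕ) : ℕ :=
  lastArgmax (X.utilityUpTo p c own i) (∑ j ∈ Finset.range X.m, c j)

/-- The bundle that bidder `i` demands among the unowned items. -/
noncomputable def demand (p : ℝ) (c own : ℕ → ℕ) (i : ℕ) : Finset ℕ :=
  pick (X.w i) c own X.m (X.demandCost p c own i)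

theorem lt_of_mem_demand {p : ℝ} {c own : ℕ → ℕ} {i j : ℕ} (h : j ∈ X.demand p c own i) :
    j < X.m := lt_of_mem_pick h

theorem own_of_mem_demand {p : ℝ} {c own : ℕ → ℕ} {i j : ℕ} (h : j ∈ X.demand p c own i) :
    own j = 0 := own_eq_zero_of_mem_pick h

theorem sum_cost_demand_le (p : ℝ) (c own : ℕ → ℕ) (i : ℕ) :
    ∑ j ∈ X.demand p c own i, c j ≤ X.demandCost p c own i := sum_cost_pick_le _ _

/-- Maximizing over cost bounds instead of bundles loses nothing, since `D` is feasible for the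
bound equal to its own cost. The charge is the chosen bound, possibly more than the cost of the
picked bundle. Deviations and parts of a target bundle are the two uses of `D`. -/
theorem utility_le_demand (p : ℝ) {c own : ℕ → ℕ} {i : ℕ} {D : Finset ℕ}
    (hD : ∀ j ∈ D, j < X.m) (hown : ∀ j ∈ D, own j = 0) :
    X.value i D - (∑ j ∈ D, c j : ℕ) * p ≤
      X.value i (X.demand p c own i) - X.demandCost p c own i * p := by
  have h1 : ∑ j ∈ D, c j ≤ ∑ j ∈ Finset.range X.m, c j :=
    Finset.sum_le_sum_of_subset fun j hj => Finset.mem_range.2 (hD j hj)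
  have h2 := le_lastArgmax (X.utilityUpTo p c own i) h1
  have h3 : X.value i (X.demand p c own i) - X.demandCost p c own i * p =
      X.utilityUpTo p c own i (X.demandCost p c own i) := by
    rw [value, demand, sum_value_pick, utilityUpTo]
  rw [h3]
  refine le_trans ?_ h2
  exact sub_le_sub_right (min_le_min_left _ (sum_value_le_best hD hown le_rfl)) _

/-- The owners (`i + 1` for bidder `i`, and `0` for none) after the bidders below `i` in the group
`H` have bought their demands at the prices `c j * p`. -/
noncomputable def owners (H : ℕ → Bool) (c : ℕ → ℕ) (p : ℝ) : ℕ → ℕ → ℕ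
  | 0, _ => 0
  | i + 1, j =>
    if H i = true ∧ j ∈ X.demand p c (owners H c p i) i then i + 1 else owners H c p i j

/-- The payments in the sequential sale. -/
noncomputable def salePay (H : ℕ → Bool) (c : ℕ → ℕ) (p : ℝ) (i : ℕ) : ℝ :=
  if H i = true then X.demandCost p c (X.owners H c p i) i * p else 0

/-- The largest budget in the group `a` among the bidders below `i`. -/
noncomputable def topBudget (a : ℕ → Bool) : ℕ → ℝ
  | 0 => 0
  | i + 1 => if a i = true ∧ topBudget a i ≤ X.B i then X.B i else topBudget a i

end Market

/-- The number of halvings that lead from an estimate of the welfare to the unit price. -/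
def levels (m : ℕ) : ℕ := Nat.clog 2 (4 * m)

/-- The number of coins that select a price level. -/
def levelBits (m : ℕ) : ℕ := Nat.clog 4 (levels m)

/-- The number of blocks of price levels, and the number of levels in every block. -/
def blocks (m : ℕ) : ℕ := 2 ^ levelBits m

/-- The coins, decoded. -/
structure Coins where
  /-- the bidders whose budgets are used to estimate the welfare -/
  a : ℕ → Bool
  /-- the division of the other bidders into two groups -/
  b : ℕ → Bool
  /-- whether all items are sold together -/
  g : Bool
  /-- whether the items are sold at a uniform price -/
  h : Bool
  /-- the price level -/
  x : ℕ

namespace Coins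

/-- The first group of buyers. -/
def U (r : Coins) (i : ℕ) : Bool := !r.a i && r.b i

/-- The second group of buyers. -/
def V (r : Coins) (i : ℕ) : Bool := !r.a i && !r.b i

end Coins

namespace Market

variable (X : Market) (r : Coins)

/-- The unit price. -/
noncomputable def unitPrice : ℝ := X.topBudget r.a X.n / 2 ^ levels X.m

/-- The owners after the sale to the first group at the uniform price of block `k`. -/
noncomputable def uniformOwners (k : ℕ) : ℕ → ℕ :=
  X.owners r.U (fun _ => 2 ^ (k * blocks X.m)) (X.unitPrice r) X.n

/-- The largest block price, among the first `k` blocks, at which item `j` is sold. -/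
noncomputable def learned : ℕ → ℕ → ℕ
  | 0, _ => 1
  | k + 1, j => if X.uniformOwners r k j ≠ 0 then 2 ^ (k * blocks X.m) else learned k j

/-- The owners after the sale to the second group at the learned prices. -/
noncomputable def finalOwners (x : ℕ) : ℕ → ℕ :=
  X.owners r.V (fun j => X.learned r (blocks X.m) j * 2 ^ x) (X.unitPrice r) X.n

/-- The highest bidder for all items among the bidders below `i`, the highest and the second
highest bid. -/
noncomputable def topTwo : ℕ → ℕ × ℝ × ℝ
  | 0 => (0, 0, 0)
  | i + 1 =>
    if (topTwo i).2.1 < X.B i then (i + 1, X.B i, (topTwo i).2.1)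
    else ((topTwo i).1, (topTwo i).2.1, max (topTwo i).2.2 (X.B i))

/-- The final owner of every item. -/
noncomputable def outcomeOwner (j : ℕ) : ℕ :=
  if r.g = true then (X.topTwo X.n).1
  else if r.h = true then X.uniformOwners r r.x j
  else X.finalOwners r r.x j

/-- The final payments. -/
noncomputable def outcomePay (i : ℕ) : ℝ :=
  if r.g = true then (if (X.topTwo X.n).1 = i + 1 then (X.topTwo X.n).2.2 else 0)
  else if r.h = true then X.salePay r.U (fun _ => 2 ^ (r.x * blocks X.m)) (X.unitPrice r) i
  else X.salePay r.V (fun j => X.learned r (blocks X.m) j * 2 ^ r.x) (X.unitPrice r) i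

/-- The bundle of bidder `i` when `own` lists the owners. -/
def bundle (own : ℕ → ℕ) (i : ℕ) : Finset ℕ := {j ∈ Finset.range X.m | own j = i + 1}

/-- The welfare when `own` lists the owners. -/
noncomputable def total (own : ℕ → ℕ) : ℝ := ∑ i ∈ Finset.range X.n, X.value i (X.bundle own i)

/-! ### Truthfulness -/

variable {X r}

/-- Demands contain unowned items only, so a sold item never changes hands. Consequently an item
unsold at the end was available at every turn. -/
theorem owners_of_ne_zero {H : ℕ → Bool} {c : ℕ → ℕ} {p : ℝ} {i j k : ℕ} (hik : i ≤ k)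
    (h : X.owners H c p i j ≠ 0) : X.owners H c p k j = X.owners H c p i j := by
  induction k, hik using Nat.le_induction with
  | base => rfl
  | succ k _ ih =>
    rw [owners, if_neg, ih]
    rintro ⟨_, hj⟩
    exact h (ih ▸ X.own_of_mem_demand hj)

theorem owners_le {H : ℕ → Bool} {c : ℕ → ℕ} {p : ℝ} (i j : ℕ) : X.owners H c p i j ≤ i := by
  induction i with
  | zero => simp [owners]
  | succ i ih =>
    rw [owners]
    split_ifs <;> omega

theorem owners_eq_succ_iff {H : ℕ → Bool} {c : ℕ → ℕ} {p : ℝ} {i j k : ℕ} (hik : i < k) :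
    X.owners H c p k j = i + 1 ↔ H i = true ∧ j ∈ X.demand p c (X.owners H c p i) i := by
  induction k, hik using Nat.le_induction with
  | base =>
    rw [owners]
    have := X.owners_le (H := H) (c := c) (p := p) i j
    split_ifs with h
    · simp [h]
    · exact iff_of_false (by omega) h
  | succ k hk ih =>
    rw [← ih]
    constructor
    · intro h
      rw [owners] at h
      split_ifs at h with h'
      · omega
      · exact h
    · intro h
      have h' : X.owners H c p k j ≠ 0 := by omega
      rw [owners_of_ne_zero (Nat.le_succ k) h', h]

theorem bundle_owners {H : ℕ → Bool} {c : ℕ → ℕ} {p : ℝ} {i : ℕ} (hi : i < X.n) :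
    X.bundle (X.owners H c p X.n) i =
      if H i = true then X.demand p c (X.owners H c p i) i else ∅ := by
  ext j
  rw [bundle, Finset.mem_filter, owners_eq_succ_iff hi, Finset.mem_range]
  split_ifs with h
  · simp only [h, true_and, and_iff_right_iff_imp]
    exact X.lt_of_mem_demand
  · simp [h]

/-- The two markets differ at most in the data of bidder `i`. -/
structure AgreeOff (X Y : Market) (i : ℕ) : Prop where
  n : Y.n = X.n
  m : Y.m = X.m
  w : ∀ k, k ≠ i → Y.w k = X.w k
  B : ∀ k, k ≠ i → Y.B k = X.B k

variable {Y : Market}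

theorem AgreeOff.demandCost {i k : ℕ} (h : AgreeOff X Y i) (hk : k ≠ i) (p : ℝ) (c own : ℕ → ℕ) :
    Y.demandCost p c own k = X.demandCost p c own k := by
  have : Y.utilityUpTo p c own k = X.utilityUpTo p c own k := by
    funext P
    simp only [utilityUpTo, h.m, h.w k hk, h.B k hk]
  simp only [Market.demandCost, this, h.m]

theorem AgreeOff.demand {i k : ℕ} (h : AgreeOff X Y i) (hk : k ≠ i) (p : ℝ) (c own : ℕ → ℕ) :
    Y.demand p c own k = X.demand p c own k := by
  simp only [Market.demand, h.demandCost hk, h.m, h.w k hk]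

/-- A report has no effect on the sale before the bidder's own turn, and none at all if the bidder
is outside the group. -/
theorem AgreeOff.owners {i k : ℕ} {H : ℕ → Bool} (h : AgreeOff X Y i) (p : ℝ) (c : ℕ → ℕ)
    (hk : k ≤ i ∨ H i = false) : Y.owners H c p k = X.owners H c p k := by
  induction k with
  | zero => rfl
  | succ k ih =>
    funext j
    have ih' := ih (hk.imp_left (by omega))
    rw [Market.owners, Market.owners, ih']
    by_cases hki : k = i
    · have : H i = false := hk.resolve_left (by omega)
      simp [hki, this]
    · rw [h.demand hki]

theorem AgreeOff.topBudget {i : ℕ} {a : ℕ → Bool} (h : AgreeOff X Y i) (ha : a i = false) (k : ℕ) :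
    Y.topBudget a k = X.topBudget a k := by
  induction k with
  | zero => rfl
  | succ k ih =>
    rw [Market.topBudget, Market.topBudget, ih]
    by_cases hki : k = i
    · simp [hki, ha]
    · rw [h.B k hki]

theorem AgreeOff.unitPrice {i : ℕ} (h : AgreeOff X Y i) (ha : r.a i = false) :
    Y.unitPrice r = X.unitPrice r := by
  rw [Market.unitPrice, Market.unitPrice, h.topBudget ha, h.n, h.m]

theorem AgreeOff.uniformOwners {i : ℕ} (h : AgreeOff X Y i) (ha : r.a i = false)
    (hb : r.U i = false) (k : ℕ) : Y.uniformOwners r k = X.uniformOwners r k := by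
  rw [Market.uniformOwners, Market.uniformOwners, h.unitPrice ha, h.n, h.m,
    h.owners _ _ (Or.inr hb)]

/-- Only estimators and first group bidders are involved in learning, so a second group bidder
cannot move the learned prices. -/
theorem AgreeOff.learned {i : ℕ} (h : AgreeOff X Y i) (ha : r.a i = false) (hb : r.U i = false)
    (k : ℕ) : Y.learned r k = X.learned r k := by
  induction k with
  | zero => rfl
  | succ k ih =>
    funext j
    rw [Market.learned, Market.learned, h.uniformOwners ha hb, h.m, ih]

theorem topBudget_nonneg (a : ℕ → Bool) (k : ℕ) : 0 ≤ X.topBudget a k := by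
  induction k with
  | zero => exact le_rfl
  | succ k ih =>
    rw [topBudget]
    split_ifs with h
    · exact ih.trans h.2
    · exact ih

theorem unitPrice_nonneg : 0 ≤ X.unitPrice r := div_nonneg (topBudget_nonneg _ _) (by positivity)

/-- The items left at the turn of `i` do not depend on the report of `i`. A false report yields a
bundle that was available anyway, for a payment no smaller than its posted cost, so it is no better
than the true demand. -/
theorem sale_truthful {H : ℕ → Bool} {c : ℕ → ℕ} {p : ℝ} {i : ℕ} (hp : 0 ≤ p) (hi : i < X.n)
    (h : AgreeOff X Y i) :
    X.value i (Y.bundle (Y.owners H c p Y.n) i) - Y.salePay H c p i ≤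
      X.value i (X.bundle (X.owners H c p X.n) i) - X.salePay H c p i := by
  rw [bundle_owners hi, bundle_owners (h.n ▸ hi), salePay, salePay, h.owners _ _ (Or.inl le_rfl)]
  split_ifs with hH
  · refine le_trans ?_ (X.utility_le_demand p (D := Y.demand p c (X.owners H c p i) i)
      (fun j hj => h.m ▸ Y.lt_of_mem_demand hj) (fun j hj => Y.own_of_mem_demand hj))
    have := Y.sum_cost_demand_le p c (X.owners H c p i) i
    exact sub_le_sub_left (mul_le_mul_of_nonneg_right (by exact_mod_cast this) hp) _
  · exact le_rfl

/-! ### Truthfulness of the second price auction and of the whole mechanism -/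

/-- The highest budget of the bidders below `k` other than `i`. -/
noncomputable def rivalBudget (X : Market) (i : ℕ) : ℕ → ℝ
  | 0 => 0
  | k + 1 => if k = i then rivalBudget X i k else max (rivalBudget X i k) (X.B k)

theorem AgreeOff.rivalBudget {i : ℕ} (h : AgreeOff X Y i) (k : ℕ) :
    Y.rivalBudget i k = X.rivalBudget i k := by
  induction k with
  | zero => rfl
  | succ k ih =>
    rw [Market.rivalBudget, Market.rivalBudget, ih]
    split_ifs with hk
    · rfl
    · rw [h.B k hk]

theorem topTwo_fst_le (k : ℕ) : (X.topTwo k).1 ≤ k := by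
  induction k with
  | zero => simp [topTwo]
  | succ k ih =>
    rw [topTwo]
    split_ifs
    · exact le_rfl
    · exact ih.trans (Nat.le_succ k)

theorem topTwo_eq_rivalBudget {i k : ℕ} (h : k ≤ i) : (X.topTwo k).2.1 = X.rivalBudget i k := by
  induction k with
  | zero => rfl
  | succ k ih =>
    rw [topTwo, rivalBudget, if_neg (show k ≠ i by omega), ← ih (by omega)]
    split_ifs with hB
    · exact (max_eq_right hB.le).symm
    · exact (max_eq_left (not_lt.1 hB)).symm

/-- Induction from the turn of `i` onwards. Up to that turn the highest bid is the rival budget, and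
afterwards the second bid tracks the rivals as long as `i` leads. The winner is replaced only by a
strictly higher bid. -/
theorem topTwo_spec {i k : ℕ} (h : i < k) :
    ((X.topTwo k).1 = i + 1 → X.B i = (X.topTwo k).2.1 ∧ (X.topTwo k).2.2 = X.rivalBudget i k ∧
      X.rivalBudget i k ≤ X.B i) ∧
    ((X.topTwo k).1 ≠ i + 1 → X.B i ≤ X.rivalBudget i k) := by
  induction k, h using Nat.le_induction with
  | base =>
    have h1 := X.topTwo_eq_rivalBudget (le_refl i)
    have h2 := X.topTwo_fst_le i
    rw [topTwo, rivalBudget, if_pos rfl]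
    split_ifs with hB
    · exact ⟨fun _ => ⟨rfl, h1, h1 ▸ hB.le⟩, fun h => absurd rfl h⟩
    · exact ⟨fun h => absurd h (by simp only; omega), fun _ => h1 ▸ not_lt.1 hB⟩
  | succ k hk ih =>
    rw [topTwo, rivalBudget, if_neg (show k ≠ i by omega)]
    split_ifs with hB
    · refine ⟨fun h => absurd h (by simp only; omega), fun _ => ?_⟩
      by_cases hl : (X.topTwo k).1 = i + 1
      · exact le_max_of_le_right ((ih.1 hl).1 ▸ hB.le)
      · exact le_max_of_le_left (ih.2 hl)
    · refine ⟨fun hl => ?_, fun hl => le_max_of_le_left (ih.2 hl)⟩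
      obtain ⟨h1, h2, h3⟩ := ih.1 hl
      exact ⟨h1, by simp only [h2], max_le h3 (h1 ▸ not_lt.1 hB)⟩

/-- Winning is worth the budget minus the highest rival budget under every report, and losing is
worth 0. A true report wins only if this difference is nonnegative and loses only if it is
nonpositive. -/
theorem grand_truthful {i : ℕ} (hi : i < X.n) (h : AgreeOff X Y i) (hB : 0 ≤ X.B i)
    (hX : X.value i (Finset.range X.m) = X.B i) :
    X.value i (Y.bundle (fun _ => (Y.topTwo Y.n).1) i)
        - (if (Y.topTwo Y.n).1 = i + 1 then (Y.topTwo Y.n).2.2 else 0) ≤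
      X.value i (X.bundle (fun _ => (X.topTwo X.n).1) i)
        - (if (X.topTwo X.n).1 = i + 1 then (X.topTwo X.n).2.2 else 0) := by
  have h0 : X.value i ∅ = 0 := by simp [value, hB]
  have hu : ∀ Z : Market, AgreeOff X Z i → X.value i (Z.bundle (fun _ => (Z.topTwo Z.n).1) i)
        - (if (Z.topTwo Z.n).1 = i + 1 then (Z.topTwo Z.n).2.2 else 0) =
      if (Z.topTwo Z.n).1 = i + 1 then X.B i - X.rivalBudget i X.n else 0 := by
    intro Z hZ
    have hs := (Z.topTwo_spec (hZ.n ▸ hi : i < Z.n)).1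
    rw [hZ.rivalBudget, hZ.n] at hs
    by_cases hl : (Z.topTwo Z.n).1 = i + 1
    · rw [if_pos hl, if_pos hl, hZ.n, (hs (hZ.n ▸ hl)).2.1]
      simp only [bundle, ← hZ.n, hl, hZ.m, Finset.filter_true, hX]
    · simp only [bundle, hl, Finset.filter_false, h0, if_false, sub_zero]
  rw [hu Y h, hu X ⟨rfl, rfl, fun _ _ => rfl, fun _ _ => rfl⟩]
  have hs := X.topTwo_spec hi
  by_cases h1 : (X.topTwo X.n).1 = i + 1
  · rw [if_pos h1]
    have := (hs.1 h1).2.2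
    split_ifs <;> linarith
  · rw [if_neg h1]
    have := hs.2 h1
    split_ifs <;> linarith

theorem outcome_truthful {i : ℕ} (hi : i < X.n) (h : AgreeOff X Y i) (hB : 0 ≤ X.B i)
    (hX : X.value i (Finset.range X.m) = X.B i) :
    X.value i (Y.bundle (Y.outcomeOwner r) i) - Y.outcomePay r i ≤
      X.value i (X.bundle (X.outcomeOwner r) i) - X.outcomePay r i := by
  by_cases hg : r.g = true
  · have : ∀ Z : Market, Z.outcomeOwner r = fun _ => (Z.topTwo Z.n).1 := fun Z => by
      funext j
      simp [outcomeOwner, hg]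
    simpa only [this, outcomePay, if_pos hg] using grand_truthful hi h hB hX
  -- Outside the selling group the bundle is empty and the payment is 0, so the prices need to agree
  -- only if `i` is in the group. This handles first group bidders, who can move the learned prices
  -- but do not buy at them.
  have hsale : ∀ (H : ℕ → Bool) (c c' : ℕ → ℕ), (∀ i, H i = true → r.a i = false) →
      (H i = true → c' = c) →
      X.value i (Y.bundle (Y.owners H c' (Y.unitPrice r) Y.n) i)
        - Y.salePay H c' (Y.unitPrice r) i ≤
      X.value i (X.bundle (X.owners H c (X.unitPrice r) X.n) i)
        - X.salePay H c (X.unitPrice r) i := by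
    intro H c c' hH hc
    by_cases hHi : H i = true
    · rw [hc hHi, h.unitPrice (hH i hHi)]
      exact sale_truthful unitPrice_nonneg hi h
    · rw [bundle_owners hi, bundle_owners (h.n ▸ hi), salePay, salePay]
      simp [hHi]
  by_cases hh : r.h = true
  · have : ∀ Z : Market, Z.outcomeOwner r =
        Z.owners r.U (fun _ => 2 ^ (r.x * blocks Z.m)) (Z.unitPrice r) Z.n := fun Z => by
      funext j
      simp [outcomeOwner, hg, hh, uniformOwners]
    simp only [this, outcomePay, if_neg hg, if_pos hh]
    refine hsale _ _ _ (fun i hi => ?_) (fun _ => by rw [h.m])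
    simp only [Coins.U, Bool.and_eq_true, Bool.not_eq_true'] at hi
    exact hi.1
  · have : ∀ Z : Market, Z.outcomeOwner r =
        Z.owners r.V (fun j => Z.learned r (blocks Z.m) j * 2 ^ r.x) (Z.unitPrice r) Z.n :=
      fun Z => by
        funext j
        simp [outcomeOwner, hg, hh, finalOwners]
    simp only [this, outcomePay, if_neg hg, if_neg hh]
    refine hsale _ _ _ (fun i hi => ?_) (fun hi => ?_)
    · simp only [Coins.V, Bool.and_eq_true, Bool.not_eq_true'] at hi
      exact hi.1
    · simp only [Coins.V, Bool.and_eq_true, Bool.not_eq_true'] at hi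
      rw [h.learned hi.1 (by simp [Coins.U, hi.2]), h.m]

end Market

/-! ### The program: the sale to one bidder -/

/-- The number of bidders. -/
def nBidders : NExp := nv 0

/-- The number of items. -/
def nItems : NExp := .get 0 (.const 0) (.const 1)

/-- The condition for taking item `j` (scalar `4`) at remaining cost `P` (scalar `5`). -/
def takeTest : Test :=
  .conj (.natLe (.get 2 (nv 4) (.const 0)) (.const 0))
    (.conj (.natLe (.get 12 (nv 4) (.const 0)) (nv 5))
      (.valLe (.get 4 (nv 4) (nv 5))
        (.add (.get 4 (nv 4) (.sub (nv 5) (.get 12 (nv 4) (.const 0)))) (.get 0 (nv 3) (nv 4)))))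

/-- One entry of the knapsack table (real array `4`, decisions in natural array `13`). -/
def tableCell : Program :=
  .ite takeTest
    (.seq (.setVal 4 (.add (nv 4) (.const 1)) (nv 5)
        (.add (.get 4 (nv 4) (.sub (nv 5) (.get 12 (nv 4) (.const 0)))) (.get 0 (nv 3) (nv 4))))
      (.setNat 13 (nv 4) (nv 5) (.const 1)))
    (.seq (.setVal 4 (.add (nv 4) (.const 1)) (nv 5) (.get 4 (nv 4) (nv 5)))
      (.setNat 13 (nv 4) (nv 5) (.const 0)))

/-- The knapsack table for costs up to the scalar `14`. -/
def tableProg : Program :=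
  .seq (forTo 5 (.add (nv 14) (.const 1)) (.setVal 4 (.const 0) (nv 5) .zero))
    (forTo 4 nItems (forTo 5 (.add (nv 14) (.const 1)) tableCell))

open Classical in
theorem tableCell_runs {s : Mem} {i m j P : ℕ} {w : ℕ → ℝ} {c own : ℕ → ℕ}
    (hi : s.nat 3 0 0 = i) (hj : s.nat 4 0 0 = j) (hP : s.nat 5 0 0 = P) (hw : s.val 0 i = w)
    (hown : ∀ l < m, s.nat 2 l 0 = own l) (hc : ∀ l < m, s.nat 12 l 0 = c l) (hjm : j < m)
    (hbest : ∀ Q ≤ P, s.val 4 j Q = best w c own j Q) :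
    Runs tableCell s 5 (fun s' =>
      s' = (s.setVal 4 (j + 1) P (best w c own (j + 1) P)).setNat 13 j P
        (if Takes w c own j P then 1 else 0)) := by
  have hT : takeTest.Holds s ↔ Takes w c own j P := by
    simp only [takeTest, Test.Holds, NExp.eval, VExp.eval, nv, hi, hj, hP, hw, hown j hjm,
      hc j hjm, Takes, hbest P le_rfl, hbest _ (Nat.sub_le P (c j)), Nat.le_zero]
  refine (Runs.ite (T := 2) (T' := 2) (fun h => ?_) (fun h => ?_))
  · rw [hT] at h
    refine Runs.seq (Runs.setVal (Runs.setNat ?_))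
    simp only [NExp.eval, VExp.eval, nv, hi, hj, hP, hw, hc j hjm, hbest _ (Nat.sub_le P (c j)),
      best_succ_of_takes h, if_pos h, Mem.nat_setVal]
  · rw [hT] at h
    refine Runs.seq (Runs.setVal (Runs.setNat ?_))
    simp only [NExp.eval, VExp.eval, nv, hj, hP, hbest P le_rfl,
      best_succ_of_not_takes h, if_neg h, Mem.nat_setVal]

/-- The data that the sale to bidder `i` reads. -/
structure SaleData (s : Mem) (i m R : ℕ) (w : ℕ → ℝ) (c own : ℕ → ℕ) : Prop where
  i_eq : s.nat 3 0 0 = i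
  m_eq : s.nat 0 0 1 = m
  R_eq : s.nat 14 0 0 = R
  w_eq : s.val 0 i = w
  own_eq : ∀ l < m, s.nat 2 l 0 = own l
  c_eq : ∀ l < m, s.nat 12 l 0 = c l

theorem SaleData.agree {s s' : Mem} {i m R : ℕ} {w : ℕ → ℝ} {c own : ℕ → ℕ} {p : Program}
    (h : SaleData s i m R w c own) (ha : Agree p s s') (h3 : p.writesNat 3 = false)
    (h0 : p.writesNat 0 = false) (h14 : p.writesNat 14 = false) (hv : p.writesVal 0 = false)
    (h2 : p.writesNat 2 = false) (h12 : p.writesNat 12 = false) : SaleData s' i m R w c own := by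
  constructor
  · rw [ha.nat 3 h3, h.i_eq]
  · rw [ha.nat 0 h0, h.m_eq]
  · rw [ha.nat 14 h14, h.R_eq]
  · rw [ha.val 0 hv, h.w_eq]
  · rw [ha.nat 2 h2]
    exact h.own_eq
  · rw [ha.nat 12 h12]
    exact h.c_eq

-- Row `j + 1` needs row `j` only, at costs up to the current one, so the table can be filled row by
-- row. The stored decisions allow the bundle to be recovered later.
open Classical in
theorem tableProg_runs {s : Mem} {i m R : ℕ} {w : ℕ → ℝ} {c own : ℕ → ℕ}
    (h : SaleData s i m R w c own) :
    Runs tableProg s (20 * (m + 1) * (R + 1)) (fun s' =>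
      (∀ P ≤ R, s'.val 4 m P = best w c own m P) ∧
      ∀ j < m, ∀ P ≤ R, s'.nat 13 j P = if Takes w c own j P then 1 else 0) := by
  refine Runs.le (T := (R + 1) * (1 + 2) + 2 + (m * (((R + 1) * (5 + 2) + 2) + 2) + 2))
    (Runs.seq ?_) (by nlinarith [Nat.zero_le (m * R)])
  refine (Runs.forTo (N := R + 1) (T := 1)
    (I := fun k s' => ∀ P < k, s'.val 4 0 P = 0) rfl ?_ ?_ ?_).mono ?_
  · intro s' ha
    simp [NExp.eval, nv, ha.nat 14 rfl, h.R_eq]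
  · simp
  · intro k hk s' ha hs hI
    refine Runs.setVal ?_
    intro P hP
    simp only [Mem.val_setNat, Mem.val_setVal, NExp.eval, nv, hs, VExp.eval, true_and]
    split_ifs with hPk
    · rfl
    · exact hI P (by omega)
  · intro s₁ ha₁ h0
    have h₁ := h.agree ha₁ rfl rfl rfl rfl rfl rfl
    refine (Runs.forTo (N := m) (T := (R + 1) * (5 + 2) + 2)
      (I := fun k s' => (∀ l ≤ k, ∀ P ≤ R, s'.val 4 l P = best w c own l P) ∧
        ∀ j < k, ∀ P ≤ R, s'.nat 13 j P = if Takes w c own j P then 1 else 0)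
      rfl ?_ ?_ ?_).mono fun s' _ h => ⟨h.1 m le_rfl, h.2⟩
    · intro s' ha
      simp [NExp.eval, nItems, ha.nat 0 rfl, h₁.m_eq]
    · refine ⟨fun l hl P hP => ?_, by simp⟩
      obtain rfl : l = 0 := by omega
      simpa [best] using h0 P (by omega)
    · rintro j hj s₂ ha₂ hs₂ ⟨hI, hI'⟩
      have h₂ := h₁.agree ha₂ rfl rfl rfl rfl rfl rfl
      refine (Runs.forTo (N := R + 1) (T := 5)
        (I := fun k s' => (∀ l ≤ j, ∀ P ≤ R, s'.val 4 l P = best w c own l P) ∧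
          (∀ l < j, ∀ P ≤ R, s'.nat 13 l P = if Takes w c own l P then 1 else 0) ∧
          ∀ P < k, s'.val 4 (j + 1) P = best w c own (j + 1) P ∧
            s'.nat 13 j P = if Takes w c own j P then 1 else 0)
        rfl ?_ ?_ ?_).mono ?_
      · intro s' ha
        simp [NExp.eval, nv, ha.nat 14 rfl, h₂.R_eq]
      · refine ⟨hI, ?_, by simp⟩
        simpa using hI'
      · rintro P hP s₃ ha₃ hs₃ ⟨hJ₁, hJ₂, hJ₃⟩
        have h₃ := h₂.agree ha₃ rfl rfl rfl rfl rfl rfl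
        refine (tableCell_runs h₃.i_eq ((congrFun (congrFun (ha₃.nat 4 rfl) 0) 0).trans hs₂) hs₃
          h₃.w_eq h₃.own_eq h₃.c_eq hj fun Q hQ => hJ₁ j le_rfl Q (by omega)).mono ?_
        rintro s₄ - rfl
        refine ⟨fun l hl Q hQ => ?_, fun l hl Q hQ => ?_, fun Q hQ => ⟨?_, ?_⟩⟩
        · have : l ≠ j + 1 := by omega
          simpa [this] using hJ₁ l hl Q hQ
        · have : l ≠ j := by omega
          simpa [this] using hJ₂ l hl Q hQ
        · by_cases hQP : Q = P
          · simp [hQP]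
          · simpa [hQP] using (hJ₃ Q (by omega)).1
        · by_cases hQP : Q = P
          · simp [hQP]
          · simpa [hQP] using (hJ₃ Q (by omega)).2
      · rintro s₃ - ⟨hJ₁, hJ₂, hJ₃⟩
        refine ⟨fun l hl P hP => ?_, fun l hl P hP => ?_⟩
        · rcases Nat.lt_or_ge j l with hlj | hlj
          · obtain rfl : l = j + 1 := by omega
            simpa using (hJ₃ P (by omega)).1
          · simpa using hJ₁ l hlj P hP
        · rcases Nat.lt_or_ge l j with hlj | hlj
          · simpa using hJ₂ l hlj P hP
          · obtain rfl : l = j := by omega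
            simpa using (hJ₃ P (by omega)).2

/-- The smaller one of the budget and the entry `e` of the last row of the knapsack table. -/
def cappedProg (e : NExp) : Program :=
  .ite (.valLe (.get 1 (nv 3) (.const 0)) (.get 4 nItems e))
    (setR 7 (.get 1 (nv 3) (.const 0))) (setR 7 (.get 4 nItems e))

/-- The search for the best total cost (scalar `15`); the payment is stored. -/
def scanProg : Program :=
  .seq (setR 5 .zero) <| .seq (.setVal 2 (nv 3) (.const 0) .zero) <|
  .seq (setN 15 (.const 0)) <| .seq (cappedProg (.const 0)) <| .seq (setR 6 (rv 7)) <|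
  forTo 5 (nv 14) <|
    .seq (setR 5 (.add (rv 5) (rv 3))) <| .seq (cappedProg (.add (nv 5) (.const 1))) <|
    .seq (setR 7 (.sub (rv 7) (rv 5))) <|
    .ite (.valLe (rv 6) (rv 7))
      (.seq (setR 6 (rv 7)) <| .seq (setN 15 (.add (nv 5) (.const 1)))
        (.setVal 2 (nv 3) (.const 0) (rv 5)))
      .skip

theorem cappedProg_runs {s : Mem} {i m P : ℕ} {B f : ℝ} {e : NExp} (hi : s.nat 3 0 0 = i)
    (hm : s.nat 0 0 1 = m) (he : e.eval s = P) (hB : s.val 1 i 0 = B) (hf : s.val 4 m P = f) :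
    Runs (cappedProg e) s 3 (fun s' => s' = s.setVal 7 0 0 (min B f)) := by
  refine Runs.ite (T := 1) (T' := 1) (fun h => Runs.setR ?_) (fun h => Runs.setR ?_)
  · simp only [Test.Holds, VExp.eval, NExp.eval, nItems, nv, hi, hm, he, hB, hf] at h
    simp only [VExp.eval, NExp.eval, nv, hi, hB, min_eq_left h]
  · simp only [Test.Holds, VExp.eval, NExp.eval, nItems, nv, hi, hm, he, hB, hf, not_le] at h
    simp only [VExp.eval, NExp.eval, nItems, hm, he, hf, min_eq_right h.le]

/-- The machine has no multiplication, so `P * p` is accumulated by adding `p` in every round.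
Replacing the candidate also on equality matches the choice of the last maximizer. -/
theorem scanProg_runs {s : Mem} {i m R : ℕ} {w : ℕ → ℝ} {c own : ℕ → ℕ} {B p : ℝ} {f u : ℕ → ℝ}
    (h : SaleData s i m R w c own) (hB : s.val 1 i 0 = B) (hp : s.val 3 0 0 = p)
    (hf : ∀ P ≤ R, s.val 4 m P = f P) (hu : ∀ P, u P = min B (f P) - P * p) :
    Runs scanProg s (20 * (R + 1)) (fun s' =>
      s'.nat 15 0 0 = lastArgmax u R ∧ s'.val 2 i 0 = lastArgmax u R * p ∧
      ∀ i', i' ≠ i → s'.val 2 i' = s.val 2 i') := by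
  refine Runs.le (T := 1 + (1 + (1 + (3 + (1 + (R * (1 + (3 + (1 + ((1 + (1 + 1)) + 1 + 1))) + 2)
    + 2)))))) (Runs.seq (Runs.setR (Runs.seq (Runs.setVal (Runs.seq (Runs.setN (Runs.seq
    ((cappedProg_runs (i := i) (m := m) (P := 0) (B := B) (f := f 0) ?_ ?_ ?_ ?_ ?_).mono
      fun s₁ _ hs₁ => Runs.seq (Runs.setR ?_)))))))))
    (by omega)
  · simpa using h.i_eq
  · simpa using h.m_eq
  · rfl
  · simpa using hB
  · simpa using hf 0 (Nat.zero_le _)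
  subst hs₁
  refine (Runs.forTo (N := R) (T := 1 + (3 + (1 + ((1 + (1 + 1)) + 1 + 1))))
    (I := fun k s' => s'.nat 15 0 0 = lastArgmax u k ∧ s'.val 6 0 0 = u (lastArgmax u k) ∧
      s'.val 5 0 0 = k * p ∧ s'.val 2 i 0 = lastArgmax u k * p ∧
      ∀ i', i' ≠ i → s'.val 2 i' = s.val 2 i') rfl ?_ ?_ ?_).mono
    fun s' _ h => ⟨h.1, h.2.2.2.1, h.2.2.2.2⟩
  · intro s' ha
    simp only [nv, NExp.eval, ha.nat 14 rfl]
    simpa using h.R_eq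
  · refine ⟨?_, ?_, ?_, ?_, ?_⟩
    · simp [lastArgmax, NExp.eval]
    · simp [lastArgmax, VExp.eval, NExp.eval, rv, hu]
    · simp [VExp.eval]
    · simp [lastArgmax, VExp.eval, NExp.eval, nv, h.i_eq]
    · intro i' hi'
      funext j'
      simp [VExp.eval, NExp.eval, nv, h.i_eq, hi']
  · rintro k hk s' ha hs ⟨h1, h2, h3, h4, h5⟩
    have hi' : s'.nat 3 0 0 = i := by
      rw [ha.nat 3 rfl]
      simpa using h.i_eq
    have hm' : s'.nat 0 0 1 = m := by
      rw [ha.nat 0 rfl]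
      simpa using h.m_eq
    have hB' : s'.val 1 i 0 = B := by
      rw [ha.val 1 rfl]
      simpa using hB
    have hp' : s'.val 3 0 0 = p := by
      rw [ha.val 3 rfl]
      simpa using hp
    have hf' : s'.val 4 m (k + 1) = f (k + 1) := by
      rw [ha.val 4 rfl]
      simpa using hf (k + 1) hk
    refine Runs.seq (Runs.setR (Runs.seq ((cappedProg_runs (i := i) (m := m) (P := k + 1)
      (B := B) (f := f (k + 1)) ?_ ?_ ?_ ?_ ?_).mono fun s₁ _ hs₁ => Runs.seq (Runs.setR ?_))))
    · simpa using hi'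
    · simpa using hm'
    · simp [NExp.eval, nv, hs]
    · simpa using hB'
    · simpa using hf'
    subst hs₁
    have h7 : min B (f (k + 1)) - (k * p + p) = u (k + 1) := by
      rw [hu]
      push_cast
      ring
    simp only [VExp.eval, NExp.eval, rv, Mem.val_setVal, h3, hp', and_self, if_true]
    simp only [show ((5 : ℕ) = 7) = False by simp, false_and, if_false, h7]
    refine Runs.ite (T := 1 + (1 + 1)) (T' := 1) (fun ht => ?_) (fun ht => Runs.skip ?_)
    · refine Runs.seq (Runs.setR (Runs.seq (Runs.setN (Runs.setVal ?_))))
      simp [Test.Holds, VExp.eval, NExp.eval, h2] at ht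
      refine ⟨?_, ?_, ?_, ?_, ?_⟩
      · simp [lastArgmax, ht, NExp.eval, nv, hs]
      · simp [lastArgmax, ht, VExp.eval, NExp.eval]
      · simp
        ring
      · simp [lastArgmax, ht, VExp.eval, NExp.eval, nv, hi']
        ring
      · intro i' hne
        funext j'
        simp [VExp.eval, NExp.eval, nv, hi', hne, h5 i' hne]
    · simp [Test.Holds, VExp.eval, NExp.eval, h2] at ht
      refine ⟨?_, ?_, ?_, ?_, ?_⟩
      · simp [lastArgmax, not_le.2 ht, h1]
      · simp [lastArgmax, not_le.2 ht, h2]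
      · simp
        ring
      · simp [lastArgmax, not_le.2 ht, h4]
      · intro i' hne
        funext j'
        simp [h5 i' hne]

/-- The bundle of the bidder is read off the knapsack table. -/
def assignProg : Program :=
  forTo 4 nItems <|
    .ite (.natLe (.const 1) (.get 13 (.sub (.sub nItems (nv 4)) (.const 1)) (nv 15)))
      (.seq (.setNat 2 (.sub (.sub nItems (nv 4)) (.const 1)) (.const 0)
          (.add (nv 3) (.const 1)))
        (setN 15 (.sub (nv 15) (.get 12 (.sub (.sub nItems (nv 4)) (.const 1)) (.const 0)))))
      .skip

-- Backtracking from the highest item down, with the remaining cost in scalar `15`. After `k` rounds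
-- the items from `m - k` on are settled, and membership of the lower ones is that in `pick` for `m
-- - k` items and the remaining cost. The bound by `R` keeps all lookups inside the filled table.
open Classical in
theorem assignProg_runs {s : Mem} {i m R P : ℕ} {w : ℕ → ℝ} {c own : ℕ → ℕ}
    (h : SaleData s i m R w c own) (hP : s.nat 15 0 0 = P) (hPR : P ≤ R)
    (ht : ∀ j < m, ∀ P ≤ R, s.nat 13 j P = if Takes w c own j P then 1 else 0) :
    Runs assignProg s (10 * (m + 1)) (fun s' =>
      ∀ l < m, s'.nat 2 l 0 = if l ∈ pick w c own m P then i + 1 else own l) := by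
  refine Runs.le (T := m * ((1 + 1) + 1 + 1 + 2) + 2) ?_ (by omega)
  refine (Runs.forTo (N := m) (I := fun k s' => s'.nat 15 0 0 ≤ R ∧
    (∀ l < m, m - k ≤ l → s'.nat 2 l 0 = if l ∈ pick w c own m P then i + 1 else own l) ∧
    (∀ l < m - k, s'.nat 2 l 0 = own l) ∧
    ∀ l < m - k, l ∈ pick w c own m P ↔ l ∈ pick w c own (m - k) (s'.nat 15 0 0))
    rfl ?_ ?_ ?_).mono fun s' _ h' l hl => h'.2.1 l hl (by omega)
  · intro s' ha
    simp [NExp.eval, nItems, ha.nat 0 rfl, h.m_eq]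
  · refine ⟨?_, ?_, ?_, ?_⟩
    · simpa [hP] using hPR
    · intro l hl hl'
      omega
    · intro l hl
      simpa using h.own_eq l (by omega)
    · simp [hP]
  · rintro k hk s' ha hs ⟨h0, h1, h2, h3⟩
    have hi' : s'.nat 3 0 0 = i := by rw [ha.nat 3 rfl, h.i_eq]
    have hm' : s'.nat 0 0 1 = m := by rw [ha.nat 0 rfl, h.m_eq]
    obtain ⟨j, hj⟩ : ∃ j, m - k = j + 1 := ⟨m - k - 1, by omega⟩
    have hj' : m - k - 1 = j := by omega
    have hj'' : m - (k + 1) = j := by omega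
    have hc' : s'.nat 12 j 0 = c j := by rw [ha.nat 12 rfl, h.c_eq j (by omega)]
    generalize hcur : s'.nat 15 0 0 = P' at h0 h3
    have ht' : s'.nat 13 j P' = if Takes w c own j P' then 1 else 0 := by
      rw [ha.nat 13 rfl, ht j (by omega) P' h0]
    rw [hj] at h1 h2 h3
    have hTest : (Test.natLe (.const 1)
        (.get 13 (.sub (.sub nItems (nv 4)) (.const 1)) (nv 15))).Holds s' ↔
        Takes w c own j P' := by
      simp only [Test.Holds, NExp.eval, nItems, nv, hm', hs, hj', hcur, ht']
      split_ifs with hT <;> simp [hT]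
    refine Runs.ite (T := 1 + 1) (T' := 1) (fun hT => ?_) (fun hT => Runs.skip ?_)
    · rw [hTest] at hT
      refine Runs.seq (Runs.setNat (Runs.setN ?_))
      simp only [NExp.eval, nItems, nv, hm', hs, hj', hi']
      rw [pick_succ_of_takes hT] at h3
      have hcur' : (((s'.setNat 2 j 0 (i + 1)).setNat 15 0 0
        ((s'.setNat 2 j 0 (i + 1)).nat 15 0 0 - (s'.setNat 2 j 0 (i + 1)).nat 12
          ((s'.setNat 2 j 0 (i + 1)).nat 0 0 1 - (s'.setNat 2 j 0 (i + 1)).nat 4 0 0 - 1) 0)).setNat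
          4 0 0 (k + 1)).nat 15 0 0 = P' - c j := by
        simp [hcur, hm', hs, hj', hc']
      refine ⟨?_, ?_, ?_, ?_⟩
      · rw [hcur']
        omega
      · intro l hl hl'
        rcases Nat.lt_or_ge j l with hjl | hjl
        · have : l ≠ j := by omega
          simpa [this] using h1 l hl (by omega)
        · obtain rfl : l = j := by omega
          have : l ∈ pick w c own m P := (h3 l (by omega)).2 (Finset.mem_insert_self _ _)
          simp [this]
      · intro l hl
        have : l ≠ j := by omega
        simpa [this] using h2 l (by omega)
      · intro l hl
        have : l ≠ j := by omega
        rw [hcur', hj'', h3 l (by omega), Finset.mem_insert, or_iff_right this]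
    · rw [hTest] at hT
      rw [pick_succ_of_not_takes hT] at h3
      refine ⟨by simp [hcur, h0], ?_, ?_, ?_⟩
      · intro l hl hl'
        rcases Nat.lt_or_ge j l with hjl | hjl
        · simpa using h1 l hl (by omega)
        · obtain rfl : l = j := by omega
          have : l ∉ pick w c own m P := fun hmem =>
            notMem_pick_self _ _ ((h3 l (by omega)).1 hmem)
          simpa [this] using h2 l (by omega)
      · intro l hl
        simpa using h2 l (by omega)
      · intro l hl
        simpa [hcur, hj''] using h3 l (by omega)

theorem lastArgmax_le (u : ℕ → ℝ) (k : ℕ) : lastArgmax u k ≤ k := by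
  induction k with
  | zero => exact le_rfl
  | succ k ih =>
    rw [lastArgmax]
    split_ifs
    · exact le_rfl
    · exact ih.trans (Nat.le_succ k)

/-- The sale to the bidder in scalar `3`. -/
def saleProg : Program := .seq tableProg (.seq scanProg assignProg)

/-- The total cost of all items bounds the cost of every bundle, so it is a sufficient width for the
table. The time is pseudo-polynomial; it becomes polynomial once the prices are bounded by
`maxCost`. -/
theorem saleProg_runs {s : Mem} {X : Market} {i : ℕ} {c own : ℕ → ℕ} {p : ℝ}
    (h : SaleData s i X.m (∑ j ∈ Finset.range X.m, c j) (X.w i) c own)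
    (hB : s.val 1 i 0 = X.B i) (hp : s.val 3 0 0 = p) :
    Runs saleProg s (50 * (X.m + 1) * ((∑ j ∈ Finset.range X.m, c j) + 1)) (fun s' =>
      (∀ l < X.m, s'.nat 2 l 0 = if l ∈ X.demand p c own i then i + 1 else own l) ∧
      s'.val 2 i 0 = X.demandCost p c own i * p ∧
      ∀ i', i' ≠ i → s'.val 2 i' = s.val 2 i') := by
  generalize hR : ∑ j ∈ Finset.range X.m, c j = R at h ⊢
  refine Runs.le (T := 20 * (X.m + 1) * (R + 1) + (20 * (R + 1) + 10 * (X.m + 1))) (Runs.seq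
    ((tableProg_runs h).mono ?_)) (by nlinarith [Nat.zero_le (X.m * R)])
  rintro s₁ ha₁ ⟨hf, ht⟩
  have h₁ := h.agree ha₁ rfl rfl rfl rfl rfl rfl
  refine Runs.seq ((scanProg_runs h₁ (B := X.B i) (p := p) (f := best (X.w i) c own X.m)
    (u := X.utilityUpTo p c own i) ?_ ?_ hf fun P => rfl).mono ?_)
  · rw [ha₁.val 1 rfl, hB]
  · rw [ha₁.val 3 rfl, hp]
  rintro s₂ ha₂ ⟨h15, hpay, hpay'⟩
  have h₂ := h₁.agree ha₂ rfl rfl rfl rfl rfl rfl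
  refine (assignProg_runs h₂ h15 (lastArgmax_le _ _) ?_).mono ?_
  · rw [ha₂.nat 13 rfl]
    exact ht
  intro s₃ ha₃ hown
  have hcost : lastArgmax (X.utilityUpTo p c own i) R = X.demandCost p c own i := by
    rw [Market.demandCost, hR]
  rw [hcost] at hown hpay
  refine ⟨hown, ?_, fun i' hi' => ?_⟩
  · rw [ha₃.val 2 rfl, hpay]
  · rw [ha₃.val 2 rfl, hpay' i' hi', ha₁.val 2 rfl]

/-! ### The program: the sale to a group, and the whole mechanism -/

/-- The memory holds the market `X` and the coins `cn`. -/
structure MarketData (s : Mem) (X : Market) (cn : ℕ → ℕ) : Prop where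
  n_eq : s.nat 0 0 0 = X.n
  m_eq : s.nat 0 0 1 = X.m
  w_eq : s.val 0 = X.w
  B_eq : ∀ i < X.n, s.val 1 i 0 = X.B i
  coin_eq : s.nat 1 0 = cn

theorem MarketData.congr {s s' : Mem} {X : Market} {cn : ℕ → ℕ} (h : MarketData s X cn)
    (h0 : s'.nat 0 = s.nat 0) (h1 : s'.nat 1 = s.nat 1) (hv0 : s'.val 0 = s.val 0)
    (hv1 : s'.val 1 = s.val 1) : MarketData s' X cn := by
  constructor
  · rw [h0, h.n_eq]
  · rw [h0, h.m_eq]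
  · rw [hv0, h.w_eq]
  · rw [hv1]
    exact h.B_eq
  · rw [h1, h.coin_eq]

theorem MarketData.agree {s s' : Mem} {X : Market} {cn : ℕ → ℕ} {p : Program}
    (h : MarketData s X cn) (ha : Agree p s s') (h0 : p.writesNat 0 = false)
    (h1 : p.writesNat 1 = false) (hv0 : p.writesVal 0 = false) (hv1 : p.writesVal 1 = false) :
    MarketData s' X cn := h.congr (ha.nat 0 h0) (ha.nat 1 h1) (ha.val 0 hv0) (ha.val 1 hv1)

/-- The coin with index `e`. -/
def coin (e : NExp) : NExp := .get 1 (.const 0) e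

/-- Whether the bidder in scalar `3` belongs to the group in scalar `16`. -/
def groupTest : Test :=
  .conj (.natLe (coin (nv 3)) (.const 0))
    (.conj (.natLe (coin (.add nBidders (nv 3))) (nv 16))
      (.natLe (nv 16) (coin (.add nBidders (nv 3)))))

/-- The sale to the group in scalar `16` at the costs in the natural array `12`. -/
def auctionProg : Program :=
  .seq (setN 14 (.const 0)) <|
  .seq (forTo 4 nItems (.seq (.setNat 2 (nv 4) (.const 0) (.const 0))
    (setN 14 (.add (nv 14) (.get 12 (nv 4) (.const 0)))))) <|
  forTo 3 nBidders (.ite groupTest saleProg (.setVal 2 (nv 3) (.const 0) .zero))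

theorem auctionProg_runs {s : Mem} {X : Market} {cn : ℕ → ℕ} {c : ℕ → ℕ} {p : ℝ} {z M : ℕ}
    {H : ℕ → Bool} (h : MarketData s X cn) (hc : ∀ l < X.m, s.nat 12 l 0 = c l)
    (hM : ∀ l < X.m, c l ≤ M) (hz : s.nat 16 0 0 = z) (hp : s.val 3 0 0 = p)
    (hH : ∀ i < X.n, H i = true ↔ cn i = 0 ∧ cn (X.n + i) = z) :
    Runs auctionProg s (100 * (X.n + 1) * (X.m + 1) * (X.m * M + 1)) (fun s' =>
      (∀ j < X.m, s'.nat 2 j 0 = X.owners H c p X.n j) ∧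
      ∀ i < X.n, s'.val 2 i 0 = X.salePay H c p i) := by
  have hR : ∑ j ∈ Finset.range X.m, c j ≤ X.m * M := by
    refine (Finset.sum_le_card_nsmul _ _ M fun l hl => hM l (Finset.mem_range.1 hl)).trans ?_
    simp
  generalize hT : 50 * (X.m + 1) * ((∑ j ∈ Finset.range X.m, c j) + 1) = T
  refine Runs.le (T := 1 + (X.m * ((1 + 1) + 2) + 2 + (X.n * (T + 1 + 1 + 2) + 2)))
    (Runs.seq (Runs.setN (Runs.seq ?_))) ?_
  · refine (Runs.forTo (N := X.m) (I := fun k s' =>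
      s'.nat 14 0 0 = ∑ j ∈ Finset.range k, c j ∧ ∀ l < k, s'.nat 2 l 0 = 0) rfl ?_ ?_ ?_).mono ?_
    · intro s' ha
      simp only [NExp.eval, nItems, ha.nat 0 rfl]
      simpa using h.m_eq
    · simp [NExp.eval]
    · rintro k hk s' ha hs ⟨hI, hI'⟩
      refine Runs.seq (Runs.setNat (Runs.setN ?_))
      have hc' : s'.nat 12 k 0 = c k := by
        rw [ha.nat 12 rfl]
        simpa using hc k hk
      refine ⟨?_, fun l hl => ?_⟩
      · simp [NExp.eval, nv, hs, hI, hc', Finset.sum_range_succ]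
      · by_cases hlk : l = k
        · simp [NExp.eval, nv, hs, hlk]
        · simpa [NExp.eval, nv, hs, hlk] using hI' l (by omega)
    · rintro s₁ ha₁ ⟨hR₁, hown₁⟩
      have hm₀ : MarketData (s.setNat 14 0 0 ((NExp.const 0).eval s)) X cn :=
        h.congr (Mem.nat_setNat_of_ne _ _ _ _ (by decide))
          (Mem.nat_setNat_of_ne _ _ _ _ (by decide)) rfl rfl
      have hm₁ : MarketData s₁ X cn := hm₀.agree ha₁ rfl rfl rfl rfl
      have hc₁ : ∀ l < X.m, s₁.nat 12 l 0 = c l := by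
        rw [ha₁.nat 12 rfl]
        simpa using hc
      have hz₁ : s₁.nat 16 0 0 = z := by
        rw [ha₁.nat 16 rfl]
        simpa using hz
      have hp₁ : s₁.val 3 0 0 = p := by
        rw [ha₁.val 3 rfl]
        simpa using hp
      refine (Runs.forTo (N := X.n) (I := fun k s' =>
        (∀ j < X.m, s'.nat 2 j 0 = X.owners H c p k j) ∧
        ∀ i < k, s'.val 2 i 0 = X.salePay H c p i) rfl ?_ ?_ ?_).mono fun s' _ h => h
      · intro s' ha
        simp only [NExp.eval, nBidders, nv, ha.nat 0 rfl]
        exact hm₁.n_eq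
      · refine ⟨fun j hj => ?_, by simp⟩
        simpa [Market.owners] using hown₁ j hj
      · rintro i hi s₂ ha₂ hs₂ ⟨hI, hI'⟩
        have hm₂ := hm₁.agree ha₂ rfl rfl rfl rfl
        have hz₂ : s₂.nat 16 0 0 = z := by rw [ha₂.nat 16 rfl, hz₁]
        have ht : groupTest.Holds s₂ ↔ H i = true := by
          rw [hH i hi]
          simp only [groupTest, Test.Holds, NExp.eval, nBidders, coin, nv, hs₂, hz₂, hm₂.n_eq,
            hm₂.coin_eq]
          omega
        refine Runs.ite (T := T) (T' := 1) (fun hg => ?_) (fun hg => Runs.setVal ?_)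
        · rw [ht] at hg
          rw [← hT]
          refine (saleProg_runs (X := X) (i := i) (c := c) (own := X.owners H c p i) (p := p)
            ⟨hs₂, hm₂.m_eq, ?_, ?_, hI, ?_⟩ (hm₂.B_eq i hi) ?_).mono ?_
          · rw [ha₂.nat 14 rfl, hR₁]
          · rw [hm₂.w_eq]
          · rw [ha₂.nat 12 rfl]
            exact hc₁
          · rw [ha₂.val 3 rfl, hp₁]
          · rintro s₃ - ⟨h1, h2, h3⟩
            refine ⟨fun j hj => ?_, fun i' hi' => ?_⟩
            · simp [h1 j hj, Market.owners, hg]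
            · rcases Nat.lt_or_ge i' i with hlt | hge
              · rw [Mem.val_setNat, h3 i' (by omega), hI' i' hlt]
              · obtain rfl : i' = i := by omega
                simp [h2, Market.salePay, hg]
        · rw [ht] at hg
          refine ⟨fun j hj => ?_, fun i' hi' => ?_⟩
          · simpa [Market.owners, hg] using hI j hj
          · by_cases hii : i' = i
            · simp [NExp.eval, VExp.eval, nv, hs₂, hii, Market.salePay, hg]
            · simpa [NExp.eval, VExp.eval, nv, hs₂, hii] using hI' i' (by omega)
  · rw [← hT]
    have h1 : 50 * (X.m + 1) * ((∑ j ∈ Finset.range X.m, c j) + 1) ≤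
        50 * (X.m + 1) * (X.m * M + 1) := by gcongr
    have h2 := Nat.mul_le_mul_left X.n h1
    have h3 : (X.n + X.m + 1) * 1 ≤ (X.n + 1) * (X.m + 1) * (X.m * M + 1) := by
      refine Nat.mul_le_mul ?_ (by omega)
      nlinarith [Nat.zero_le (X.n * X.m)]
    have h4 : (X.m + 1) * (X.m * M + 1) ≤ (X.n + 1) * ((X.m + 1) * (X.m * M + 1)) :=
      Nat.le_mul_of_pos_left _ (by omega)
    nlinarith

/-! ### Programs for the budgets, the unit price, the price level and the second price auction -/

/-- Every budget is replaced by the value of the bundle of all items. -/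
def normalizeProg : Program :=
  forTo 3 nBidders <|
    .seq (setR 7 .zero) <|
    .seq (forTo 4 nItems (setR 7 (.add (rv 7) (.get 0 (nv 3) (nv 4))))) <|
    .ite (.valLe (rv 7) (.get 1 (nv 3) (.const 0))) (.setVal 1 (nv 3) (.const 0) (rv 7)) .skip

/-- A valuation can have several valid budgets. After this replacement the memory depends on the
valuation alone, as the output must. -/
theorem normalizeProg_runs {s : Mem} {n m : ℕ} {w : ℕ → ℕ → ℝ} {b : ℕ → ℝ}
    (hn : s.nat 0 0 0 = n) (hm : s.nat 0 0 1 = m) (hw : s.val 0 = w)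
    (hb : ∀ i < n, s.val 1 i 0 = b i) :
    Runs normalizeProg s (20 * (n + 1) * (m + 1)) (fun s' =>
      ∀ i < n, s'.val 1 i 0 = min (b i) (∑ j ∈ Finset.range m, w i j)) := by
  refine Runs.le (T := n * (1 + ((m * (1 + 2) + 2) + (1 + 1 + 1)) + 2) + 2) ?_
    (by nlinarith [Nat.zero_le (n * m)])
  refine (Runs.forTo (N := n) (I := fun k s' =>
    (∀ i < k, s'.val 1 i 0 = min (b i) (∑ j ∈ Finset.range m, w i j)) ∧
      ∀ i < n, k ≤ i → s'.val 1 i 0 = b i) rfl ?_ ?_ ?_).mono fun s' _ h => h.1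
  · intro s' ha
    simp [NExp.eval, nBidders, nv, ha.nat 0 rfl, hn]
  · simpa using hb
  · rintro k hk s₁ ha₁ hs₁ ⟨h1, h2⟩
    refine Runs.seq (Runs.setR (Runs.seq ((Runs.forTo (N := m) (I := fun l s' =>
      s'.val 7 0 0 = ∑ j ∈ Finset.range l, w k j) rfl ?_ ?_ ?_).mono ?_)))
    · intro s' ha
      simp [NExp.eval, nItems, ha.nat 0 rfl, ha₁.nat 0 rfl, hm]
    · simp [VExp.eval]
    · intro l hl s₂ ha₂ hs₂ hI
      refine Runs.setR ?_
      have h3 : s₂.nat 3 0 0 = k := by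
        rw [ha₂.nat 3 rfl]
        simpa using hs₁
      have h0 : s₂.val 0 = w := by
        rw [ha₂.val 0 rfl, Mem.val_setVal_of_ne _ _ _ _ (by decide), ha₁.val 0 rfl, hw]
      simp [VExp.eval, NExp.eval, rv, nv, hI, h3, hs₂, h0, Finset.sum_range_succ]
    · intro s₂ ha₂ hsum
      have h3 : s₂.nat 3 0 0 = k := by
        rw [ha₂.nat 3 rfl]
        simpa using hs₁
      have hB : s₂.val 1 = s₁.val 1 := by
        rw [ha₂.val 1 rfl, Mem.val_setVal_of_ne _ _ _ _ (by decide)]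
      refine Runs.ite (fun ht => Runs.setVal ?_) (fun ht => Runs.skip ?_)
      all_goals
        simp only [Test.Holds, VExp.eval, NExp.eval, rv, nv, h3, hsum, hB, h2 k hk le_rfl] at ht
        refine ⟨fun i hi => ?_, fun i hi hki => ?_⟩
      · by_cases hik : i = k
        · simp [NExp.eval, VExp.eval, nv, rv, h3, hik, hsum, min_eq_right ht]
        · simpa [NExp.eval, VExp.eval, nv, rv, h3, hik, hB] using h1 i (by omega)
      · have hik : i ≠ k := by omega
        simpa [NExp.eval, VExp.eval, nv, rv, h3, hik, hB] using h2 i hi (by omega)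
      · by_cases hik : i = k
        · simp [hik, hB, min_eq_left (not_le.1 ht).le, h2 k hk le_rfl]
        · simpa [hB] using h1 i (by omega)
      · simpa [hB] using h2 i hi (by omega)

/-- The highest budget in the estimating group, in the real scalar `3`. -/
def topProg : Program :=
  .seq (setR 3 .zero) <|
  forTo 3 nBidders <|
    .ite (.conj (.neg (.natLe (coin (nv 3)) (.const 0)))
        (.valLe (rv 3) (.get 1 (nv 3) (.const 0))))
      (setR 3 (.get 1 (nv 3) (.const 0))) .skip

theorem topProg_runs {s : Mem} {X : Market} {cn : ℕ → ℕ} {a : ℕ → Bool} (h : MarketData s X cn)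
    (ha : ∀ i < X.n, a i = true ↔ cn i ≠ 0) :
    Runs topProg s (10 * (X.n + 1)) (fun s' => s'.val 3 0 0 = X.topBudget a X.n) := by
  refine Runs.le (T := 1 + (X.n * (1 + 1 + 1 + 2) + 2)) (Runs.seq (Runs.setR ?_)) (by omega)
  refine (Runs.forTo (N := X.n) (I := fun k s' => s'.val 3 0 0 = X.topBudget a k)
    rfl ?_ ?_ ?_).mono fun s' _ h => h
  · intro s' ha
    simpa [NExp.eval, nBidders, nv, ha.nat 0 rfl] using h.n_eq
  · simp [VExp.eval, Market.topBudget]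
  · intro k hk s₁ ha₁ hs₁ hI
    have h0 : MarketData (s.setVal 3 0 0 (VExp.zero.eval s)) X cn :=
      h.congr rfl rfl (Mem.val_setVal_of_ne _ _ _ _ (by decide))
        (Mem.val_setVal_of_ne _ _ _ _ (by decide))
    have h1 : MarketData s₁ X cn := h0.agree ha₁ rfl rfl rfl rfl
    refine Runs.ite (fun ht => Runs.setR ?_) (fun ht => Runs.skip ?_) <;>
    · simp only [Test.Holds, VExp.eval, NExp.eval, rv, nv, coin, hs₁, h1.coin_eq, hI,
        h1.B_eq k hk, Nat.le_zero, ← ha k hk] at ht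
      simp [Market.topBudget, ht, VExp.eval, NExp.eval, nv, hs₁, h1.B_eq k hk, hI]

/-- The number of levels, in the natural scalar `7`; the real scalar `3` is halved as often. -/
def levelsProg : Program :=
  .seq (setN 8 (.const 1)) <| .seq (setN 7 (.const 0)) <|
  .loop (.neg (.natLe (.add (.add nItems nItems) (.add nItems nItems)) (nv 8))) <|
    .seq (setN 8 (.add (nv 8) (nv 8))) <| .seq (setN 7 (.add (nv 7) (.const 1))) <|
    setR 3 (.half (rv 3))

/-- The ceiling of the logarithm is the number of doublings that reach `4 * m`; halving in the same
rounds produces the unit price without a division. -/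
theorem levelsProg_runs {s : Mem} {m : ℕ} {p : ℝ} (hm : s.nat 0 0 1 = m) (hp : s.val 3 0 0 = p) :
    Runs levelsProg s (10 * (levels m + 1)) (fun s' =>
      s'.nat 7 0 0 = levels m ∧ s'.val 3 0 0 = p / 2 ^ levels m) := by
  refine Runs.le (T := 1 + (1 + (levels m * (1 + (1 + 1) + 1) + 1)))
    (Runs.seq (Runs.setN (Runs.seq (Runs.setN ?_)))) (by omega)
  refine (Runs.loop (N := levels m) (I := fun k s' => s'.nat 8 0 0 = 2 ^ k ∧ s'.nat 7 0 0 = k ∧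
    s'.val 3 0 0 = p / 2 ^ k) ?_ ?_ ?_).mono fun s' _ h => h.2
  · simp [NExp.eval, hp]
  · rintro k hk s' ha ⟨h1, h2, h3⟩
    have h0 : s'.nat 0 0 1 = m := by
      rw [ha.nat 0 rfl]
      simpa using hm
    constructor
    · have : 2 ^ k < 4 * m := (Nat.lt_clog_iff_pow_lt (by decide)).1 hk
      simp only [Test.Holds, NExp.eval, nItems, nv, h0, h1]
      omega
    · refine Runs.seq (Runs.setN (Runs.seq (Runs.setN (Runs.setR ?_))))
      refine ⟨?_, ?_, ?_⟩
      · simp [NExp.eval, nv, h1]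
        ring
      · simp [NExp.eval, nv, h2]
      · simp [VExp.eval, NExp.eval, rv, h3]
        ring
  · rintro s' ha ⟨h1, -, -⟩
    have h0 : s'.nat 0 0 1 = m := by
      rw [ha.nat 0 rfl]
      simpa using hm
    have : 4 * m ≤ 2 ^ levels m := Nat.le_pow_clog (by decide) _
    simp only [Test.Holds, NExp.eval, nItems, nv, h0, h1]
    omega

/-- The number with the given binary digits, the most significant one first. -/
def horner (f : ℕ → ℕ) : ℕ → ℕ
  | 0 => 0
  | k + 1 => 2 * horner f k + f k

/-- The number of blocks (scalar `9`) and the price level (scalar `11`). -/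
def bitsProg : Program :=
  .seq (setN 9 (.const 1)) <| .seq (setN 10 (.const 1)) <| .seq (setN 11 (.const 0)) <|
  .seq (setN 19 (.const 0)) <|
  .loop (.neg (.natLe (nv 7) (nv 10))) <|
    .seq (setN 9 (.add (nv 9) (nv 9))) <|
    .seq (setN 10 (.add (.add (nv 10) (nv 10)) (.add (nv 10) (nv 10)))) <|
    .seq (setN 11 (.add (.add (nv 11) (nv 11))
      (coin (.add (.add nBidders nBidders) (.add (.const 2) (nv 19)))))) <|
    setN 19 (.add (nv 19) (.const 1))

/-- Doubling one variable while quadrupling another until it reaches the number of levels yields the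
block number without a square root. Every round also shifts one coin into the price level. -/
theorem bitsProg_runs {s : Mem} {X : Market} {cn : ℕ → ℕ} (h : MarketData s X cn)
    (h7 : s.nat 7 0 0 = levels X.m) :
    Runs bitsProg s (10 * (levelBits X.m + 1)) (fun s' =>
      s'.nat 9 0 0 = blocks X.m ∧
      s'.nat 11 0 0 = horner (fun k => cn (X.n + X.n + (2 + k))) (levelBits X.m)) := by
  refine Runs.le (T := 1 + (1 + (1 + (1 + (levelBits X.m * (1 + (1 + (1 + 1)) + 1) + 1)))))
    (Runs.seq (Runs.setN (Runs.seq (Runs.setN (Runs.seq (Runs.setN (Runs.seq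
      (Runs.setN ?_)))))))) (by omega)
  refine (Runs.loop (N := levelBits X.m) (I := fun k s' => s'.nat 9 0 0 = 2 ^ k ∧
    s'.nat 10 0 0 = 4 ^ k ∧ s'.nat 11 0 0 = horner (fun k => cn (X.n + X.n + (2 + k))) k ∧
    s'.nat 19 0 0 = k) ?_ ?_ ?_).mono fun s' _ h => ⟨h.1, h.2.2.1⟩
  · simp [NExp.eval, horner]
  · rintro k hk s' ha ⟨h1, h2, h3, h4⟩
    have h0 : s'.nat 7 0 0 = levels X.m := by
      rw [ha.nat 7 rfl]
      simpa using h7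
    have hn : s'.nat 0 0 0 = X.n := by
      rw [ha.nat 0 rfl]
      simpa using h.n_eq
    have hcn : s'.nat 1 0 = cn := by
      rw [ha.nat 1 rfl]
      exact h.coin_eq
    have hcn' : ∀ l, s'.nat 1 0 l = cn l := fun l => congrFun hcn l
    constructor
    · have : 4 ^ k < levels X.m := (Nat.lt_clog_iff_pow_lt (by decide)).1 hk
      simp only [Test.Holds, NExp.eval, nv, h0, h2]
      omega
    · refine Runs.seq (Runs.setN (Runs.seq (Runs.setN (Runs.seq (Runs.setN (Runs.setN ?_))))))
      refine ⟨?_, ?_, ?_, ?_⟩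
      · simp [NExp.eval, nv, h1]
        ring
      · simp [NExp.eval, nv, h2]
        ring
      · simp [NExp.eval, nv, nBidders, coin, h3, h4, horner, hn, hcn']
        ring
      · simp [NExp.eval, nv, h4]
  · rintro s' ha ⟨-, h2, -, -⟩
    have h0 : s'.nat 7 0 0 = levels X.m := by
      rw [ha.nat 7 rfl]
      simpa using h7
    have : levels X.m ≤ 4 ^ levelBits X.m := Nat.le_pow_clog (by decide) _
    simp only [Test.Holds, NExp.eval, nv, h0, h2]
    omega

/-- The second price auction for the bundle of all items. -/
def grandProg : Program :=
  .seq (setN 20 (.const 0)) <| .seq (setR 8 .zero) <| .seq (setR 9 .zero) <|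
  .seq (forTo 3 nBidders <|
    .ite (.valLe (.get 1 (nv 3) (.const 0)) (rv 8))
      (.ite (.valLe (rv 9) (.get 1 (nv 3) (.const 0))) (setR 9 (.get 1 (nv 3) (.const 0))) .skip)
      (.seq (setR 9 (rv 8)) <| .seq (setR 8 (.get 1 (nv 3) (.const 0)))
        (setN 20 (.add (nv 3) (.const 1))))) <|
  .seq (forTo 4 nItems (.setNat 2 (nv 4) (.const 0) (nv 20))) <|
  forTo 3 nBidders <|
    .ite (.conj (.natLe (nv 20) (.add (nv 3) (.const 1)))
        (.natLe (.add (nv 3) (.const 1)) (nv 20)))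
      (.setVal 2 (nv 3) (.const 0) (rv 9)) (.setVal 2 (nv 3) (.const 0) .zero)

theorem grandProg_runs {s : Mem} {X : Market} {cn : ℕ → ℕ} (h : MarketData s X cn) :
    Runs grandProg s (30 * (X.n + X.m + 1)) (fun s' =>
      (∀ j < X.m, s'.nat 2 j 0 = (X.topTwo X.n).1) ∧
      ∀ i < X.n, s'.val 2 i 0 = if (X.topTwo X.n).1 = i + 1 then (X.topTwo X.n).2.2 else 0) := by
  refine Runs.le (T := 1 + (1 + (1 + ((X.n * ((1 + 1 + 1) + (1 + (1 + 1)) + 1 + 2) + 2) +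
    ((X.m * (1 + 2) + 2) + (X.n * (1 + 1 + 1 + 2) + 2))))))
    (Runs.seq (Runs.setN (Runs.seq (Runs.setR (Runs.seq (Runs.setR (Runs.seq ?_)))))))
    (by omega)
  refine (Runs.forTo (N := X.n) (I := fun k s' => s'.nat 20 0 0 = (X.topTwo k).1 ∧
    s'.val 8 0 0 = (X.topTwo k).2.1 ∧ s'.val 9 0 0 = (X.topTwo k).2.2) rfl ?_ ?_ ?_).mono ?_
  · intro s' ha
    simpa [NExp.eval, nBidders, nv, ha.nat 0 rfl] using h.n_eq
  · simp [NExp.eval, VExp.eval, Market.topTwo]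
  · rintro k hk s₁ ha₁ hs₁ ⟨h1, h2, h3⟩
    have hB : s₁.val 1 k 0 = X.B k := by
      rw [ha₁.val 1 rfl]
      simpa using h.B_eq k hk
    refine Runs.ite (T := 1 + 1 + 1) (T' := 1 + (1 + 1)) (fun ht => ?_) (fun ht => ?_)
    · simp only [Test.Holds, VExp.eval, NExp.eval, rv, nv, hs₁, hB, h2] at ht
      refine Runs.ite (fun ht' => Runs.setR ?_) (fun ht' => Runs.skip ?_)
      · simp only [Test.Holds, VExp.eval, NExp.eval, rv, nv, hs₁, hB, h3] at ht'
        simp [Market.topTwo, not_lt.2 ht, max_eq_right ht', VExp.eval, NExp.eval, nv, hs₁, hB, h1,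
          h2]
      · simp only [Test.Holds, VExp.eval, NExp.eval, rv, nv, hs₁, hB, h3, not_le] at ht'
        simp [Market.topTwo, not_lt.2 ht, max_eq_left ht'.le, h1, h2, h3]
    · simp only [Test.Holds, VExp.eval, NExp.eval, rv, nv, hs₁, hB, h2, not_le] at ht
      refine Runs.seq (Runs.setR (Runs.seq (Runs.setR (Runs.setN ?_))))
      simp [Market.topTwo, ht, VExp.eval, NExp.eval, nv, rv, hs₁, hB, h2]
  · rintro s₁ ha₁ ⟨h1, -, h3⟩
    refine Runs.seq ((Runs.forTo (N := X.m) (I := fun k s' =>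
      ∀ j < k, s'.nat 2 j 0 = (X.topTwo X.n).1) rfl ?_ ?_ ?_).mono ?_)
    · intro s' ha
      simpa [NExp.eval, nItems, ha.nat 0 rfl, ha₁.nat 0 rfl] using h.m_eq
    · simp
    · intro k hk s₂ ha₂ hs₂ hI
      refine Runs.setNat fun j hj => ?_
      by_cases hjk : j = k
      · simp [NExp.eval, nv, hs₂, ha₂.nat 20 rfl, h1, hjk]
      · simpa [NExp.eval, nv, hs₂, hjk] using hI j (by omega)
    · intro s₂ ha₂ hown
      refine (Runs.forTo (N := X.n) (I := fun k s' => ∀ i < k, s'.val 2 i 0 =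
        if (X.topTwo X.n).1 = i + 1 then (X.topTwo X.n).2.2 else 0) rfl ?_ ?_ ?_).mono ?_
      · intro s' ha
        simpa [NExp.eval, nBidders, nv, ha.nat 0 rfl, ha₁.nat 0 rfl, ha₂.nat 0 rfl] using h.n_eq
      · simp
      · intro k hk s₃ ha₃ hs₃ hI
        have h1' : s₃.nat 20 0 0 = (X.topTwo X.n).1 := by
          rw [ha₃.nat 20 rfl, ha₂.nat 20 rfl, h1]
        have h3' : s₃.val 9 0 0 = (X.topTwo X.n).2.2 := by
          rw [ha₃.val 9 rfl, ha₂.val 9 rfl, h3]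
        refine Runs.ite (fun ht => Runs.setVal fun i hi => ?_)
          (fun ht => Runs.setVal fun i hi => ?_) <;>
        · simp only [Test.Holds, NExp.eval, nv, hs₃, h1', ← le_antisymm_iff] at ht
          by_cases hik : i = k
          · simp [NExp.eval, VExp.eval, nv, rv, hs₃, h3', hik, ht]
          · simpa [NExp.eval, VExp.eval, nv, hs₃, hik] using hI i (by omega)
      · intro s₃ ha₃ hpay
        refine ⟨fun j hj => ?_, hpay⟩
        rw [ha₃.nat 2 rfl, hown j hj]

/-- The coins `cn`, decoded for the market `X`, are `r`. -/
structure CoinData (cn : ℕ → ℕ) (X : Market) (r : Coins) : Prop where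
  le_one : ∀ k, cn k ≤ 1
  a_iff : ∀ i < X.n, r.a i = true ↔ cn i ≠ 0
  b_iff : ∀ i < X.n, r.b i = true ↔ cn (X.n + i) ≠ 0
  g_iff : r.g = true ↔ cn (X.n + X.n) ≠ 0
  h_iff : r.h = true ↔ cn (X.n + X.n + 1) ≠ 0
  x_eq : r.x = horner (fun k => cn (X.n + X.n + (2 + k))) (levelBits X.m)

theorem horner_lt {f : ℕ → ℕ} (hf : ∀ k, f k ≤ 1) (k : ℕ) : horner f k < 2 ^ k := by
  induction k with
  | zero => simp [horner]
  | succ k ih =>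
    have := hf k
    rw [horner, pow_succ]
    omega

theorem CoinData.x_lt {cn : ℕ → ℕ} {X : Market} {r : Coins} (h : CoinData cn X r) :
    r.x < blocks X.m := h.x_eq ▸ horner_lt (fun _ => h.le_one _) _

theorem CoinData.U_iff {cn : ℕ → ℕ} {X : Market} {r : Coins} (h : CoinData cn X r) (i : ℕ)
    (hi : i < X.n) : r.U i = true ↔ cn i = 0 ∧ cn (X.n + i) = 1 := by
  have h1 := h.le_one (X.n + i)
  rw [Coins.U, Bool.and_eq_true, Bool.not_eq_true', ← Bool.not_eq_true, h.a_iff i hi,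
    h.b_iff i hi]
  omega

theorem CoinData.V_iff {cn : ℕ → ℕ} {X : Market} {r : Coins} (h : CoinData cn X r) (i : ℕ)
    (hi : i < X.n) : r.V i = true ↔ cn i = 0 ∧ cn (X.n + i) = 0 := by
  rw [Coins.V, Bool.and_eq_true, Bool.not_eq_true', Bool.not_eq_true', ← Bool.not_eq_true,
    ← Bool.not_eq_true, h.a_iff i hi, h.b_iff i hi]
  omega

theorem Market.learned_le (X : Market) (r : Coins) (k j : ℕ) :
    X.learned r k j ≤ 2 ^ ((k - 1) * blocks X.m) := by
  induction k with
  | zero => simp [Market.learned]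
  | succ k ih =>
    rw [Market.learned, Nat.add_sub_cancel]
    split_ifs
    · exact le_rfl
    · exact ih.trans (Nat.pow_le_pow_right (by decide) (Nat.mul_le_mul_right _ (Nat.sub_le k 1)))

/-- A bound for all costs. -/
def maxCost (m : ℕ) : ℕ := 2 ^ (blocks m * blocks m)

theorem uniformCost_le {m k : ℕ} (h : k < blocks m) : 2 ^ (k * blocks m) ≤ maxCost m :=
  Nat.pow_le_pow_right (by decide) (Nat.mul_le_mul_right _ h.le)

/-- The highest block starts at exponent $(K-1)K$ and a level adds less than $K$, so $K^2$ bounds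
the exponents in both kinds of sales. -/
theorem Market.finalCost_le {X : Market} {r : Coins} {x : ℕ} (h : x < blocks X.m) (j : ℕ) :
    X.learned r (blocks X.m) j * 2 ^ x ≤ maxCost X.m := by
  refine (Nat.mul_le_mul_right _ (X.learned_le r _ j)).trans ?_
  rw [← pow_add]
  refine Nat.pow_le_pow_right (by decide) ?_
  obtain ⟨k, hk⟩ : ∃ k, blocks X.m = k + 1 := ⟨blocks X.m - 1, by omega⟩
  rw [hk] at h ⊢
  rw [Nat.add_sub_cancel]
  nlinarith

/-! ### The sales at uniform and at learned prices, and the complete program -/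

/-- A bound for the time of the sale to a group. -/
def saleTime (X : Market) : ℕ := 100 * (X.n + 1) * (X.m + 1) * (X.m * maxCost X.m + 1)

/-- The sales to the first group at uniform prices; the learned prices are collected in the
natural array `18`. -/
def learnProg : Program :=
  .seq (setN 16 (.const 1)) <| .seq (setN 17 (.const 1)) <|
  .seq (forTo 4 nItems (.setNat 18 (nv 4) (.const 0) (.const 1))) <|
  .seq (.ite (.natLe (coin (.add (.add nBidders nBidders) (.const 1))) (.const 0))
    (setN 22 (nv 9)) (setN 22 (.add (nv 11) (.const 1)))) <|
  forTo 6 (nv 22) <|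
    .seq (forTo 4 nItems (.setNat 12 (nv 4) (.const 0) (nv 17))) <|
    .seq auctionProg <|
    .seq (forTo 4 nItems (.ite (.natLe (.const 1) (.get 2 (nv 4) (.const 0)))
      (.setNat 18 (nv 4) (.const 0) (nv 17)) .skip)) <|
    forTo 21 (nv 9) (setN 17 (.add (nv 17) (nv 17)))

/-- The expression is evaluated inside the loop, where only the natural arrays `a` and `4` can
differ from `s`; this is what `he` permits. -/
theorem fillProg_runs {s : Mem} {a m : ℕ} {e : NExp} {f : ℕ → ℕ} (ha4 : (a == 4) = false)
    (ha0 : (a == 0) = false)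
    (hm : s.nat 0 0 1 = m)
    (he : ∀ k < m, ∀ s', (∀ b, (a == b) = false → b ≠ 4 → s'.nat b = s.nat b) →
      s'.nat 4 0 0 = k → e.eval s' = f k) :
    Runs (forTo 4 nItems (.setNat a (nv 4) (.const 0) e)) s (m * (1 + 2) + 2) (fun s' =>
      ∀ j < m, s'.nat a j 0 = f j) := by
  have ha4' : ¬ a = 4 := by simpa using ha4
  refine (Runs.forTo (N := m) (I := fun k s' => ∀ j < k, s'.nat a j 0 = f j)
    (by simpa [Program.writesNat] using ha4) ?_ ?_ ?_).mono fun s' _ h => h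
  · intro s' ha
    have : s'.nat 0 = s.nat 0 := ha.nat 0
      (by simp [forTo, setN, Program.writesNat, beq_iff_eq.not.1 (Bool.eq_false_iff.1 ha0)])
    simpa [NExp.eval, nItems, this] using hm
  · simp
  · intro k hk s₁ ha₁ hs₁ hI
    refine Runs.setNat fun j hj => ?_
    have hev := he k hk s₁ (fun b hb hb4 => ha₁.nat b (by
      have : ¬ 4 = b := fun h => hb4 h.symm
      simp [forTo, setN, Program.writesNat, beq_iff_eq.not.1 (Bool.eq_false_iff.1 hb), this])) hs₁
    by_cases hjk : j = k
    · simp [NExp.eval, nv, hs₁, hev, hjk, ha4']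
    · simpa [NExp.eval, nv, hs₁, hjk, ha4'] using hI j (by omega)

theorem learnProg_runs {s : Mem} {X : Market} {cn : ℕ → ℕ} {r : Coins} (h : MarketData s X cn)
    (hr : CoinData cn X r) (h9 : s.nat 9 0 0 = blocks X.m) (h11 : s.nat 11 0 0 = r.x)
    (h3 : s.val 3 0 0 = X.unitPrice r) :
    Runs learnProg s (blocks X.m * (saleTime X + 10 * (X.m + blocks X.m + 1)) + 10 * (X.m + 1))
      (fun s' =>
      (r.h = true → (∀ j < X.m, s'.nat 2 j 0 = X.uniformOwners r r.x j) ∧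
        ∀ i < X.n, s'.val 2 i 0 =
          X.salePay r.U (fun _ => 2 ^ (r.x * blocks X.m)) (X.unitPrice r) i) ∧
      (r.h = false → ∀ j < X.m, s'.nat 18 j 0 = X.learned r (blocks X.m) j)) := by
  -- If the uniform price sale is the outcome, the loop stops right after block `r.x`, so that its
  -- owners and payments are the ones left in memory. Otherwise all blocks are needed for learning.
  obtain ⟨N, hN⟩ : ∃ N, N = if r.h = true then r.x + 1 else blocks X.m := ⟨_, rfl⟩
  have hNK : N ≤ blocks X.m := by
    have := hr.x_lt
    rw [hN]
    split_ifs <;> omega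
  refine Runs.le (T := 1 + (1 + ((X.m * (1 + 2) + 2) + ((1 + 1 + 1) +
    (N * (((X.m * (1 + 2) + 2) + (saleTime X + ((X.m * (1 + 1 + 1 + 2) + 2) +
      (blocks X.m * (1 + 2) + 2)))) + 2) + 2)))))
    (Runs.seq (Runs.setN (Runs.seq (Runs.setN (Runs.seq ?_))))) ?_
  · refine (fillProg_runs (m := X.m) (f := fun _ => 1) rfl rfl (by simpa using h.m_eq)
      (fun _ _ _ _ _ => rfl)).mono fun s₁ ha₁ hs₁ => Runs.seq ?_
    have hm₁ : MarketData s₁ X cn := h.congr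
      ((ha₁.nat 0 rfl).trans ((Mem.nat_setNat_of_ne _ _ _ _ (by decide)).trans
        (Mem.nat_setNat_of_ne _ _ _ _ (by decide))))
      ((ha₁.nat 1 rfl).trans ((Mem.nat_setNat_of_ne _ _ _ _ (by decide)).trans
        (Mem.nat_setNat_of_ne _ _ _ _ (by decide)))) (ha₁.val 0 rfl) (ha₁.val 1 rfl)
    have h9₁ : s₁.nat 9 0 0 = blocks X.m := by
      rw [ha₁.nat 9 rfl]
      simpa using h9
    have h11₁ : s₁.nat 11 0 0 = r.x := by
      rw [ha₁.nat 11 rfl]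
      simpa using h11
    have h16₁ : s₁.nat 16 0 0 = 1 := by
      rw [ha₁.nat 16 rfl]
      simp [NExp.eval]
    have h17₁ : s₁.nat 17 0 0 = 1 := by
      rw [ha₁.nat 17 rfl]
      simp [NExp.eval]
    have h3₁ : s₁.val 3 0 0 = X.unitPrice r := by
      rw [ha₁.val 3 rfl]
      exact h3
    have hcn : ∀ l, s₁.nat 1 0 l = cn l := fun l => congrFun hm₁.coin_eq l
    have key : ∀ s₂, (∀ b, b ≠ 22 → s₂.nat b = s₁.nat b) → s₂.val = s₁.val → s₂.nat 22 0 0 = N →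
        Runs (forTo 6 (nv 22) <|
          .seq (forTo 4 nItems (.setNat 12 (nv 4) (.const 0) (nv 17))) <|
          .seq auctionProg <|
          .seq (forTo 4 nItems (.ite (.natLe (.const 1) (.get 2 (nv 4) (.const 0)))
            (.setNat 18 (nv 4) (.const 0) (nv 17)) .skip)) <|
          forTo 21 (nv 9) (setN 17 (.add (nv 17) (nv 17)))) s₂
        (N * (((X.m * (1 + 2) + 2) + (saleTime X + ((X.m * (1 + 1 + 1 + 2) + 2) +
          (blocks X.m * (1 + 2) + 2)))) + 2) + 2) (fun s' =>
        (r.h = true → (∀ j < X.m, s'.nat 2 j 0 = X.uniformOwners r r.x j) ∧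
          ∀ i < X.n, s'.val 2 i 0 =
            X.salePay r.U (fun _ => 2 ^ (r.x * blocks X.m)) (X.unitPrice r) i) ∧
        (r.h = false → ∀ j < X.m, s'.nat 18 j 0 = X.learned r (blocks X.m) j)) := by
      intro s₂ hn₂ hv₂ h22
      have hm₂ : MarketData s₂ X cn := hm₁.congr (hn₂ 0 (by decide)) (hn₂ 1 (by decide))
        (by rw [hv₂]) (by rw [hv₂])
      -- Before the first round there is no sale whose result could be in memory, hence the
      -- condition `k = k' + 1` on the last clause.
      refine (Runs.forTo (N := N) (I := fun k s' => s'.nat 17 0 0 = 2 ^ (k * blocks X.m) ∧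
        (∀ j < X.m, s'.nat 18 j 0 = X.learned r k j) ∧ ∀ k', k = k' + 1 →
          (∀ j < X.m, s'.nat 2 j 0 = X.uniformOwners r k' j) ∧
          ∀ i < X.n, s'.val 2 i 0 =
            X.salePay r.U (fun _ => 2 ^ (k' * blocks X.m)) (X.unitPrice r) i)
        rfl ?_ ?_ ?_).mono ?_
      · intro s' ha
        simpa [NExp.eval, nv, ha.nat 22 rfl] using h22
      · refine ⟨?_, ?_, ?_⟩
        · simpa [hn₂ 17 (by decide)] using h17₁
        · simpa [hn₂ 18 (by decide), Market.learned] using hs₁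
        · intro k' hk'
          omega
      · rintro k hk s₃ ha₃ hs₃ ⟨hI₁, hI₂, -⟩
        have hm₃ : MarketData s₃ X cn := hm₂.agree ha₃ rfl rfl rfl rfl
        refine Runs.seq ((fillProg_runs (m := X.m) (f := fun _ => 2 ^ (k * blocks X.m)) rfl rfl
          hm₃.m_eq ?_).mono fun s₄ ha₄ hs₄ => Runs.seq ?_)
        · intro l hl s' hs' _
          simp only [NExp.eval, nv, hs' 17 rfl (by decide), hI₁]
        have hm₄ : MarketData s₄ X cn := hm₃.agree ha₄ rfl rfl rfl rfl
        refine (auctionProg_runs (z := 1) (M := maxCost X.m) (H := r.U) (p := X.unitPrice r) hm₄ hs₄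
          (fun _ _ => uniformCost_le (by omega)) ?_ ?_ hr.U_iff).mono ?_
        · rw [ha₄.nat 16 rfl, ha₃.nat 16 rfl, hn₂ 16 (by decide), h16₁]
        · rw [ha₄.val 3 rfl, ha₃.val 3 rfl, hv₂, h3₁]
        rintro s₅ ha₅ ⟨hown₅, hpay₅⟩
        have hm₅ : MarketData s₅ X cn := hm₄.agree ha₅ rfl rfl rfl rfl
        have h17₅ : s₅.nat 17 0 0 = 2 ^ (k * blocks X.m) := by
          rw [ha₅.nat 17 rfl, ha₄.nat 17 rfl, hI₁]
        have h18₅ : ∀ j < X.m, s₅.nat 18 j 0 = X.learned r k j := by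
          rw [ha₅.nat 18 rfl, ha₄.nat 18 rfl]
          exact hI₂
        refine Runs.seq ((Runs.forTo (N := X.m) (I := fun l s' =>
          (∀ j < l, s'.nat 18 j 0 = X.learned r (k + 1) j) ∧
          ∀ j < X.m, l ≤ j → s'.nat 18 j 0 = X.learned r k j) rfl ?_ ?_ ?_).mono ?_)
        · intro s' ha
          simpa [NExp.eval, nItems, ha.nat 0 rfl] using hm₅.m_eq
        · simpa using h18₅
        · rintro l hl s₆ ha₆ hs₆ ⟨hJ₁, hJ₂⟩
          have ht : (Test.natLe (.const 1) (.get 2 (nv 4) (.const 0))).Holds s₆ ↔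
              X.uniformOwners r k l ≠ 0 := by
            simp only [Test.Holds, NExp.eval, nv, hs₆, ha₆.nat 2 rfl, hown₅ l hl,
              Market.uniformOwners]
            omega
          refine Runs.ite (fun hh => Runs.setNat ⟨fun j hj => ?_, fun j hj hlj => ?_⟩)
            (fun hh => Runs.skip ⟨fun j hj => ?_, fun j hj hlj => ?_⟩)
          all_goals rw [ht] at hh
          · by_cases hjl : j = l
            · simp [NExp.eval, nv, hs₆, hjl, ha₆.nat 17 rfl, h17₅, Market.learned, hh]
            · simpa [NExp.eval, nv, hs₆, hjl] using hJ₁ j (by omega)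
          · have hjl : j ≠ l := by omega
            simpa [NExp.eval, nv, hs₆, hjl] using hJ₂ j hj (by omega)
          · by_cases hjl : j = l
            · subst hjl
              simpa [Market.learned, not_not.1 hh] using hJ₂ j hl le_rfl
            · simpa using hJ₁ j (by omega)
          · simpa using hJ₂ j hj (by omega)
        · rintro s₆ ha₆ ⟨h18₆, -⟩
          refine (Runs.forTo (N := blocks X.m) (I := fun l s' =>
            s'.nat 17 0 0 = 2 ^ (k * blocks X.m + l)) rfl ?_ ?_ ?_).mono ?_
          · intro s' ha
            simpa [NExp.eval, nv, ha.nat 9 rfl, ha₆.nat 9 rfl, ha₅.nat 9 rfl, ha₄.nat 9 rfl,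
              ha₃.nat 9 rfl, hn₂ 9 (by decide)] using h9₁
          · simpa [ha₆.nat 17 rfl] using h17₅
          · intro l hl s₇ ha₇ hs₇ hI
            refine Runs.setN ?_
            simp [NExp.eval, nv, hI]
            ring
          · intro s₇ ha₇ h17₇
            refine ⟨?_, fun j hj => ?_, fun k' hk' => ?_⟩
            · simpa [add_mul] using h17₇
            · simpa [ha₇.nat 18 rfl] using h18₆ j hj
            · obtain rfl : k = k' := by omega
              refine ⟨fun j hj => ?_, fun i hi => ?_⟩
              · simpa [ha₇.nat 2 rfl, ha₆.nat 2 rfl, Market.uniformOwners] using hown₅ j hj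
              · simpa [ha₇.val 2 rfl, ha₆.val 2 rfl] using hpay₅ i hi
      · rintro s₃ - ⟨-, hI₂, hI₃⟩
        refine ⟨fun hh => ?_, fun hh => ?_⟩
        · exact hI₃ r.x (by simpa [hh] using hN)
        · have : N = blocks X.m := by simpa [hh] using hN
          rw [this] at hI₂
          exact hI₂
    have ht : (Test.natLe (coin (.add (.add nBidders nBidders) (.const 1))) (.const 0)).Holds s₁ ↔
        ¬ r.h = true := by
      rw [hr.h_iff]
      simp only [Test.Holds, NExp.eval, coin, nBidders, nv, hcn, hm₁.n_eq]
      omega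
    refine Runs.ite (fun hh => Runs.setN ?_) (fun hh => Runs.setN ?_)
    all_goals
      rw [ht] at hh
      refine key _ (fun b hb => Mem.nat_setNat_of_ne _ _ _ _ hb) rfl ?_
    · simp [NExp.eval, nv, h9₁, hN, hh]
    · simp [NExp.eval, nv, h11₁, hN, not_not.1 hh]
  · have h1 : N * (((X.m * (1 + 2) + 2) + (saleTime X + ((X.m * (1 + 1 + 1 + 2) + 2) +
      (blocks X.m * (1 + 2) + 2)))) + 2) ≤
        blocks X.m * (saleTime X + 10 * (X.m + blocks X.m + 1)) :=
      Nat.mul_le_mul hNK (by omega)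
    omega

/-- The sale to the second group at the learned prices. -/
def finalProg : Program :=
  .seq (setN 16 (.const 0)) <|
  .seq (forTo 4 nItems (.setNat 12 (nv 4) (.const 0) (.get 18 (nv 4) (.const 0)))) <|
  .seq (forTo 21 (nv 11) (forTo 4 nItems (.setNat 12 (nv 4) (.const 0)
    (.add (.get 12 (nv 4) (.const 0)) (.get 12 (nv 4) (.const 0)))))) <|
  auctionProg

theorem finalProg_runs {s : Mem} {X : Market} {cn : ℕ → ℕ} {r : Coins} (h : MarketData s X cn)
    (hr : CoinData cn X r) (h11 : s.nat 11 0 0 = r.x) (h3 : s.val 3 0 0 = X.unitPrice r)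
    (h18 : ∀ j < X.m, s.nat 18 j 0 = X.learned r (blocks X.m) j) :
    Runs finalProg s (saleTime X + 10 * (X.m + 1) * (blocks X.m + 1)) (fun s' =>
      (∀ j < X.m, s'.nat 2 j 0 = X.finalOwners r r.x j) ∧
      ∀ i < X.n, s'.val 2 i 0 =
        X.salePay r.V (fun j => X.learned r (blocks X.m) j * 2 ^ r.x) (X.unitPrice r) i) := by
  have hx := hr.x_lt
  refine Runs.le (T := 1 + ((X.m * (1 + 2) + 2) + ((r.x * ((X.m * (1 + 2) + 2) + 2) + 2) +
    saleTime X))) (Runs.seq (Runs.setN (Runs.seq ?_))) ?_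
  · refine (fillProg_runs (m := X.m) (f := X.learned r (blocks X.m)) rfl rfl
      (by simpa using h.m_eq) ?_).mono fun s₁ ha₁ hs₁ => Runs.seq ?_
    · intro k hk s' hs' h4
      simp only [NExp.eval, nv, h4, hs' 18 rfl (by decide)]
      simpa using h18 k hk
    have hm₁ : MarketData s₁ X cn := h.congr
      ((ha₁.nat 0 rfl).trans (Mem.nat_setNat_of_ne _ _ _ _ (by decide)))
      ((ha₁.nat 1 rfl).trans (Mem.nat_setNat_of_ne _ _ _ _ (by decide)))
      (ha₁.val 0 rfl) (ha₁.val 1 rfl)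
    refine (Runs.forTo (N := r.x) (I := fun k s' =>
      ∀ j < X.m, s'.nat 12 j 0 = X.learned r (blocks X.m) j * 2 ^ k) rfl ?_ ?_ ?_).mono ?_
    · intro s' ha
      simpa [NExp.eval, nv, ha.nat 11 rfl, ha₁.nat 11 rfl] using h11
    · simpa using hs₁
    · intro k hk s₂ ha₂ hs₂ hI
      have hm₂ : MarketData s₂ X cn := hm₁.agree ha₂ rfl rfl rfl rfl
      refine (Runs.forTo (N := X.m) (I := fun l s' =>
        (∀ j < l, s'.nat 12 j 0 = X.learned r (blocks X.m) j * 2 ^ (k + 1)) ∧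
        ∀ j < X.m, l ≤ j → s'.nat 12 j 0 = X.learned r (blocks X.m) j * 2 ^ k)
        rfl ?_ ?_ ?_).mono ?_
      · intro s' ha
        simpa [NExp.eval, nItems, ha.nat 0 rfl] using hm₂.m_eq
      · simpa using hI
      · rintro l hl s₃ ha₃ hs₃ ⟨hJ₁, hJ₂⟩
        refine Runs.setNat ⟨fun j hj => ?_, fun j hj hlj => ?_⟩
        · by_cases hjl : j = l
          · simp [NExp.eval, nv, hs₃, hjl, hJ₂ l hl le_rfl]
            ring
          · simpa [NExp.eval, nv, hs₃, hjl] using hJ₁ j (by omega)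
        · have hjl : j ≠ l := by omega
          simpa [NExp.eval, nv, hs₃, hjl] using hJ₂ j hj (by omega)
      · rintro s₃ - ⟨hJ₁, -⟩
        simpa using hJ₁
    · intro s₂ ha₂ hs₂
      refine (auctionProg_runs (z := 0) (M := maxCost X.m) (H := r.V) (p := X.unitPrice r)
        (hm₁.agree ha₂ rfl rfl rfl rfl) hs₂ (fun j _ => Market.finalCost_le hx j) ?_ ?_
        hr.V_iff).mono fun s' _ h => h
      · rw [ha₂.nat 16 rfl, ha₁.nat 16 rfl]
        simp [NExp.eval]
      · rw [ha₂.val 3 rfl, ha₁.val 3 rfl]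
        exact h3
  · have h1 : r.x * ((X.m * (1 + 2) + 2) + 2) ≤ blocks X.m * (4 * (X.m + 1)) :=
      Nat.mul_le_mul hx.le (by omega)
    nlinarith [Nat.zero_le (blocks X.m * X.m)]

/-- The whole mechanism. -/
def mainProg : Program :=
  .seq normalizeProg <| .seq topProg <| .seq levelsProg <| .seq bitsProg <|
  .ite (.natLe (coin (.add nBidders nBidders)) (.const 0))
    (.seq learnProg
      (.ite (.natLe (coin (.add (.add nBidders nBidders) (.const 1))) (.const 0))
        finalProg .skip))
    grandProg

/-- A bound for the time of the whole mechanism. -/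
def mainTime (X : Market) : ℕ :=
  20 * (X.n + 1) * (X.m + 1) + (10 * (X.n + 1) + (10 * (levels X.m + 1) +
    (10 * (levelBits X.m + 1) +
      ((blocks X.m * (saleTime X + 10 * (X.m + blocks X.m + 1)) + 10 * (X.m + 1)) +
        (saleTime X + 10 * (X.m + 1) * (blocks X.m + 1) + 1 + 1) +
        30 * (X.n + X.m + 1) + 1))))

theorem mainProg_runs {s : Mem} {X : Market} {cn : ℕ → ℕ} {r : Coins} {b : ℕ → ℝ}
    (hn : s.nat 0 0 0 = X.n) (hm : s.nat 0 0 1 = X.m) (hw : s.val 0 = X.w)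
    (hb : ∀ i < X.n, s.val 1 i 0 = b i)
    (hB : ∀ i < X.n, X.B i = min (b i) (∑ j ∈ Finset.range X.m, X.w i j))
    (hcn : s.nat 1 0 = cn) (hr : CoinData cn X r) :
    Runs mainProg s (mainTime X) (fun s' =>
      (∀ j < X.m, s'.nat 2 j 0 = X.outcomeOwner r j) ∧
      ∀ i < X.n, s'.val 2 i 0 = X.outcomePay r i) := by
  refine Runs.seq ((normalizeProg_runs hn hm hw hb).mono fun s₁ ha₁ hs₁ => ?_)
  have hm₁ : MarketData s₁ X cn := by
    constructor
    · rw [ha₁.nat 0 rfl, hn]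
    · rw [ha₁.nat 0 rfl, hm]
    · rw [ha₁.val 0 rfl, hw]
    · intro i hi
      rw [hs₁ i hi, hB i hi]
    · rw [ha₁.nat 1 rfl, hcn]
  refine Runs.seq ((topProg_runs hm₁ hr.a_iff).mono fun s₂ ha₂ hs₂ => ?_)
  have hm₂ := hm₁.agree ha₂ rfl rfl rfl rfl
  refine Runs.seq ((levelsProg_runs hm₂.m_eq hs₂).mono fun s₃ ha₃ hs₃ => ?_)
  have hm₃ := hm₂.agree ha₃ rfl rfl rfl rfl
  refine Runs.seq ((bitsProg_runs hm₃ hs₃.1).mono fun s₄ ha₄ hs₄ => ?_)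
  have hm₄ := hm₃.agree ha₄ rfl rfl rfl rfl
  have h3₄ : s₄.val 3 0 0 = X.unitPrice r := by
    rw [ha₄.val 3 rfl, hs₃.2, Market.unitPrice]
  have h11₄ : s₄.nat 11 0 0 = r.x := by rw [hs₄.2, hr.x_eq]
  have hcn₄ : ∀ l, s₄.nat 1 0 l = cn l := fun l => congrFun hm₄.coin_eq l
  have hg : (Test.natLe (coin (.add nBidders nBidders)) (.const 0)).Holds s₄ ↔ ¬ r.g = true := by
    rw [hr.g_iff]
    simp only [Test.Holds, NExp.eval, coin, nBidders, nv, hcn₄, hm₄.n_eq]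
    omega
  refine Runs.ite (fun ht => Runs.seq ((learnProg_runs hm₄ hr hs₄.1 h11₄ h3₄).mono ?_))
    (fun ht => (grandProg_runs hm₄).mono ?_)
  · rw [hg] at ht
    rintro s₅ ha₅ ⟨hU, hV⟩
    have hm₅ := hm₄.agree ha₅ rfl rfl rfl rfl
    have hcn₅ : ∀ l, s₅.nat 1 0 l = cn l := fun l => congrFun hm₅.coin_eq l
    have hh : (Test.natLe (coin (.add (.add nBidders nBidders) (.const 1))) (.const 0)).Holds s₅ ↔
        ¬ r.h = true := by
      rw [hr.h_iff]
      simp only [Test.Holds, NExp.eval, coin, nBidders, nv, hcn₅, hm₅.n_eq]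
      omega
    refine Runs.ite (fun ht' => ?_) (fun ht' => Runs.skip ?_)
    · rw [hh] at ht'
      refine (finalProg_runs hm₅ hr ?_ ?_ (hV (by simpa using ht'))).mono ?_
      · rw [ha₅.nat 11 rfl, h11₄]
      · rw [ha₅.val 3 rfl, h3₄]
      · rintro s₆ - ⟨h1, h2⟩
        simpa [Market.outcomeOwner, Market.outcomePay, ht, ht'] using ⟨h1, h2⟩
    · rw [hh, not_not] at ht'
      simpa [Market.outcomeOwner, Market.outcomePay, ht, ht'] using hU ht'
  · rw [hg, not_not] at ht
    rintro s₅ - ⟨h1, h2⟩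
    simpa [Market.outcomeOwner, Market.outcomePay, ht] using ⟨h1, h2⟩

namespace Market

/-! ### Welfare of the sale to a group -/

variable {X : Market}

/-- Disjoint bundles with item prices that are supported by the valuations. -/
structure Supported (X : Market) (O : ℕ → Finset ℕ) (q : ℕ → ℕ → ℝ) : Prop where
  lt : ∀ i, ∀ j ∈ O i, j < X.m
  disjoint : ∀ i i', i ≠ i' → Disjoint (O i) (O i')
  nonneg : ∀ i j, 0 ≤ q i j
  le_value : ∀ i S, S ⊆ O i → ∑ j ∈ S, q i j ≤ X.value i S

variable {O : ℕ → Finset ℕ} {q : ℕ → ℕ → ℝ} {H : ℕ → Bool} {c : ℕ → ℕ} {p : ℝ}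

/-- The utility of bidder `i` in the sale. -/
noncomputable def saleUtility (X : Market) (H : ℕ → Bool) (c : ℕ → ℕ) (p : ℝ) (i : ℕ) : ℝ :=
  X.value i (X.demand p c (X.owners H c p i) i) - X.demandCost p c (X.owners H c p i) i * p

/-- The bundle `T` is still available at the turn of `i`, so it competes with the demand, and its
value is at least its supporting prices. -/
theorem Supported.sum_le_saleUtility (hq : X.Supported O q) {i : ℕ} {T : Finset ℕ} (hT : T ⊆ O i)
    (hown : ∀ j ∈ T, X.owners H c p i j = 0) :
    ∑ j ∈ T, (q i j - c j * p) ≤ X.saleUtility H c p i := by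
  refine le_trans ?_ (X.utility_le_demand p (fun j hj => hq.lt i j (hT hj)) hown)
  rw [Finset.sum_sub_distrib, ← Finset.sum_mul]
  push_cast
  exact sub_le_sub_right (hq.le_value i T hT) _

theorem saleUtility_nonneg (hB : ∀ i, 0 ≤ X.B i) (i : ℕ) : 0 ≤ X.saleUtility H c p i := by
  have := X.utility_le_demand p (c := c) (own := X.owners H c p i) (i := i) (D := ∅)
    (by simp) (by simp)
  simpa [value, hB i, saleUtility] using this

theorem value_nonneg (hB : ∀ i, 0 ≤ X.B i) (hw : ∀ i j, 0 ≤ X.w i j) (i : ℕ) (S : Finset ℕ) :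
    0 ≤ X.value i S := le_min (hB i) (Finset.sum_nonneg fun j _ => hw i j)

theorem total_nonneg (hB : ∀ i, 0 ≤ X.B i) (hw : ∀ i j, 0 ≤ X.w i j) (own : ℕ → ℕ) :
    0 ≤ X.total own := Finset.sum_nonneg fun i _ => value_nonneg hB hw i _

/-- The welfare is at least the utilities and the prices of the sold items. -/
theorem utility_add_revenue_le_total (hB : ∀ i, 0 ≤ X.B i) (hp : 0 ≤ p) :
    ∑ i ∈ Finset.range X.n, (if H i = true then X.saleUtility H c p i else 0) +
      ∑ j ∈ Finset.range X.m, (if X.owners H c p X.n j ≠ 0 then c j * p else 0) ≤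
    X.total (X.owners H c p X.n) := by
  have h1 : ∑ j ∈ Finset.range X.m, (if X.owners H c p X.n j ≠ 0 then c j * p else 0) =
      ∑ i ∈ Finset.range X.n, ∑ j ∈ X.bundle (X.owners H c p X.n) i, c j * p := by
    -- The sold items are grouped by buyer; bidder `i` is recorded as owner `i + 1`.
    rw [← Finset.sum_filter, ← Finset.sum_fiberwise_of_maps_to
      (g := fun j => X.owners H c p X.n j - 1) (t := Finset.range X.n)]
    · refine Finset.sum_congr rfl fun i _ => Finset.sum_congr ?_ fun _ _ => rfl
      ext j
      simp only [bundle, Finset.mem_filter, Finset.mem_range]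
      omega
    · intro j hj
      have := X.owners_le (H := H) (c := c) (p := p) X.n j
      have := (Finset.mem_filter.1 hj).2
      rw [Finset.mem_range]
      omega
  rw [h1, ← Finset.sum_add_distrib, total]
  refine Finset.sum_le_sum fun i hi => ?_
  rw [bundle_owners (Finset.mem_range.1 hi)]
  split_ifs with hH
  · rw [← Finset.sum_mul]
    -- Value is utility plus payment, and the payment is at least the posted prices of the bundle.
    have h2 : ((∑ j ∈ X.demand p c (X.owners H c p i) i, c j : ℕ) : ℝ) ≤
        X.demandCost p c (X.owners H c p i) i := by
      exact_mod_cast X.sum_cost_demand_le p c (X.owners H c p i) i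
    push_cast at h2
    have := mul_le_mul_of_nonneg_right h2 hp
    rw [saleUtility]
    linarith
  · simp [value, hB i]

theorem Supported.sum_sum_le (hq : X.Supported O q) {T : ℕ → Finset ℕ} (hT : ∀ i, T i ⊆ O i)
    {f : ℕ → ℝ} (hf : ∀ j, 0 ≤ f j) (s : Finset ℕ) :
    ∑ i ∈ s, ∑ j ∈ T i, f j ≤ ∑ j ∈ Finset.range X.m, f j := by
  rw [← Finset.sum_biUnion fun i _ i' _ h =>
    Finset.disjoint_of_subset_left (hT i) (Finset.disjoint_of_subset_right (hT i')
      (hq.disjoint i i' h))]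
  refine Finset.sum_le_sum_of_subset_of_nonneg (fun j hj => ?_) fun j _ _ => hf j
  obtain ⟨i, -, hi⟩ := Finset.mem_biUnion.1 hj
  exact Finset.mem_range.2 (hq.lt i j (hT i hi))

/-- Items whose prices are between a quarter and a half of the supporting prices contribute to the
welfare of the sale. -/
theorem Supported.sum_le_total (hq : X.Supported O q) (hB : ∀ i, 0 ≤ X.B i) (hp : 0 ≤ p)
    {T : ℕ → Finset ℕ} (hT : ∀ i, T i ⊆ O i)
    (hl : ∀ i, ∀ j ∈ T i, 2 * (c j * p) ≤ q i j) (hu : ∀ i, ∀ j ∈ T i, q i j ≤ 4 * (c j * p)) :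
    ∑ i ∈ Finset.range X.n, (if H i = true then ∑ j ∈ T i, q i j else 0) ≤
      4 * X.total (X.owners H c p X.n) := by
  refine le_trans ?_ (mul_le_mul_of_nonneg_left (utility_add_revenue_le_total hB hp) (by norm_num))
  have h1 := hq.sum_sum_le hT
    (f := fun j => if X.owners H c p X.n j ≠ 0 then c j * p else 0)
    (fun j => by
      split_ifs
      · positivity
      · exact le_rfl) (Finset.range X.n)
  have h2 : ∀ i ∈ Finset.range X.n, (if H i = true then ∑ j ∈ T i, q i j else 0) ≤
      4 * ((if H i = true then X.saleUtility H c p i else 0) +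
        ∑ j ∈ T i, if X.owners H c p X.n j ≠ 0 then c j * p else 0) := by
    intro i hi
    have hnn : 0 ≤ ∑ j ∈ T i, if X.owners H c p X.n j ≠ 0 then (c j : ℝ) * p else 0 :=
      Finset.sum_nonneg fun j _ => by
        split_ifs
        · positivity
        · exact le_rfl
    split_ifs with hH
    · have h3 := hq.sum_le_saleUtility (H := H) (c := c) (p := p) (i := i)
        (T := {j ∈ T i | X.owners H c p X.n j = 0})
        ((Finset.filter_subset _ _).trans (hT i)) (fun j hj => by
          have h0 := (Finset.mem_filter.1 hj).2
          by_contra hne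
          exact hne ((owners_of_ne_zero (Finset.mem_range.1 hi).le hne).symm.trans h0))
      rw [Finset.sum_filter] at h3
      -- An unsold item contributes `q - c * p ≥ q / 2` to the utility, a sold one contributes `c *
      -- p ≥ q / 4` to the revenue.
      have h4 : ∑ j ∈ T i, q i j ≤ 4 * (∑ j ∈ T i,
          ((if X.owners H c p X.n j = 0 then q i j - c j * p else 0) +
            if X.owners H c p X.n j ≠ 0 then c j * p else 0)) := by
        rw [Finset.mul_sum]
        refine Finset.sum_le_sum fun j hj => ?_
        have := hl i j hj
        have := hu i j hj
        have := hq.nonneg i j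
        by_cases h0 : X.owners H c p X.n j = 0
        · simp only [h0, ne_eq, not_true_eq_false, if_true, if_false]
          linarith
        · simp only [h0, ne_eq, not_false_eq_true, if_true, if_false]
          linarith
      rw [Finset.sum_add_distrib] at h4
      linarith
    · linarith
  refine (Finset.sum_le_sum h2).trans ?_
  rw [← Finset.mul_sum, Finset.sum_add_distrib]
  linarith

theorem owners_congr {H' : ℕ → Bool} {k : ℕ} (h : ∀ i < k, H i = H' i) :
    X.owners H c p k = X.owners H' c p k := by
  induction k with
  | zero => rfl
  | succ k ih =>
    funext j
    rw [owners, owners, ih fun i hi => h i (by omega), h k (by omega)]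

/-- Adding a bidder to the group: the unsold items are still available when the bidder's turn
comes. -/
theorem Supported.sum_unsold_le (hq : X.Supported O q) {H' : ℕ → Bool} {i : ℕ} (hi : i < X.n)
    (hH : ∀ l < i, H l = H' l) {T : Finset ℕ} (hT : T ⊆ O i) :
    ∑ j ∈ T, (if X.owners H c p X.n j = 0 then q i j - c j * p else 0) ≤
      X.saleUtility H' c p i := by
  rw [← Finset.sum_filter]
  refine hq.sum_le_saleUtility ((Finset.filter_subset _ _).trans hT) fun j hj => ?_
  rw [← owners_congr hH]
  have h0 := (Finset.mem_filter.1 hj).2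
  by_contra hne
  exact hne ((owners_of_ne_zero hi.le hne).symm.trans h0)

/-! ### Learned prices -/

variable {r : Coins}

/-- Locates a price on a grid of `K` points. At the last grid point nothing is known about the next
one, so an upper bound has to come from elsewhere. -/
theorem exists_last {P : ℕ → Prop} (h0 : P 0) {K : ℕ} (hK : 0 < K) :
    ∃ k < K, P k ∧ (k + 1 < K → ¬ P (k + 1)) := by
  induction K, hK using Nat.le_induction with
  | base => exact ⟨0, by omega, h0, by omega⟩
  | succ K hK ih =>
    obtain ⟨k, hk, hPk, hP⟩ := ih
    by_cases hKP : P K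
    · exact ⟨K, by omega, hKP, by omega⟩
    · refine ⟨k, by omega, hPk, fun _ => ?_⟩
      by_cases hkK : k + 1 < K
      · exact hP hkK
      · obtain rfl : k + 1 = K := by omega
        exact hKP

/-- The highest selling block is learned, so a learned price is never below a block price at which
the item sells. -/
theorem learned_spec {K k j : ℕ} (hk : k < K) (h : X.uniformOwners r k j ≠ 0) :
    ∃ l < K, k ≤ l ∧ X.uniformOwners r l j ≠ 0 ∧ X.learned r K j = 2 ^ (l * blocks X.m) := by
  induction K with
  | zero => omega
  | succ K ih =>
    by_cases hK : X.uniformOwners r K j ≠ 0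
    · exact ⟨K, by omega, by omega, hK, by rw [learned, if_pos hK]⟩
    · have hkK : k ≠ K := by
        rintro rfl
        exact hK h
      obtain ⟨l, hl, h1, h2, h3⟩ := ih (by omega)
      exact ⟨l, by omega, h1, h2, by rw [learned, if_neg hK, h3]⟩

theorem blocks_pos (m : ℕ) : 0 < blocks m := by
  rw [blocks]
  positivity

/-- A supporting price is lost in a sale at a uniform price, or kept in a sale at the learned
prices, or covered by the revenue of the sales at uniform prices. -/
theorem price_le {Q : ℝ} {j : ℕ} (hp : 0 ≤ p) (hl : 2 * p ≤ Q) (hQ : 0 < Q)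
    (hu : Q ≤ 2 ^ (blocks X.m * blocks X.m) * p) :
    Q ≤ ∑ k ∈ Finset.range (blocks X.m), (2 * if 2 * (2 ^ (k * blocks X.m) * p) ≤ Q then
          (if X.uniformOwners r k j = 0 then Q - 2 ^ (k * blocks X.m) * p else 0) else 0) +
      ∑ x ∈ Finset.range (blocks X.m),
        (if 2 * ((X.learned r (blocks X.m) j * 2 ^ x : ℕ) * p) ≤ Q ∧
            Q ≤ 4 * ((X.learned r (blocks X.m) j * 2 ^ x : ℕ) * p) then Q else 0) +
      ∑ k ∈ Finset.range (blocks X.m), (2 *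
        if X.uniformOwners r k j ≠ 0 then 2 ^ (k * blocks X.m) * p else 0) := by
  set K := blocks X.m with hK
  have hKpos : 0 < K := blocks_pos _
  have n1 : ∀ k ∈ Finset.range K, 0 ≤ 2 * if 2 * (2 ^ (k * K) * p) ≤ Q then
      (if X.uniformOwners r k j = 0 then Q - 2 ^ (k * K) * p else 0) else 0 := fun k _ => by
    split_ifs with h1 h2
    · have : 0 ≤ 2 ^ (k * K) * p := by positivity
      linarith
    · simp
    · simp
  have n2 : ∀ x ∈ Finset.range K, 0 ≤ if 2 * ((X.learned r K j * 2 ^ x : ℕ) * p) ≤ Q ∧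
      Q ≤ 4 * ((X.learned r K j * 2 ^ x : ℕ) * p) then Q else 0 := fun x _ => by
    split_ifs
    · exact hQ.le
    · exact le_rfl
  have n3 : ∀ k ∈ Finset.range K, 0 ≤ 2 *
      if X.uniformOwners r k j ≠ 0 then 2 ^ (k * K) * p else 0 := fun k _ => by
    split_ifs <;> positivity
  -- Block `k` is the last one whose price is at most half of `Q`; block 0 qualifies by `hl`.
  obtain ⟨k, hk, hPk, hP⟩ := exists_last (P := fun k => 2 * (2 ^ (k * K) * p) ≤ Q)
    (by simpa using hl) hKpos
  have s1 := Finset.sum_nonneg n1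
  have s2 := Finset.sum_nonneg n2
  have s3 := Finset.sum_nonneg n3
  by_cases h0 : X.uniformOwners r k j = 0
  -- Unsold at block `k`: the price is at most `Q / 2`, so twice the forgone gain is at least `Q`.
  · have := Finset.single_le_sum n1 (Finset.mem_range.2 hk)
    rw [if_pos hPk, if_pos h0] at this
    linarith
  obtain ⟨l, hl, hkl, hsold, hlearn⟩ := learned_spec hk h0
  rcases hkl.lt_or_eq with hkl | rfl
  -- A higher block is learned: the item sells there at more than `Q / 2`, and this revenue pays for
  -- the overpricing.
  · have h1 := hP (by omega)
    have h2 : (2 : ℝ) ^ ((k + 1) * K) * p ≤ 2 ^ (l * K) * p :=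
      mul_le_mul_of_nonneg_right
        (pow_le_pow_right₀ (by norm_num) (Nat.mul_le_mul_right _ hkl)) hp
    have := Finset.single_le_sum n3 (Finset.mem_range.2 hl)
    rw [if_pos hsold] at this
    linarith [not_le.1 h1]
  -- Block `k` itself is learned. In the last block the bound comes from `hu`, and strictness from
  -- `0 < Q`.
  · have hlast : Q < 2 * (2 ^ ((k + 1) * K) * p) := by
      by_cases hkK : k + 1 < K
      · exact not_le.1 (hP hkK)
      · have h : k + 1 = K := by omega
        rw [h]
        linarith
    -- The levels inside the block refine the price by factors of 2. At the last level the upper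
    -- bound is `hlast`, because one more doubling reaches the next block.
    obtain ⟨x, hx, hPx, hPx'⟩ := exists_last (P := fun x => 2 * (2 ^ (k * K + x) * p) ≤ Q)
      (by simpa using hPk) hKpos
    have hcast : ((X.learned r K j * 2 ^ x : ℕ) : ℝ) = 2 ^ (k * K + x) := by
      rw [hlearn, ← hK]
      push_cast
      ring
    have hux : Q ≤ 4 * (2 ^ (k * K + x) * p) := by
      by_cases hxK : x + 1 < K
      · have := not_le.1 (hPx' hxK)
        rw [← add_assoc, pow_succ] at this
        linarith
      · have hKx : (k + 1) * K = k * K + x + 1 := by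
          rw [add_mul]
          omega
        rw [hKx, pow_succ] at hlast
        linarith
    have := Finset.single_le_sum n2 (Finset.mem_range.2 hx)
    rw [hcast, if_pos ⟨hPx, hux⟩] at this
    linarith

/-- What the second group loses in the sale at the uniform price of block `k`. -/
noncomputable def lost (X : Market) (r : Coins) (O : ℕ → Finset ℕ) (q : ℕ → ℕ → ℝ)
    (k i : ℕ) : ℝ :=
  ∑ j ∈ O i with 2 * (2 ^ (k * blocks X.m) * X.unitPrice r) ≤ q i j,
    if X.uniformOwners r k j = 0 then q i j - (2 ^ (k * blocks X.m) : ℕ) * X.unitPrice r else 0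

/-- `price_le` is summed over the items of the second group. The term with well-placed learned
prices costs the factor 4 of `sum_le_total`. The revenue term keeps its factor 2, since each item
lies in at most one target bundle and is charged once per block. -/
theorem Supported.sum_le (hq : X.Supported O q) (hB : ∀ i, 0 ≤ X.B i)
    (hu : ∀ i < X.n, ∀ j ∈ O i, q i j ≤ 2 ^ (blocks X.m * blocks X.m) * X.unitPrice r) :
    ∑ i ∈ Finset.range X.n, (if r.V i = true then
        ∑ j ∈ O i with 2 * X.unitPrice r ≤ q i j, q i j else 0) ≤
      2 * ∑ k ∈ Finset.range (blocks X.m), ∑ i ∈ Finset.range X.n,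
        (if r.V i = true then X.lost r O q k i else 0) +
      4 * ∑ x ∈ Finset.range (blocks X.m), X.total (X.finalOwners r x) +
      2 * ∑ k ∈ Finset.range (blocks X.m), X.total (X.uniformOwners r k) := by
  set K := blocks X.m with hK
  set p := X.unitPrice r with hp'
  have hp : 0 ≤ p := unitPrice_nonneg
  have h2 : ∀ x ∈ Finset.range K, ∑ i ∈ Finset.range X.n, (if r.V i = true then
      ∑ j ∈ O i with (2 * ((X.learned r K j * 2 ^ x : ℕ) * p) ≤ q i j ∧
        q i j ≤ 4 * ((X.learned r K j * 2 ^ x : ℕ) * p)), q i j else 0) ≤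
      4 * X.total (X.finalOwners r x) := fun x _ =>
    hq.sum_le_total hB hp (fun i => Finset.filter_subset _ _)
      (fun i j hj => (Finset.mem_filter.1 hj).2.1) (fun i j hj => (Finset.mem_filter.1 hj).2.2)
  have h3 : ∀ k ∈ Finset.range K, ∑ j ∈ Finset.range X.m,
      (if X.uniformOwners r k j ≠ 0 then 2 ^ (k * K) * p else 0) ≤
        X.total (X.uniformOwners r k) := fun k _ => by
    have := utility_add_revenue_le_total (X := X) (H := r.U) (c := fun _ => 2 ^ (k * K)) hB hp
    have hnn : 0 ≤ ∑ i ∈ Finset.range X.n,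
        (if r.U i = true then X.saleUtility r.U (fun _ => 2 ^ (k * K)) p i else 0) :=
      Finset.sum_nonneg fun i _ => by
        split_ifs
        · exact saleUtility_nonneg hB i
        · exact le_rfl
    push_cast at this
    exact le_trans (le_add_of_nonneg_left hnn) this
  have h4 : ∑ i ∈ Finset.range X.n, ∑ j ∈ O i, ∑ k ∈ Finset.range K,
      (if X.uniformOwners r k j ≠ 0 then 2 ^ (k * K) * p else 0) ≤
      ∑ k ∈ Finset.range K, X.total (X.uniformOwners r k) := by
    refine (hq.sum_sum_le (fun i => Finset.Subset.refl _) (fun j => Finset.sum_nonneg fun k _ => ?_)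
      _).trans ?_
    · split_ifs <;> positivity
    · rw [Finset.sum_comm]
      exact Finset.sum_le_sum h3
  have h1 : ∀ i ∈ Finset.range X.n, (if r.V i = true then
        ∑ j ∈ O i with 2 * p ≤ q i j, q i j else 0) ≤
      2 * ∑ k ∈ Finset.range K, (if r.V i = true then X.lost r O q k i else 0) +
      ∑ x ∈ Finset.range K, (if r.V i = true then
        ∑ j ∈ O i with (2 * ((X.learned r K j * 2 ^ x : ℕ) * p) ≤ q i j ∧
          q i j ≤ 4 * ((X.learned r K j * 2 ^ x : ℕ) * p)), q i j else 0) +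
      2 * ∑ j ∈ O i, ∑ k ∈ Finset.range K,
        (if X.uniformOwners r k j ≠ 0 then 2 ^ (k * K) * p else 0) := by
    intro i hi
    have n3 : 0 ≤ ∑ j ∈ O i, ∑ k ∈ Finset.range K,
        (if X.uniformOwners r k j ≠ 0 then 2 ^ (k * K) * p else 0) :=
      Finset.sum_nonneg fun j _ => Finset.sum_nonneg fun k _ => by split_ifs <;> positivity
    split_ifs with hV
    · have e1 : 2 * ∑ k ∈ Finset.range K, X.lost r O q k i = ∑ j ∈ O i, ∑ k ∈ Finset.range K,
          (2 * if 2 * (2 ^ (k * K) * p) ≤ q i j then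
            (if X.uniformOwners r k j = 0 then q i j - 2 ^ (k * K) * p else 0) else 0) := by
        rw [Finset.sum_comm, Finset.mul_sum]
        refine Finset.sum_congr rfl fun k _ => ?_
        rw [lost, Finset.sum_filter, Finset.mul_sum]
        push_cast
        rfl
      have e2 : ∑ x ∈ Finset.range K, ∑ j ∈ O i with
          (2 * ((X.learned r K j * 2 ^ x : ℕ) * p) ≤ q i j ∧
          q i j ≤ 4 * ((X.learned r K j * 2 ^ x : ℕ) * p)), q i j =
          ∑ j ∈ O i, ∑ x ∈ Finset.range K, (if 2 * ((X.learned r K j * 2 ^ x : ℕ) * p) ≤ q i j ∧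
            q i j ≤ 4 * ((X.learned r K j * 2 ^ x : ℕ) * p) then q i j else 0) := by
        rw [Finset.sum_comm]
        exact Finset.sum_congr rfl fun x _ => Finset.sum_filter _ _
      have e3 : 2 * ∑ j ∈ O i, ∑ k ∈ Finset.range K,
          (if X.uniformOwners r k j ≠ 0 then 2 ^ (k * K) * p else 0) =
          ∑ j ∈ O i, ∑ k ∈ Finset.range K,
            (2 * if X.uniformOwners r k j ≠ 0 then 2 ^ (k * K) * p else 0) := by
        rw [Finset.mul_sum]
        exact Finset.sum_congr rfl fun j _ => Finset.mul_sum _ _ _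
      rw [e1, e2, e3, ← Finset.sum_add_distrib, ← Finset.sum_add_distrib, Finset.sum_filter]
      refine Finset.sum_le_sum fun j hj => ?_
      have nn : 0 ≤ ∑ k ∈ Finset.range K, (2 * if 2 * (2 ^ (k * K) * p) ≤ q i j then
            (if X.uniformOwners r k j = 0 then q i j - 2 ^ (k * K) * p else 0) else 0) +
          ∑ x ∈ Finset.range K, (if 2 * ((X.learned r K j * 2 ^ x : ℕ) * p) ≤ q i j ∧
            q i j ≤ 4 * ((X.learned r K j * 2 ^ x : ℕ) * p) then q i j else 0) +
          ∑ k ∈ Finset.range K, (2 *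
            if X.uniformOwners r k j ≠ 0 then 2 ^ (k * K) * p else 0) := by
        refine add_nonneg (add_nonneg ?_ ?_) ?_ <;> refine Finset.sum_nonneg fun k _ => ?_
        · split_ifs with h1 h2
          · have : 0 ≤ 2 ^ (k * K) * p := by positivity
            linarith
          · simp
          · simp
        · split_ifs
          · exact hq.nonneg i j
          · exact le_rfl
        · split_ifs <;> positivity
      split_ifs with hj2
      -- `price_le` needs a positive price; a price equal to 0 is trivially covered.
      · rcases (hq.nonneg i j).eq_or_lt with h0 | h0
        · rw [← h0] at nn ⊢
          exact nn
        · exact price_le hp hj2 h0 (hu i (Finset.mem_range.1 hi) j hj)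
      · exact nn
    · simp only [Finset.sum_const_zero, mul_zero, zero_add]
      linarith
  refine (Finset.sum_le_sum h1).trans ?_
  rw [Finset.sum_add_distrib, Finset.sum_add_distrib, ← Finset.mul_sum, ← Finset.mul_sum,
    Finset.sum_comm (t := Finset.range K), Finset.sum_comm (t := Finset.range K)]
  have := Finset.sum_le_sum h2
  rw [← Finset.mul_sum] at this
  linarith

end Market

/-! ### Fair coins -/

/-- Fairness and independence at once: the permutation exchanges the event with its complement and
leaves `f` unchanged. It is applied to flips of a coin on which `f` does not depend. -/
theorem sum_ite_eq_half {Ω : Type*} [Fintype Ω] (σ : Equiv.Perm Ω) {f : Ω → ℝ} {c : Ω → Prop}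
    [DecidablePred c] (hc : ∀ ω, c (σ ω) ↔ ¬ c ω) (hf : ∀ ω, f (σ ω) = f ω) :
    ∑ ω, (if c ω then f ω else 0) = (∑ ω, f ω) / 2 := by
  have h1 : ∑ ω, (if c ω then f ω else 0) = ∑ ω, if c ω then 0 else f ω := by
    rw [← Equiv.sum_comp σ]
    refine Finset.sum_congr rfl fun ω _ => ?_
    simp only [hc, hf, ite_not]
  have h2 : ∑ ω, f ω = ∑ ω, (if c ω then f ω else 0) + ∑ ω, if c ω then 0 else f ω := by
    rw [← Finset.sum_add_distrib]
    refine Finset.sum_congr rfl fun ω _ => ?_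
    split_ifs <;> simp
  linarith

variable {ℓ : ℕ}

/-- The coins as numbers. -/
def coinNat (r : Fin ℓ → Bool) (k : ℕ) : ℕ :=
  if h : k < ℓ then (if r ⟨k, h⟩ = true then 1 else 0) else 0

theorem coinNat_le_one (r : Fin ℓ → Bool) (k : ℕ) : coinNat r k ≤ 1 := by
  rw [coinNat]
  split_ifs <;> simp

/-- Turning over one coin. -/
def flipCoin (k : Fin ℓ) : Equiv.Perm (Fin ℓ → Bool) :=
  Function.Involutive.toPerm (fun r => Function.update r k (!r k)) fun r => by simp

theorem flipCoin_apply (k : Fin ℓ) (r : Fin ℓ → Bool) :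
    flipCoin k r = Function.update r k (!r k) := rfl

theorem coinNat_flipCoin (k : Fin ℓ) (r : Fin ℓ → Bool) (l : ℕ) :
    coinNat (flipCoin k r) l = if l = k then 1 - coinNat r l else coinNat r l := by
  by_cases hl : l < ℓ
  · by_cases hlk : l = k
    · subst hlk
      simp only [coinNat, flipCoin_apply, hl, dif_pos, if_true, Fin.eta, Function.update_self]
      cases r k <;> simp
    · have : (⟨l, hl⟩ : Fin ℓ) ≠ k := fun h => hlk (by rw [← h])
      simp [coinNat, flipCoin_apply, hl, hlk, Function.update_of_ne this]
  · have : l ≠ k := fun h => hl (h ▸ k.2)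
    simp [coinNat, hl, this]

theorem coinNat_flipCoin_of_ne {k : Fin ℓ} {l : ℕ} (h : l ≠ k) (r : Fin ℓ → Bool) :
    coinNat (flipCoin k r) l = coinNat r l := by rw [coinNat_flipCoin, if_neg h]

theorem coinNat_flipCoin_ne_zero_iff {k : Fin ℓ} {l : ℕ} (h : l = k) (r : Fin ℓ → Bool) :
    coinNat (flipCoin k r) l ≠ 0 ↔ ¬ coinNat r l ≠ 0 := by
  have := coinNat_le_one r l
  rw [coinNat_flipCoin, if_pos h]
  omega

theorem sum_range_two_mul (g : ℕ → ℝ) (N : ℕ) :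
    ∑ y ∈ Finset.range (2 * N), g y = ∑ y ∈ Finset.range N, (g (2 * y) + g (2 * y + 1)) := by
  induction N with
  | zero => simp
  | succ N ih =>
    rw [mul_add, mul_one, Finset.sum_range_succ, Finset.sum_range_succ, ih,
      Finset.sum_range_succ, add_assoc]

/-- Binary digits given by fair coins make a uniform random number. -/
theorem sum_horner {pos : ℕ → ℕ} (hinj : Function.Injective pos) {s : ℕ}
    (hpos : ∀ k < s, pos k < ℓ) {f : ℕ → (Fin ℓ → Bool) → ℝ}
    (hf : ∀ y k (hk : k < s) r, f y (flipCoin ⟨pos k, hpos k hk⟩ r) = f y r) :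
    2 ^ s * ∑ r : Fin ℓ → Bool, f (horner (fun k => coinNat r (pos k)) s) r =
      ∑ y ∈ Finset.range (2 ^ s), ∑ r, f y r := by
  induction s generalizing f with
  | zero => simp [horner]
  | succ s ih =>
    -- The last digit is absorbed into the function, which still ignores the earlier digit coins;
    -- `h2` then averages over the last digit.
    have h1 := ih (fun k hk => hpos k (by omega))
      (f := fun y r => f (2 * y + coinNat r (pos s)) r) fun y k hk r => by
        have hne : pos s ≠ pos k := fun h => by
          have := hinj h
          omega
        rw [coinNat_flipCoin_of_ne (by simpa using hne), hf _ k (by omega)]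
    have h2 : ∀ y, 2 * ∑ r : Fin ℓ → Bool, f (2 * y + coinNat r (pos s)) r =
        ∑ r, f (2 * y) r + ∑ r, f (2 * y + 1) r := by
      intro y
      have hs : pos s < ℓ := hpos s (by omega)
      have e1 := sum_ite_eq_half (flipCoin ⟨pos s, hs⟩) (f := f (2 * y))
        (c := fun r => ¬ coinNat r (pos s) ≠ 0)
        (fun r => not_congr (coinNat_flipCoin_ne_zero_iff rfl r))
        (fun r => hf _ s (by omega) r)
      have e2 := sum_ite_eq_half (flipCoin ⟨pos s, hs⟩) (f := f (2 * y + 1))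
        (c := fun r => coinNat r (pos s) ≠ 0)
        (fun r => coinNat_flipCoin_ne_zero_iff rfl r)
        (fun r => hf _ s (by omega) r)
      have e3 : ∑ r : Fin ℓ → Bool, f (2 * y + coinNat r (pos s)) r =
          ∑ r, (if ¬ coinNat r (pos s) ≠ 0 then f (2 * y) r else 0) +
          ∑ r, (if coinNat r (pos s) ≠ 0 then f (2 * y + 1) r else 0) := by
        rw [← Finset.sum_add_distrib]
        refine Finset.sum_congr rfl fun r _ => ?_
        have := coinNat_le_one r (pos s)
        obtain h | h : coinNat r (pos s) = 0 ∨ coinNat r (pos s) = 1 := by omega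
        · simp [h]
        · simp [h]
      rw [e3, e1, e2]
      ring
    simp only [horner]
    rw [pow_succ, mul_comm (2 ^ s : ℝ) 2, mul_assoc, h1, pow_succ, mul_comm (2 ^ s) 2,
      sum_range_two_mul, Finset.mul_sum]
    exact Finset.sum_congr rfl fun y _ => h2 y

/-- The meaning of the coins for `n` bidders and `m` items. -/
def decode (n m : ℕ) (cn : ℕ → ℕ) : Coins where
  a i := decide (i < n ∧ cn i ≠ 0)
  b i := decide (i < n ∧ cn (n + i) ≠ 0)
  g := decide (cn (n + n) ≠ 0)
  h := decide (cn (n + n + 1) ≠ 0)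
  x := horner (fun k => cn (n + n + (2 + k))) (levelBits m)

namespace Market

variable {X : Market}

/-- The coins of a market, decoded. -/
def coins (X : Market) (r : Fin ℓ → Bool) : Coins := decode X.n X.m (coinNat r)

theorem coinData (X : Market) (r : Fin ℓ → Bool) : CoinData (coinNat r) X (X.coins r) := by
  refine ⟨coinNat_le_one r, fun i hi => ?_, fun i hi => ?_, ?_, ?_, rfl⟩ <;>
    simp [coins, decode, *]

theorem coins_a_flip {k : Fin ℓ} (hk : X.n ≤ k) (r : Fin ℓ → Bool) :
    (X.coins (flipCoin k r)).a = (X.coins r).a := by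
  funext i
  simp only [coins, decode]
  by_cases hi : i < X.n
  · rw [coinNat_flipCoin_of_ne (by omega)]
  · simp [hi]

theorem coins_b_flip {k : Fin ℓ} {i : ℕ} (hk : X.n + i ≠ k) (r : Fin ℓ → Bool) :
    (X.coins (flipCoin k r)).b i = (X.coins r).b i := by
  simp only [coins, decode]
  rw [coinNat_flipCoin_of_ne hk]

theorem coins_b_flip_self {k : Fin ℓ} {i : ℕ} (hi : i < X.n) (hk : X.n + i = k)
    (r : Fin ℓ → Bool) : (X.coins (flipCoin k r)).b i = !(X.coins r).b i := by
  have := coinNat_flipCoin_ne_zero_iff hk r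
  simp only [coins, decode, hi, true_and, this, decide_not]

theorem coins_a_flip_self {k : Fin ℓ} {i : ℕ} (hi : i < X.n) (hk : i = k)
    (r : Fin ℓ → Bool) : (X.coins (flipCoin k r)).a i = !(X.coins r).a i := by
  have := coinNat_flipCoin_ne_zero_iff hk r
  simp only [coins, decode, hi, true_and, this, decide_not]

theorem coins_a_flip_of_ne {k : Fin ℓ} {i : ℕ} (hk : i ≠ k) (r : Fin ℓ → Bool) :
    (X.coins (flipCoin k r)).a i = (X.coins r).a i := by
  simp only [coins, decode]
  rw [coinNat_flipCoin_of_ne hk]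

theorem coins_b_flip_of_le {k : Fin ℓ} (hk : X.n + X.n ≤ k) (r : Fin ℓ → Bool) :
    (X.coins (flipCoin k r)).b = (X.coins r).b := by
  funext i
  by_cases hi : i < X.n
  · exact coins_b_flip (by omega) r
  · simp [coins, decode, hi]

theorem unitPrice_congr {r r' : Coins} (ha : r.a = r'.a) : X.unitPrice r = X.unitPrice r' := by
  rw [unitPrice, unitPrice, ha]

theorem uniformOwners_congr {r r' : Coins} (ha : r.a = r'.a) (hb : r.b = r'.b) (k : ℕ) :
    X.uniformOwners r k = X.uniformOwners r' k := by
  have : r.U = r'.U := by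
    funext i
    simp only [Coins.U, ha, hb]
  rw [uniformOwners, uniformOwners, this, unitPrice_congr ha]

theorem learned_congr {r r' : Coins} (ha : r.a = r'.a) (hb : r.b = r'.b) (k : ℕ) :
    X.learned r k = X.learned r' k := by
  induction k with
  | zero => rfl
  | succ k ih =>
    funext j
    rw [learned, learned, ih, uniformOwners_congr ha hb]

theorem finalOwners_congr {r r' : Coins} (ha : r.a = r'.a) (hb : r.b = r'.b) (x : ℕ) :
    X.finalOwners r x = X.finalOwners r' x := by
  have : r.V = r'.V := by
    funext i
    simp only [Coins.V, ha, hb]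
  rw [finalOwners, finalOwners, this, unitPrice_congr ha, learned_congr ha hb]

theorem le_topBudget {a : ℕ → Bool} {i k : ℕ} (hi : i < k) (ha : a i = true) :
    X.B i ≤ X.topBudget a k := by
  induction k, hi using Nat.le_induction with
  | base =>
    rw [topBudget]
    split_ifs with h
    · exact le_rfl
    · exact (not_le.1 fun h' => h ⟨ha, h'⟩).le
  | succ k _ ih =>
    rw [topBudget]
    split_ifs with h
    · exact ih.trans h.2
    · exact ih

theorem topBudget_le {a : ℕ → Bool} {M : ℝ} (hM : 0 ≤ M) {k : ℕ} (h : ∀ i < k, X.B i ≤ M) :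
    X.topBudget a k ≤ M := by
  induction k with
  | zero => exact hM
  | succ k ih =>
    rw [topBudget]
    split_ifs
    · exact h k (by omega)
    · exact ih fun i hi => h i (by omega)

theorem topTwo_max (k : ℕ) : (∀ i < k, X.B i ≤ (X.topTwo k).2.1) ∧
    ((X.topTwo k).2.1 = 0 ∨ ∃ i < k, (X.topTwo k).1 = i + 1 ∧ (X.topTwo k).2.1 = X.B i) := by
  induction k with
  | zero => simp [topTwo]
  | succ k ih =>
    obtain ⟨h1, h2⟩ := ih
    rw [topTwo]
    split_ifs with h
    · refine ⟨fun i hi => ?_, Or.inr ⟨k, by omega, rfl, rfl⟩⟩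
      rcases Nat.lt_succ_iff_lt_or_eq.1 hi with hi | rfl
      · exact (h1 i hi).trans h.le
      · exact le_rfl
    · refine ⟨fun i hi => ?_, h2.imp_right fun ⟨i, hi, h⟩ => ⟨i, by omega, h⟩⟩
      rcases Nat.lt_succ_iff_lt_or_eq.1 hi with hi | rfl
      · exact h1 i hi
      · exact not_lt.1 h

/-- The winner of all items realizes the full budget, which is the largest one. If the highest bid
is still 0, all budgets are at most 0 and nonnegativity suffices. -/
theorem le_total_topTwo (hB : ∀ i, 0 ≤ X.B i) (hw : ∀ i j, 0 ≤ X.w i j)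
    (hX : ∀ i < X.n, X.value i (Finset.range X.m) = X.B i) {i : ℕ} (hi : i < X.n) :
    X.B i ≤ X.total (fun _ => (X.topTwo X.n).1) := by
  obtain ⟨h1, h2⟩ := X.topTwo_max X.n
  rcases h2 with h0 | ⟨l, hl, hl1, hl2⟩
  · exact (h1 i hi).trans (h0.le.trans (total_nonneg hB hw _))
  · refine ((h1 i hi).trans hl2.le).trans ?_
    have := Finset.single_le_sum (f := fun i => X.value i (X.bundle (fun _ => (X.topTwo X.n).1) i))
      (fun i _ => value_nonneg hB hw i _) (Finset.mem_range.2 hl)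
    simp only [bundle, hl1, Finset.filter_true, hX l hl] at this
    simpa only [total, bundle, hl1] using this

/-! ### The expected welfare -/

variable {O : ℕ → Finset ℕ} {q : ℕ → ℕ → ℝ}

/-- In expectation, the second group loses at most the utility of the first group. -/
theorem Supported.sum_lost_le (hq : X.Supported O q) (hB : ∀ i, 0 ≤ X.B i) (hℓ : X.n + X.n ≤ ℓ)
    (e k : ℕ) :
    ∑ r : Fin ℓ → Bool, (if (X.coins r).a e = true then ∑ i ∈ Finset.range X.n,
        (if (X.coins r).V i = true then X.lost (X.coins r) O q k i else 0) else 0) ≤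
      ∑ r : Fin ℓ → Bool, (if (X.coins r).a e = true then
        X.total (X.uniformOwners (X.coins r) k) else 0) := by
  set G : ℕ → (Fin ℓ → Bool) → ℝ := fun i r =>
    if (X.coins r).a e = true then (if (X.coins r).U i = true then
      X.saleUtility (X.coins r).U (fun _ => 2 ^ (k * blocks X.m)) (X.unitPrice (X.coins r)) i
      else 0) else 0 with hG
  have h1 : ∀ i < X.n, ∑ r : Fin ℓ → Bool, (if (X.coins r).a e = true then
      (if (X.coins r).V i = true then X.lost (X.coins r) O q k i else 0) else 0) ≤
      ∑ r, G i r := by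
    intro i hi
    -- Flipping the group coin of `i` moves `i` from the second group to the first and preserves the
    -- unit price and the group membership of all earlier bidders. What the original sale leaves
    -- unsold is thus available to `i` in the new one.
    rw [← Equiv.sum_comp (flipCoin (⟨X.n + i, by omega⟩ : Fin ℓ)) (G i)]
    refine Finset.sum_le_sum fun r _ => ?_
    have ha := X.coins_a_flip (k := (⟨X.n + i, by omega⟩ : Fin ℓ)) (by simp) r
    have hb := X.coins_b_flip_self (k := (⟨X.n + i, by omega⟩ : Fin ℓ)) hi rfl r
    have hb' : ∀ l < i, (X.coins (flipCoin (⟨X.n + i, by omega⟩ : Fin ℓ) r)).b l =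
        (X.coins r).b l := fun l hl => coins_b_flip (by simp; omega) r
    simp only [hG, ha, unitPrice_congr ha]
    split_ifs with h1 h2 h3 h3
    · refine hq.sum_unsold_le hi (fun l hl => ?_) (Finset.filter_subset _ _)
      rw [Coins.U, Coins.U, ha, hb' l hl]
    · exfalso
      simp only [Coins.V, Bool.and_eq_true, Bool.not_eq_true'] at h2
      simp [Coins.U, ha, hb, h2] at h3
    · exact saleUtility_nonneg hB i
    · exact le_rfl
    · exact le_rfl
  calc _ = ∑ i ∈ Finset.range X.n, ∑ r : Fin ℓ → Bool, (if (X.coins r).a e = true then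
      (if (X.coins r).V i = true then X.lost (X.coins r) O q k i else 0) else 0) := by
        rw [Finset.sum_comm]
        refine Finset.sum_congr rfl fun r _ => ?_
        split_ifs <;> simp
    _ ≤ ∑ i ∈ Finset.range X.n, ∑ r, G i r :=
        Finset.sum_le_sum fun i hi => h1 i (Finset.mem_range.1 hi)
    _ ≤ _ := by
        rw [Finset.sum_comm]
        refine Finset.sum_le_sum fun r _ => ?_
        simp only [hG]
        split_ifs with ha
        · have := utility_add_revenue_le_total (X := X) (H := (X.coins r).U)
            (c := fun _ => 2 ^ (k * blocks X.m)) hB (unitPrice_nonneg (X := X) (r := X.coins r))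
          refine le_trans (le_add_of_nonneg_right ?_) this
          refine Finset.sum_nonneg fun j _ => ?_
          split_ifs
          · exact mul_nonneg (Nat.cast_nonneg _) unitPrice_nonneg
          · exact le_rfl
        · simp

/-- Three independent fair coins decide: `e` estimates, `i` does not, and `i` falls into the second
group. -/
theorem sum_coins_eq (hℓ : X.n + X.n ≤ ℓ) {e i : ℕ} (he : e < X.n) (hi : i < X.n) (hie : i ≠ e)
    (c : ℝ) : ∑ r : Fin ℓ → Bool, (if (X.coins r).a e = true then
      (if (X.coins r).V i = true then c else 0) else 0) = 2 ^ ℓ / 8 * c := by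
  have h1 := sum_ite_eq_half (flipCoin (⟨e, by omega⟩ : Fin ℓ)) (c := fun r => (X.coins r).a e = true)
    (f := fun r => if (X.coins r).V i = true then c else 0)
    (fun r => by rw [coins_a_flip_self he rfl]; simp)
    (fun r => by
      rw [Coins.V, Coins.V, coins_a_flip_of_ne (by simpa using hie),
        coins_b_flip (by simp; omega)])
  have h2 := sum_ite_eq_half (flipCoin (⟨i, by omega⟩ : Fin ℓ))
    (c := fun r => ¬ (X.coins r).a i = true)
    (f := fun r => if ¬ (X.coins r).b i = true then c else 0)
    (fun r => by rw [coins_a_flip_self hi rfl]; simp)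
    (fun r => by rw [coins_b_flip (by simp; omega)])
  have h3 := sum_ite_eq_half (flipCoin (⟨X.n + i, by omega⟩ : Fin ℓ))
    (c := fun r => ¬ (X.coins r).b i = true) (f := fun r => c)
    (fun r => by rw [coins_b_flip_self hi rfl]; simp) (fun r => rfl)
  have h4 : ∀ r : Fin ℓ → Bool, (if (X.coins r).V i = true then c else 0) =
      if ¬ (X.coins r).a i = true then (if ¬ (X.coins r).b i = true then c else 0) else 0 := by
    intro r
    simp only [Coins.V]
    by_cases h : (X.coins r).a i = true <;> by_cases h' : (X.coins r).b i = true <;> simp [h, h']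
  rw [h1, Finset.sum_congr rfl fun r _ => h4 r, h2, h3]
  simp
  ring

/-- Guarantees that the grid of prices reaches up to the highest budget. -/
theorem blocks_mul_self (m : ℕ) : levels m ≤ blocks m * blocks m := by
  have h : blocks m * blocks m = 4 ^ levelBits m := by
    rw [blocks, ← mul_pow]
    norm_num
  rw [h]
  exact Nat.le_pow_clog (by decide) _

/-- Only outcomes in which `e` estimates are used. The losses of the second group are charged to the
uniform sales, whose weight rises from 2 to 4, the weight of the final sales. The probability 1/8
turns 4 into 32. -/
theorem Supported.sum_le_sum_total (hq : X.Supported O q) (hB : ∀ i, 0 ≤ X.B i)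
    (hw : ∀ i j, 0 ≤ X.w i j) (hℓ : X.n + X.n ≤ ℓ) {e : ℕ} (he : e < X.n)
    (hmax : ∀ i < X.n, X.B i ≤ X.B e) :
    2 ^ ℓ * (∑ i ∈ Finset.range X.n, ∑ j ∈ O i, q i j - 3 / 2 * X.B e) ≤
      32 * ∑ x ∈ Finset.range (blocks X.m), ∑ r : Fin ℓ → Bool,
        (X.total (X.uniformOwners (X.coins r) x) + X.total (X.finalOwners (X.coins r) x)) := by
  set p := X.B e / 2 ^ levels X.m with hp
  have hp0 : 0 ≤ p := div_nonneg (hB e) (by positivity)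
  have hpB : 2 ^ levels X.m * p = X.B e := by
    rw [hp]
    field_simp
  set Q : ℕ → ℝ := fun i => ∑ j ∈ O i with 2 * p ≤ q i j, q i j with hQ
  -- When `e` is an estimator, the estimate is exactly the largest budget.
  have hunit : ∀ r : Fin ℓ → Bool, (X.coins r).a e = true → X.unitPrice (X.coins r) = p := by
    intro r ha
    rw [unitPrice, hp, le_antisymm (topBudget_le (hB e) hmax) (le_topBudget he ha)]
  have hqB : ∀ i < X.n, ∀ j ∈ O i, q i j ≤ 2 ^ (blocks X.m * blocks X.m) * p := by
    intro i hi j hj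
    have h1 := hq.le_value i {j} (Finset.singleton_subset_iff.2 hj)
    rw [Finset.sum_singleton] at h1
    have h2 : (2 : ℝ) ^ levels X.m * p ≤ 2 ^ (blocks X.m * blocks X.m) * p :=
      mul_le_mul_of_nonneg_right (pow_le_pow_right₀ (by norm_num) (blocks_mul_self _)) hp0
    exact (h1.trans ((min_le_left _ _).trans (hmax i hi))).trans (hpB ▸ h2)
  have hmain : ∑ r : Fin ℓ → Bool, (if (X.coins r).a e = true then ∑ i ∈ Finset.range X.n,
      (if (X.coins r).V i = true then Q i else 0) else 0) ≤
      4 * ∑ x ∈ Finset.range (blocks X.m), ∑ r : Fin ℓ → Bool,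
        (X.total (X.uniformOwners (X.coins r) x) + X.total (X.finalOwners (X.coins r) x)) := by
    have h1 : ∀ r ∈ (Finset.univ : Finset (Fin ℓ → Bool)),
        (if (X.coins r).a e = true then ∑ i ∈ Finset.range X.n,
          (if (X.coins r).V i = true then Q i else 0) else 0) ≤
        2 * ∑ k ∈ Finset.range (blocks X.m), (if (X.coins r).a e = true then
          ∑ i ∈ Finset.range X.n,
            (if (X.coins r).V i = true then X.lost (X.coins r) O q k i else 0) else 0) +
        (4 * ∑ x ∈ Finset.range (blocks X.m), X.total (X.finalOwners (X.coins r) x) +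
          2 * ∑ k ∈ Finset.range (blocks X.m), X.total (X.uniformOwners (X.coins r) k)) := by
      intro r _
      split_ifs with ha
      · have hu := hunit r ha
        have := hq.sum_le (r := X.coins r) hB (by rwa [hu])
        rw [hu] at this
        linarith
      · have e1 : 0 ≤ ∑ x ∈ Finset.range (blocks X.m), X.total (X.finalOwners (X.coins r) x) :=
          Finset.sum_nonneg fun x _ => total_nonneg hB hw _
        have e2 : 0 ≤ ∑ x ∈ Finset.range (blocks X.m), X.total (X.uniformOwners (X.coins r) x) :=
          Finset.sum_nonneg fun x _ => total_nonneg hB hw _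
        rw [Finset.sum_const_zero]
        linarith
    refine (Finset.sum_le_sum h1).trans ?_
    rw [Finset.sum_add_distrib, Finset.sum_add_distrib, ← Finset.mul_sum, ← Finset.mul_sum,
      ← Finset.mul_sum, Finset.sum_comm, Finset.sum_comm (t := Finset.range (blocks X.m)),
      Finset.sum_comm (t := Finset.range (blocks X.m))]
    have h2 := Finset.sum_le_sum (s := Finset.range (blocks X.m))
      fun k _ => hq.sum_lost_le (ℓ := ℓ) hB hℓ e k
    have h3 : ∑ k ∈ Finset.range (blocks X.m), ∑ r : Fin ℓ → Bool,
        (if (X.coins r).a e = true then X.total (X.uniformOwners (X.coins r) k) else 0) ≤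
        ∑ k ∈ Finset.range (blocks X.m), ∑ r : Fin ℓ → Bool,
          X.total (X.uniformOwners (X.coins r) k) :=
      Finset.sum_le_sum fun k _ => Finset.sum_le_sum fun r _ => by
        split_ifs
        · exact le_rfl
        · exact total_nonneg hB hw _
    simp only [Finset.sum_add_distrib]
    linarith
  have hcount : ∑ r : Fin ℓ → Bool, (if (X.coins r).a e = true then ∑ i ∈ Finset.range X.n,
      (if (X.coins r).V i = true then Q i else 0) else 0) =
      2 ^ ℓ / 8 * ∑ i ∈ (Finset.range X.n).erase e, Q i := by
    calc _ = ∑ i ∈ Finset.range X.n, ∑ r : Fin ℓ → Bool, (if (X.coins r).a e = true then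
        (if (X.coins r).V i = true then Q i else 0) else 0) := by
          rw [Finset.sum_comm]
          refine Finset.sum_congr rfl fun r _ => ?_
          split_ifs <;> simp
      _ = _ := by
          rw [← Finset.add_sum_erase _ _ (Finset.mem_range.2 he), Finset.mul_sum]
          have h0 : ∑ r : Fin ℓ → Bool, (if (X.coins r).a e = true then
              (if (X.coins r).V e = true then Q e else 0) else 0) = 0 := by
            refine Finset.sum_eq_zero fun r _ => ?_
            split_ifs with h1 h2
            · simp [Coins.V, h1] at h2
            · rfl
            · rfl
          rw [h0, zero_add]
          refine Finset.sum_congr rfl fun i hi => ?_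
          rw [Finset.mem_erase, Finset.mem_range] at hi
          exact sum_coins_eq hℓ he hi.2 hi.1 _
  -- Dropping `e` costs at most `B e`. The items priced below `2 * p` cost at most `2 * m * p ≤ B e
  -- / 2`, as `2 ^ levels m ≥ 4 * m`.
  have hlow : ∑ i ∈ Finset.range X.n, ∑ j ∈ O i, q i j - 3 / 2 * X.B e ≤
      ∑ i ∈ (Finset.range X.n).erase e, Q i := by
    rw [← Finset.add_sum_erase _ _ (Finset.mem_range.2 he)]
    have h1 : ∑ j ∈ O e, q e j ≤ X.B e := (hq.le_value e _ subset_rfl).trans (min_le_left _ _)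
    have h2 : ∀ i ∈ (Finset.range X.n).erase e, ∑ j ∈ O i, q i j ≤ Q i + ∑ j ∈ O i, 2 * p := by
      intro i _
      simp only [hQ]
      rw [Finset.sum_filter, ← Finset.sum_add_distrib]
      refine Finset.sum_le_sum fun j _ => ?_
      split_ifs with h
      · linarith
      · linarith
    have h3 := Finset.sum_le_sum h2
    rw [Finset.sum_add_distrib] at h3
    have h4 := hq.sum_sum_le (T := O) (fun i => subset_rfl) (f := fun _ => 2 * p)
      (fun _ => by positivity) ((Finset.range X.n).erase e)
    rw [Finset.sum_const, Finset.card_range, nsmul_eq_mul] at h4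
    have h5 : ((4 * X.m : ℕ) : ℝ) ≤ ((2 ^ levels X.m : ℕ) : ℝ) := by
      exact_mod_cast Nat.le_pow_clog (by decide) _
    push_cast at h5
    have h6 := mul_le_mul_of_nonneg_right h5 hp0
    rw [hpB] at h6
    linarith
  rw [hcount] at hmain
  have hpos : (0 : ℝ) < 2 ^ ℓ := by positivity
  nlinarith [mul_le_mul_of_nonneg_left hlow hpos.le]

/-- The coins beyond the first `2 * n` only select the auction: the joint sale has probability 1/2,
and each of the `2 * blocks` group sales has probability `1 / (4 * blocks)`. The hypotheses say that
the welfare of a fixed auction ignores these coins. -/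
theorem sum_outcome (f : (Fin ℓ → Bool) → ℝ) (u v : ℕ → (Fin ℓ → Bool) → ℝ)
    (hℓ : X.n + X.n + 2 + levelBits X.m ≤ ℓ)
    (hf : ∀ (k : Fin ℓ) r, X.n + X.n ≤ k → f (flipCoin k r) = f r)
    (hu : ∀ y (k : Fin ℓ) r, X.n + X.n ≤ k → u y (flipCoin k r) = u y r)
    (hv : ∀ y (k : Fin ℓ) r, X.n + X.n ≤ k → v y (flipCoin k r) = v y r) :
    ∑ r : Fin ℓ → Bool, (if (X.coins r).g = true then f r
      else if (X.coins r).h = true then u (X.coins r).x r else v (X.coins r).x r) =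
    (∑ r, f r) / 2 +
      (∑ x ∈ Finset.range (blocks X.m), ∑ r, (u x r + v x r)) / (4 * blocks X.m) := by
  have hg : ∀ r : Fin ℓ → Bool, (X.coins (flipCoin (⟨X.n + X.n, by omega⟩ : Fin ℓ) r)).g =
      !(X.coins r).g := fun r => by
    have := coinNat_flipCoin_ne_zero_iff (k := (⟨X.n + X.n, by omega⟩ : Fin ℓ)) rfl r
    simp only at this
    simp only [coins, decode, this, decide_not]
  have hh : ∀ r : Fin ℓ → Bool, (X.coins (flipCoin (⟨X.n + X.n + 1, by omega⟩ : Fin ℓ) r)).h =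
      !(X.coins r).h := fun r => by
    have := coinNat_flipCoin_ne_zero_iff (k := (⟨X.n + X.n + 1, by omega⟩ : Fin ℓ)) rfl r
    simp only at this
    simp only [coins, decode, this, decide_not]
  have hgh : ∀ r : Fin ℓ → Bool, (X.coins (flipCoin (⟨X.n + X.n, by omega⟩ : Fin ℓ) r)).h =
      (X.coins r).h := fun r => by
    simp only [coins, decode]
    rw [coinNat_flipCoin_of_ne (by simp)]
  have hx : ∀ (k : Fin ℓ) (r : Fin ℓ → Bool), (k : ℕ) < X.n + X.n + 2 →
      (X.coins (flipCoin k r)).x = (X.coins r).x := fun k r hk => by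
    have : (fun l => coinNat (flipCoin k r) (X.n + X.n + (2 + l))) =
        fun l => coinNat r (X.n + X.n + (2 + l)) := by
      funext l
      exact coinNat_flipCoin_of_ne (by omega) r
    simp only [coins, decode, this]
  have hunif : ∀ w : ℕ → (Fin ℓ → Bool) → ℝ,
      (∀ y (k : Fin ℓ) r, X.n + X.n ≤ k → w y (flipCoin k r) = w y r) →
      ∑ r : Fin ℓ → Bool, w (X.coins r).x r =
        (∑ x ∈ Finset.range (blocks X.m), ∑ r, w x r) / blocks X.m := by
    intro w hw
    have := sum_horner (ℓ := ℓ) (pos := fun k => X.n + X.n + (2 + k)) (s := levelBits X.m)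
      (fun a b hab => by simpa using hab) (fun k hk => by omega) (f := w)
      (fun y k hk r => hw y _ r (by simp))
    rw [eq_div_iff (by exact_mod_cast (blocks_pos X.m).ne'), mul_comm, blocks, ← this]
    push_cast
    rfl
  have e1 := sum_ite_eq_half (flipCoin (⟨X.n + X.n, by omega⟩ : Fin ℓ))
    (c := fun r => (X.coins r).g = true) (f := f) (fun r => by rw [hg]; simp)
    (fun r => hf _ r le_rfl)
  have e2 := sum_ite_eq_half (flipCoin (⟨X.n + X.n, by omega⟩ : Fin ℓ))
    (c := fun r => ¬ (X.coins r).g = true)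
    (f := fun r => if (X.coins r).h = true then u (X.coins r).x r else v (X.coins r).x r)
    (fun r => by rw [hg]; simp)
    (fun r => by
      rw [hgh, hx _ _ (by simp), hu _ _ _ le_rfl, hv _ _ _ le_rfl])
  have e3 := sum_ite_eq_half (flipCoin (⟨X.n + X.n + 1, by omega⟩ : Fin ℓ))
    (c := fun r => (X.coins r).h = true) (f := fun r => u (X.coins r).x r)
    (fun r => by rw [hh]; simp)
    (fun r => by rw [hx _ _ (by simp), hu _ _ _ (by simp)])
  have e4 := sum_ite_eq_half (flipCoin (⟨X.n + X.n + 1, by omega⟩ : Fin ℓ))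
    (c := fun r => ¬ (X.coins r).h = true) (f := fun r => v (X.coins r).x r)
    (fun r => by rw [hh]; simp)
    (fun r => by rw [hx _ _ (by simp), hv _ _ _ (by simp)])
  have s1 : ∀ (c : (Fin ℓ → Bool) → Bool) (f' g' : (Fin ℓ → Bool) → ℝ),
      ∑ r, (if c r = true then f' r else g' r) =
      ∑ r, (if c r = true then f' r else 0) + ∑ r, (if ¬ c r = true then g' r else 0) := by
    intro c f' g'
    rw [← Finset.sum_add_distrib]
    refine Finset.sum_congr rfl fun r _ => ?_
    cases c r <;> simp
  rw [s1 (fun r => (X.coins r).g), e1, e2, s1 (fun r => (X.coins r).h), e3, e4, hunif u hu,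
    hunif v hv]
  simp only [Finset.sum_add_distrib]
  have : (blocks X.m : ℝ) ≠ 0 := by exact_mod_cast (blocks_pos X.m).ne'
  field_simp
  ring

/-- The factor `128 * blocks` turns the weight `1 / (4 * blocks)` into the 32 of `sum_le_sum_total`,
and the weight 1/2 of the joint sale into `64 * blocks`, ample for the deficit `3 / 2 * B e`. -/
theorem Supported.approximation (hq : X.Supported O q) (hB : ∀ i, 0 ≤ X.B i)
    (hw : ∀ i j, 0 ≤ X.w i j) (hX : ∀ i < X.n, X.value i (Finset.range X.m) = X.B i)
    (hℓ : X.n + X.n + 2 + levelBits X.m ≤ ℓ) :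
    ∑ i ∈ Finset.range X.n, ∑ j ∈ O i, q i j ≤ 128 * blocks X.m *
      ((∑ r : Fin ℓ → Bool, X.total (X.outcomeOwner (X.coins r))) / 2 ^ ℓ) := by
  rcases Nat.eq_zero_or_pos X.n with hn | hn
  · rw [hn, Finset.sum_range_zero]
    have := Finset.sum_nonneg fun (r : Fin ℓ → Bool) (_ : r ∈ Finset.univ) =>
      X.total_nonneg hB hw (X.outcomeOwner (X.coins r))
    positivity
  obtain ⟨e, he, hmax⟩ := (Finset.range X.n).exists_max_image X.B ⟨0, Finset.mem_range.2 hn⟩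
  rw [Finset.mem_range] at he
  have h1 := hq.sum_le_sum_total (ℓ := ℓ) hB hw (by omega) he
    fun i hi => hmax i (Finset.mem_range.2 hi)
  have h2 := sum_outcome (X := X) (ℓ := ℓ) (fun _ => X.total (fun _ => (X.topTwo X.n).1))
    (fun x r => X.total (X.uniformOwners (X.coins r) x))
    (fun x r => X.total (X.finalOwners (X.coins r) x)) hℓ (fun _ _ _ => rfl)
    (fun y k r hk => by
      rw [uniformOwners_congr (coins_a_flip (by omega) r) (coins_b_flip_of_le hk r)])
    (fun y k r hk => by
      rw [finalOwners_congr (coins_a_flip (by omega) r) (coins_b_flip_of_le hk r)])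
  have h3 : ∑ r : Fin ℓ → Bool, X.total (X.outcomeOwner (X.coins r)) =
      ∑ r : Fin ℓ → Bool, (if (X.coins r).g = true then X.total (fun _ => (X.topTwo X.n).1)
      else if (X.coins r).h = true then X.total (X.uniformOwners (X.coins r) (X.coins r).x)
      else X.total (X.finalOwners (X.coins r) (X.coins r).x)) := by
    refine Finset.sum_congr rfl fun r _ => ?_
    split_ifs with hg hh
    · congr 1
      funext j
      simp [outcomeOwner, hg]
    · congr 1
      funext j
      simp [outcomeOwner, hg, hh]
    · congr 1
      funext j
      simp [outcomeOwner, hg, hh]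
  rw [h3, h2]
  have h4 := le_total_topTwo hB hw hX he
  have hK : (1 : ℝ) ≤ blocks X.m := by exact_mod_cast blocks_pos X.m
  have hpos : (0 : ℝ) < 2 ^ ℓ := by positivity
  generalize ∑ x ∈ Finset.range (blocks X.m), ∑ r : Fin ℓ → Bool,
    (X.total (X.uniformOwners (X.coins r) x) + X.total (X.finalOwners (X.coins r) x)) = S at h1 ⊢
  generalize ∑ i ∈ Finset.range X.n, ∑ j ∈ O i, q i j = Z at h1 ⊢
  rw [Finset.sum_const, Finset.card_univ, Fintype.card_fun, Fintype.card_bool, Fintype.card_fin,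
    nsmul_eq_mul]
  push_cast
  have h5 : 128 * (blocks X.m : ℝ) *
      ((2 ^ ℓ * X.total (fun _ => (X.topTwo X.n).1) / 2 + S / (4 * blocks X.m)) / 2 ^ ℓ) =
      64 * blocks X.m * X.total (fun _ => (X.topTwo X.n).1) + 32 * S / 2 ^ ℓ := by
    field_simp
    ring
  rw [h5]
  have h6 : Z - 3 / 2 * X.B e ≤ 32 * S / 2 ^ ℓ := by
    rw [le_div_iff₀ hpos]
    linarith
  have h7 := mul_le_mul hK h4 (hB e) (by linarith)
  have := hB e
  nlinarith

end Market

/-! ### The running time -/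

theorem two_pow_levels_le (m : ℕ) : 2 ^ levels m ≤ 8 * m + 1 := by
  rcases Nat.eq_zero_or_pos (levels m) with h | h
  · rw [h]
    simp
  · obtain ⟨t, ht⟩ : ∃ t, levels m = t + 1 := ⟨levels m - 1, by omega⟩
    have : 2 ^ t < 4 * m := (Nat.lt_clog_iff_pow_lt (by decide)).1 (by
      change t < levels m
      omega)
    rw [ht, pow_succ]
    omega

theorem blocks_mul_self_le (m : ℕ) : blocks m * blocks m ≤ 4 * levels m + 1 := by
  have h : blocks m * blocks m = 4 ^ levelBits m := by
    rw [blocks, ← mul_pow]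
    norm_num
  rw [h]
  rcases Nat.eq_zero_or_pos (levelBits m) with h | h
  · rw [h]
    simp
  · obtain ⟨t, ht⟩ : ∃ t, levelBits m = t + 1 := ⟨levelBits m - 1, by omega⟩
    have : 4 ^ t < levels m := (Nat.lt_clog_iff_pow_lt (by decide)).1 (by
      change t < levelBits m
      omega)
    rw [ht, pow_succ]
    omega

theorem levels_le (m : ℕ) : levels m ≤ m + 2 := by
  refine Nat.clog_le_of_le_pow ?_
  have : m < 2 ^ m := Nat.lt_two_pow_self
  rw [pow_add]
  omega

theorem levelBits_le (m : ℕ) : levelBits m ≤ m + 2 := by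
  have h1 : levelBits m ≤ levels m := Nat.clog_le_of_le_pow (Nat.lt_pow_self (by decide)).le
  exact h1.trans (levels_le m)

/-- The exponent is $17=4\cdot4+1$: the number of blocks squared is at most `4 * levels m + 1`, and
`2 ^ levels m ≤ N ^ 4`. -/
theorem maxCost_le (m : ℕ) {N : ℕ} (h : m + 2 ≤ N) : maxCost m ≤ N ^ 17 := by
  have h1 : 2 ^ levels m ≤ N ^ 4 := by
    refine (two_pow_levels_le m).trans ?_
    have : 2 ^ 3 ≤ N ^ 3 := Nat.pow_le_pow_left (by omega) 3
    calc 8 * m + 1 ≤ 8 * N := by omega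
      _ ≤ N ^ 3 * N := Nat.mul_le_mul_right _ (by simpa using this)
      _ = N ^ 4 := by ring
  calc maxCost m ≤ 2 ^ (4 * levels m + 1) :=
        Nat.pow_le_pow_right (by decide) (blocks_mul_self_le m)
    _ = (2 ^ levels m) ^ 4 * 2 := by rw [pow_succ, mul_comm 4, pow_mul]
    _ ≤ (N ^ 4) ^ 4 * N := Nat.mul_le_mul (Nat.pow_le_pow_left h1 4) (by omega)
    _ = N ^ 17 := by ring

/-- The dominant term is one sale per block, of order `N ^ 3 * M ^ 2` with `M ≤ N ^ 17` bounding
both costs and blocks. The constant $512=2^9$ is absorbed by `N ^ 9`, and $9+3+34=46$. -/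
theorem mainTime_le (X : Market) : mainTime X ≤ (X.n + X.m + 2) ^ 46 := by
  obtain ⟨N, hN⟩ : ∃ N, N = X.n + X.m + 2 := ⟨_, rfl⟩
  obtain ⟨M, hM⟩ : ∃ M, M = maxCost X.m := ⟨_, rfl⟩
  have hM1 : 1 ≤ M := hM ▸ Nat.one_le_two_pow
  have hMN : M ≤ N ^ 17 := hM ▸ maxCost_le X.m (by omega)
  have hK : blocks X.m ≤ M := by
    rw [hM, maxCost]
    exact (Nat.lt_two_pow_self).le.trans
      (Nat.pow_le_pow_right (by decide) (Nat.le_mul_self _))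
  have hlev := levels_le X.m
  have hbit := levelBits_le X.m
  have hsale : saleTime X ≤ 100 * (N ^ 3 * M) := by
    have : X.m * M + 1 ≤ N * M := by
      have : (X.m + 1) * M ≤ N * M := Nat.mul_le_mul_right _ (by omega)
      nlinarith
    calc saleTime X = 100 * (X.n + 1) * (X.m + 1) * (X.m * M + 1) := by rw [saleTime, hM]
      _ ≤ 100 * N * N * (N * M) := by gcongr <;> omega
      _ = 100 * (N ^ 3 * M) := by ring
  have mono : ∀ a b, a ≤ 3 → b ≤ 2 → N ^ a * M ^ b ≤ N ^ 3 * M ^ 2 := fun a b ha hb =>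
    Nat.mul_le_mul (Nat.pow_le_pow_right (by omega) ha) (Nat.pow_le_pow_right hM1 hb)
  have h1 : (X.n + 1) * (X.m + 1) ≤ N ^ 2 := by
    rw [sq]
    exact Nat.mul_le_mul (by omega) (by omega)
  have h2 : blocks X.m * (saleTime X + 10 * (X.m + blocks X.m + 1)) ≤
      M * (100 * (N ^ 3 * M) + 10 * (N + M)) := Nat.mul_le_mul hK (by omega)
  have h3 : (X.m + 1) * (blocks X.m + 1) ≤ N * (M + 1) := Nat.mul_le_mul (by omega) (by omega)
  have h4 : mainTime X ≤ 20 * N ^ 2 + (10 * N + (10 * N + 10 + (10 * N + 10 +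
      ((M * (100 * (N ^ 3 * M) + 10 * (N + M)) + 10 * N) +
        (100 * (N ^ 3 * M) + 10 * (N * (M + 1)) + 1 + 1) + 30 * N + 1)))) := by
    rw [mainTime, mul_assoc 20, mul_assoc 10]
    omega
  have h5 : mainTime X ≤ 512 * (N ^ 3 * M ^ 2) := by
    have m00 := mono 0 0 (by decide) (by decide)
    have m10 := mono 1 0 (by decide) (by decide)
    have m20 := mono 2 0 (by decide) (by decide)
    have m11 := mono 1 1 (by decide) (by decide)
    have m02 := mono 0 2 (by decide) (by decide)
    have m31 := mono 3 1 (by decide) (by decide)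
    simp only [pow_zero, pow_one, mul_one, one_mul] at m00 m10 m20 m11 m02 m31
    have e : M * (100 * (N ^ 3 * M) + 10 * (N + M)) =
        100 * (N ^ 3 * M ^ 2) + 10 * (N * M) + 10 * M ^ 2 := by ring
    rw [e, mul_add, mul_one] at h4
    omega
  rw [← hN]
  calc mainTime X ≤ 2 ^ 9 * (N ^ 3 * M ^ 2) := by simpa using h5
    _ ≤ N ^ 9 * (N ^ 3 * (N ^ 17) ^ 2) := Nat.mul_le_mul (Nat.pow_le_pow_left (by omega) 9)
        (Nat.mul_le_mul_left _ (Nat.pow_le_pow_left hMN 2))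
    _ = N ^ 46 := by ring

/-- From $K^2\le4L+1$ and $L\le4+\log_2m$ one gets $K^2\le17+4\log_2m\le21\log_2m\le36\log m$; the
hypothesis $m\ge2$ absorbs the constant. -/
theorem blocks_le_sqrt_log {m : ℕ} (hm : 2 ≤ m) : (blocks m : ℝ) ≤ 6 * √(Real.log m) := by
  have hlog2 : 0.6931471803 < Real.log 2 := Real.log_two_gt_d9
  have hlogm : Real.log 2 ≤ Real.log m :=
    Real.log_le_log (by norm_num) (by exact_mod_cast hm)
  have h1 : (levels m : ℝ) * Real.log 2 ≤ 4 * Real.log 2 + Real.log m := by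
    have h : ((2 ^ levels m : ℕ) : ℝ) ≤ ((2 ^ 4 * m : ℕ) : ℝ) := by
      have := two_pow_levels_le m
      exact_mod_cast (by omega : 2 ^ levels m ≤ 2 ^ 4 * m)
    have h' := Real.log_le_log (by positivity) h
    rw [Nat.cast_mul, Nat.cast_pow, Nat.cast_pow, Real.log_mul (by positivity) (by positivity),
      Real.log_pow, Real.log_pow] at h'
    exact_mod_cast h'
  have h2 : ((blocks m * blocks m : ℕ) : ℝ) ≤ ((4 * levels m + 1 : ℕ) : ℝ) := by
    exact_mod_cast blocks_mul_self_le m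
  push_cast at h2
  have h3 : (blocks m : ℝ) * blocks m ≤ 36 * Real.log m := by nlinarith
  have h4 : (blocks m : ℝ) = √((blocks m : ℝ) * blocks m) :=
    (Real.sqrt_mul_self (Nat.cast_nonneg _)).symm
  rw [h4, show (6 : ℝ) = √36 by
    rw [show (36 : ℝ) = 6 * 6 by norm_num, Real.sqrt_mul_self (by norm_num)],
    ← Real.sqrt_mul (by norm_num)]
  exact Real.sqrt_le_sqrt h3

/-! ### The mechanism -/

theorem Valuation.nonneg {m : ℕ} (v : Valuation m) (S : Finset (Fin m)) : 0 ≤ v S :=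
  v.empty' ▸ v.mono' (Finset.empty_subset S)

/-- The value of the set of all items is a canonical budget, which makes the mechanism a function of
the valuation alone. -/
theorem IsBudget.eq_min {m : ℕ} {v : Valuation m} {b : ℝ} (h : IsBudget v b)
    (S : Finset (Fin m)) : v S = min (v Finset.univ) (∑ j ∈ S, v {j}) := by
  have hle : ∑ j ∈ S, v {j} ≤ ∑ j, v {j} :=
    Finset.sum_le_sum_of_subset_of_nonneg (Finset.subset_univ _) fun j _ _ => v.nonneg _
  rw [h Finset.univ, min_assoc, min_eq_right hle, h S]

variable {n m : ℕ}

/-- The market of a profile of valuations. -/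
noncomputable def market (v : Fin n → budgetAdditive m) : Market where
  n := n
  m := m
  w i j := if h : i < n ∧ j < m then (v ⟨i, h.1⟩ : Valuation m) {⟨j, h.2⟩} else 0
  B i := if h : i < n then (v ⟨i, h⟩ : Valuation m) Finset.univ else 0

theorem market_w (v : Fin n → budgetAdditive m) (i : Fin n) (j : Fin m) :
    (market v).w i j = (v i : Valuation m) {j} := by
  simp [market]

theorem market_B (v : Fin n → budgetAdditive m) (i : Fin n) :
    (market v).B i = (v i : Valuation m) Finset.univ := by
  simp [market]

theorem market_w_nonneg (v : Fin n → budgetAdditive m) (i j : ℕ) : 0 ≤ (market v).w i j := by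
  simp only [market]
  split_ifs
  · exact Valuation.nonneg _ _
  · exact le_rfl

theorem market_B_nonneg (v : Fin n → budgetAdditive m) (i : ℕ) : 0 ≤ (market v).B i := by
  simp only [market]
  split_ifs
  · exact Valuation.nonneg _ _
  · exact le_rfl

theorem market_value (v : Fin n → budgetAdditive m) (i : Fin n) (S : Finset (Fin m)) :
    (market v).value i (S.map Fin.valEmbedding) = (v i : Valuation m) S := by
  obtain ⟨b, hb⟩ := (v i).2
  rw [hb.eq_min S, Market.value, market_B, Finset.sum_map]
  simp only [Fin.valEmbedding_apply, market_w]

theorem market_value_range (v : Fin n → budgetAdditive m) {i : ℕ} (hi : i < n) :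
    (market v).value i (Finset.range m) = (market v).B i := by
  have h := market_value v ⟨i, hi⟩ Finset.univ
  rw [Fin.map_valEmbedding_univ, Nat.Iio_eq_range] at h
  exact h.trans (market_B v ⟨i, hi⟩).symm

/-- The bundles of items with the given owners. -/
def ownedAllocation (n m : ℕ) (own : ℕ → ℕ) : Allocation n m where
  bundle i := Finset.univ.filter fun j => own j = (i : ℕ) + 1
  disjoint' i i' h := Finset.disjoint_filter.2 fun j _ h1 h2 => h (Fin.ext (by omega))

theorem market_bundle (v : Fin n → budgetAdditive m) (own : ℕ → ℕ) (i : Fin n) :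
    (market v).bundle own i = ((ownedAllocation n m own).bundle i).map Fin.valEmbedding := by
  ext j
  simp only [Market.bundle, ownedAllocation, Finset.mem_filter, Finset.mem_range, Finset.mem_map,
    Finset.mem_univ, true_and, Fin.valEmbedding_apply]
  constructor
  · rintro ⟨hj, h⟩
    exact ⟨⟨j, hj⟩, h, rfl⟩
  · rintro ⟨j, h, rfl⟩
    exact ⟨j.2, h⟩

theorem market_value_bundle (v : Fin n → budgetAdditive m) (own : ℕ → ℕ) (i : Fin n) :
    (v i : Valuation m) ((ownedAllocation n m own).bundle i) =
      (market v).value i ((market v).bundle own i) := by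
  rw [market_bundle, market_value]

/-- The randomized mechanism. -/
noncomputable def mechanism (n m ℓ : ℕ) : RandomizedMechanism (budgetAdditive m) n ℓ := fun r =>
  { alloc := fun v => ownedAllocation n m ((market v).outcomeOwner (decode n m (coinNat r)))
    pay := fun v i => (market v).outcomePay (decode n m (coinNat r)) i }

theorem market_agreeOff (v : Fin n → budgetAdditive m) (i : Fin n) (v' : budgetAdditive m) :
    Market.AgreeOff (market v) (market (Function.update v i v')) i := by
  refine ⟨rfl, rfl, fun k hk => ?_, fun k hk => ?_⟩
  · funext j
    simp only [market]
    split_ifs with h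
    · rw [Function.update_of_ne fun h' => hk (congrArg Fin.val h')]
    · rfl
  · simp only [market]
    split_ifs with h
    · rw [Function.update_of_ne fun h' => hk (congrArg Fin.val h')]
    · rfl

theorem mechanism_universallyTruthful (n m ℓ : ℕ) : (mechanism n m ℓ).UniversallyTruthful := by
  intro r i v v'
  have h := Market.outcome_truthful (r := decode n m (coinNat r)) (X := market v) i.2
    (market_agreeOff v i v') (market_B_nonneg v i) (market_value_range v i.2)
  rwa [← market_value_bundle, market_bundle, market_value] at h

theorem mechanism_computedInTime (n m ℓ : ℕ) :
    (mechanism n m ℓ).ComputedInTime mainProg ((n + m + 2) ^ 46) := by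
  intro v b r hb
  have hrun := mainProg_runs
    (s := inputMem (fun i j => (v i : Valuation m) {j}) b r) (X := market v) (cn := coinNat r)
    (r := decode n m (coinNat r)) (b := fun i => if h : i < n then b ⟨i, h⟩ else 0)
    (by simp [inputMem, market]) (by simp [inputMem, market])
    (by
      funext i j
      simp [inputMem, market])
    (fun i hi => by simp [inputMem])
    -- For any valid budget, its minimum with the sum of all item values is the value of the set of
    -- all items, so the normalized input is the market.
    (fun i hi => by
      have hi' : i < n := hi
      have hbi := hb ⟨i, hi'⟩ Finset.univ
      change (market v).B i = min _ (∑ j ∈ Finset.range m, (market v).w i j)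
      rw [dif_pos hi', Finset.sum_range]
      have h1 := market_B v ⟨i, hi'⟩
      have h2 := market_w v ⟨i, hi'⟩
      simp only at h1 h2
      simp only [h1, h2, hbi])
    (by
      funext k
      simp [inputMem, coinNat])
    (Market.coinData (market v) r)
  obtain ⟨s', t, he, ht, hown, hpay⟩ := hrun
  refine ⟨s', t, he, ht.trans (mainTime_le (market v)), fun i j => ?_, fun i => hpay i i.2⟩
  rw [hown j j.2]
  simp [mechanism, ownedAllocation]

theorem mechanism_expectedWelfare (ℓ : ℕ) (v : Fin n → budgetAdditive m) :
    (mechanism n m ℓ).expectedWelfare v = (∑ r : Fin ℓ → Bool,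
      (market v).total ((market v).outcomeOwner ((market v).coins r))) / 2 ^ ℓ := by
  rw [RandomizedMechanism.expectedWelfare]
  congr 1
  refine Finset.sum_congr rfl fun r _ => ?_
  change ∑ i, _ = ∑ i ∈ Finset.range n, _
  rw [Finset.sum_range]
  exact Finset.sum_congr rfl fun i _ => market_value_bundle v _ i

/-! ### Supporting prices of a target allocation -/

/-- The bundles of an allocation, as sets of natural numbers. -/
def natBundle (A : Allocation n m) (i : ℕ) : Finset ℕ :=
  if h : i < n then (A.bundle ⟨i, h⟩).map Fin.valEmbedding else ∅

/-- The prices that support an allocation: item values, scaled down to the value of the bundle. -/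
noncomputable def supportPrice (v : Fin n → budgetAdditive m) (A : Allocation n m) (i j : ℕ) : ℝ :=
  (market v).w i j * ((market v).value i (natBundle A i) / ∑ l ∈ natBundle A i, (market v).w i l)

/-- The scaling factor is at most 1, so a subset is charged at most its sum of item values; the
whole bundle is charged at most its value, hence no subset is charged more than the budget. -/
theorem supported_natBundle (v : Fin n → budgetAdditive m) (A : Allocation n m) :
    (market v).Supported (natBundle A) (supportPrice v A) := by
  have hw := market_w_nonneg v
  have hB := market_B_nonneg v
  refine ⟨fun i j hj => ?_, fun i i' h => ?_, fun i j => ?_, fun i S hS => ?_⟩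
  · rw [natBundle] at hj
    split_ifs at hj with h
    · obtain ⟨j, -, rfl⟩ := Finset.mem_map.1 hj
      exact j.2
    · simp at hj
  · rw [natBundle, natBundle]
    split_ifs
    · rw [Finset.disjoint_map]
      exact A.disjoint' _ _ fun h' => h (congrArg Fin.val h')
    all_goals simp
  · exact mul_nonneg (hw i j) (div_nonneg (Market.value_nonneg hB hw i _)
      (Finset.sum_nonneg fun j _ => hw i j))
  · simp only [supportPrice]
    rw [← Finset.sum_mul]
    have hSsum : 0 ≤ ∑ j ∈ S, (market v).w i j := Finset.sum_nonneg fun j _ => hw i j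
    have hle : ∑ j ∈ S, (market v).w i j ≤ ∑ j ∈ natBundle A i, (market v).w i j :=
      Finset.sum_le_sum_of_subset_of_nonneg hS fun j _ _ => hw i j
    have hv := Market.value_nonneg hB hw i (natBundle A i)
    have hv1 : (market v).value i (natBundle A i) ≤ (market v).B i := min_le_left _ _
    have hv2 : (market v).value i (natBundle A i) ≤ ∑ j ∈ natBundle A i, (market v).w i j :=
      min_le_right _ _
    -- If all item values in the bundle vanish, division by zero makes the prices 0.
    rcases (hSsum.trans hle).eq_or_lt with h0 | h0
    · rw [← h0, div_zero, mul_zero]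
      exact le_min (hB i) hSsum
    · refine le_min ?_ ?_
      · refine le_trans ?_ hv1
        rw [mul_div_left_comm]
        exact mul_le_of_le_one_right hv (div_le_one_of_le₀ hle h0.le)
      · exact mul_le_of_le_one_right hSsum (div_le_one_of_le₀ hv2 h0.le)

theorem sum_supportPrice (v : Fin n → budgetAdditive m) (A : Allocation n m) (i : Fin n) :
    ∑ j ∈ natBundle A i, supportPrice v A i j = (v i : Valuation m) (A.bundle i) := by
  have hb : natBundle A i = (A.bundle i).map Fin.valEmbedding := by simp [natBundle]
  rw [← market_value, ← hb]
  simp only [supportPrice]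
  rw [← Finset.sum_mul]
  by_cases h0 : ∑ j ∈ natBundle A i, (market v).w i j = 0
  · rw [h0, div_zero, mul_zero, Market.value, h0, min_eq_right (market_B_nonneg v i)]
  · rw [mul_div_cancel₀ _ h0]

theorem welfare_le_expectedWelfare {ℓ : ℕ} (hℓ : n + n + 2 + levelBits m ≤ ℓ)
    (v : Fin n → budgetAdditive m) (A : Allocation n m) :
    welfare v A ≤ 128 * blocks m * (mechanism n m ℓ).expectedWelfare v := by
  have h := (supported_natBundle v A).approximation (ℓ := ℓ) (market_B_nonneg v)
    (market_w_nonneg v) (fun i hi => market_value_range v hi) hℓ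
  rw [mechanism_expectedWelfare]
  refine le_trans (le_of_eq ?_) h
  change ∑ i, _ = ∑ i ∈ Finset.range n, _
  rw [Finset.sum_range]
  exact Finset.sum_congr rfl fun i _ => (sum_supportPrice v A i).symm

end BudgetAuction

theorem mainTheorem4 :
    ∃ (C : ℝ) (d e : ℕ) (P : BudgetAuction.Program)
      (M : ∀ n m : ℕ, BudgetAuction.RandomizedMechanism
        (BudgetAuction.budgetAdditive m) n ((n + m + 2) ^ d)),
      0 < C ∧
      ∀ n m : ℕ,
        (M n m).UniversallyTruthful ∧
        (M n m).ComputedInTime P ((n + m + 2) ^ e) ∧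
        (2 ≤ m → ∀ (v : Fin n → BudgetAuction.budgetAdditive m)
          (A : BudgetAuction.Allocation n m),
          BudgetAuction.welfare v A
            ≤ C * Real.sqrt (Real.log m) * (M n m).expectedWelfare v) := by
  -- The constant is $768=128\cdot6$, from `welfare_le_expectedWelfare` and `blocks_le_sqrt_log`.
  -- The exponent 2 gives room for the `2 * n + 2 + levelBits m` coins in use; the remaining coins
  -- are ignored.
  refine ⟨768, 2, 46, BudgetAuction.mainProg, fun n m => BudgetAuction.mechanism n m _,
    by norm_num, fun n m => ⟨BudgetAuction.mechanism_universallyTruthful _ _ _,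
      BudgetAuction.mechanism_computedInTime _ _ _, fun hm v A => ?_⟩⟩
  have hℓ : n + n + 2 + BudgetAuction.levelBits m ≤ (n + m + 2) ^ 2 := by
    have := BudgetAuction.levelBits_le m
    nlinarith
  refine (BudgetAuction.welfare_le_expectedWelfare hℓ v A).trans ?_
  have hE : 0 ≤ (BudgetAuction.mechanism n m ((n + m + 2) ^ 2)).expectedWelfare v := by
    refine div_nonneg (Finset.sum_nonneg fun r _ => Finset.sum_nonneg fun i _ => ?_) (by positivity)
    exact BudgetAuction.Valuation.nonneg _ _
  refine mul_le_mul_of_nonneg_right ?_ hE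
  linarith [BudgetAuction.blocks_le_sqrt_log hm]
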